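/- Let $A\in C^2(\mathbb R)$ be strictly convex and let $\eta\in C^2(\mathbb R)$ satisfy $\eta''>0$ on $\mathbb R$; put $\eta(x|y)=\eta(x)-\eta(y)-\eta'(y)(x-y)$. Let $C_L>C_R$, let $S_0(x)=C_L$ for $x<0$ and $S_0(x)=C_R$ for $x\ge 0$, and let $\sigma=\frac{A(C_L)-A(C_R)}{C_L-C_R}$. Let $M,K\ge 0$. Then there is $\varepsilon_0>0$, depending only on $A,\eta,C_L,C_R,M,K$, and for every $T>0$ there is $C^*>0$, depending only on $A,\eta,C_L,C_R,M,K,T$, such that the following holds. Let $U_0\in L^\infty(\mathbb R)\cap BV_{loc}(\mathbb R)$ be such that $U_0-S_0\in L^2(\mathbb R)$, the positive part $(\frac{d}{dx}U_0)_+$ of the Radon measure $\frac{d}{dx}U_0$ belongs to $L^2(\mathbb R)$, $\|U_0\|_{L^\infty}\le M$ and $\|(\frac{d}{dx}U_0)_+\|_{L^2}\le K$. Let $0<\varepsilon\le\varepsilon_0$ and let $U$ be a bounded solution of $$\partial_tU+\partial_xA(U)=\varepsilon\,\partial_{xx}^2U\quad\text{on }(0,T)\times\mathbb R,\qquad U(0,\cdot)=U_0,$$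 that is, $U$ is bounded, $C^1$ in $t$ and $C^2$ in $x$ for $0<t<T$, satisfies the equation pointwise there, and $U(t,\cdot)\to U_0$ in $L^1_{loc}(\mathbb R)$ as $t\to0^+$. Then there is a Lipschitz curve $X:[0,T]\to\mathbb R$ with $X(0)=0$ and $|\dot X(t)|\le C^*$ for almost every $t\in(0,T)$ such that, with $S(t,x)=S_0(x-X(t))$: (I) for all $0<t<T$ and all $\alpha$ with $\varepsilon\le\alpha\le\varepsilon_0$, $$\int_{\{|x-X(t)|\ge C^*\alpha\}}\eta(U(t,x)|S(t,x))\,dx\le\int_{\mathbb R}\eta(U_0(x)|S_0(x))\,dx+C^*e^{-\alpha/\varepsilon},$$ where the integrand on the left is integrable; (II) for all $0<t<T$, $$|X(t)-\sigma t|^2\le C^*t^{2/3}\Big(\int_{\mathbb R}\eta(U_0(x)|S_0(x))\,dx+\varepsilon\log(1/\varepsilon)\Big).$$ -/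

import Mathlib

open MeasureTheory Set Filter Topology
open scoped NNReal ENNReal ContDiff

/-- The inviscid shock profile: `CL` to the left of the origin, `CR` to the right. -/
noncomputable def shockProfile (CL CR x : ℝ) : ℝ := if x < 0 then CL else CR

/-- The Rankine–Hugoniot speed of the shock. -/
noncomputable def shockSpeed (A : ℝ → ℝ) (CL CR : ℝ) : ℝ := (A CL - A CR) / (CL - CR)

/-- The relative entropy `η(x|y) = η(x) - η(y) - η'(y)(x - y)`. -/
noncomputable def relEntropy (η : ℝ → ℝ) (x y : ℝ) : ℝ := η x - η y - deriv η y * (x - y)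

/-- The distributional derivative of `u` is the (signed) Radon measure whose Jordan
decomposition is `μp - μn`. -/
structure HasDerivMeasure (u : ℝ → ℝ) (μp μn : Measure ℝ) : Prop where
  locallyFinite_pos : IsLocallyFiniteMeasure μp
  locallyFinite_neg : IsLocallyFiniteMeasure μn
  mutuallySingular : μp ⟂ₘ μn
  integral_mul_deriv : ∀ φ : ℝ → ℝ, ContDiff ℝ ∞ φ → HasCompactSupport φ →
    ∫ x, u x * deriv φ x = -((∫ x, φ x ∂μp) - ∫ x, φ x ∂μn)

/-- Functions of locally bounded variation on the line: locally integrable functions whose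
distributional derivative is a Radon measure. -/
def MemBVLoc (u : ℝ → ℝ) : Prop :=
  LocallyIntegrable u volume ∧ ∃ μp μn : Measure ℝ, HasDerivMeasure u μp μn

/-- The positive part `(u')₊` of the derivative measure of `u` is absolutely continuous with
respect to Lebesgue measure, with the nonnegative measurable density `g`. -/
def HasDerivPosPart (u g : ℝ → ℝ) : Prop :=
  AEMeasurable g volume ∧ (∀ᵐ x, 0 ≤ g x) ∧
    ∃ μp μn : Measure ℝ, HasDerivMeasure u μp μn ∧
      μp = volume.withDensity (fun x => ENNReal.ofReal (g x))

/-- `U` is a bounded solution on `(0,T) × ℝ` of the Cauchy problem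
`∂ₜU + ∂ₓA(U) = ε ∂ₓₓU`, `U(0,·) = U₀`: it is of class `C¹` in time and `C²` in space for
`0 < t < T`, and it takes its initial value in the sense of `L¹_loc`. -/
structure IsViscousSolution (A : ℝ → ℝ) (ε T : ℝ) (U₀ : ℝ → ℝ) (U : ℝ → ℝ → ℝ) : Prop where
  bounded : ∃ B : ℝ, ∀ t ∈ Ioo 0 T, ∀ x, |U t x| ≤ B
  continuousOn : ContinuousOn (fun p : ℝ × ℝ => U p.1 p.2) (Ioo 0 T ×ˢ univ)
  differentiableAt_time : ∀ t ∈ Ioo 0 T, ∀ x, DifferentiableAt ℝ (fun s => U s x) t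
  continuousOn_deriv_time :
    ContinuousOn (fun p : ℝ × ℝ => deriv (fun s => U s p.2) p.1) (Ioo 0 T ×ˢ univ)
  contDiff_space : ∀ t ∈ Ioo 0 T, ContDiff ℝ 2 (U t)
  continuousOn_deriv_space :
    ContinuousOn (fun p : ℝ × ℝ => deriv (U p.1) p.2) (Ioo 0 T ×ˢ univ)
  continuousOn_deriv_deriv_space :
    ContinuousOn (fun p : ℝ × ℝ => deriv (deriv (U p.1)) p.2) (Ioo 0 T ×ˢ univ)
  equation : ∀ t ∈ Ioo 0 T, ∀ x,
    deriv (fun s => U s x) t + deriv (fun y => A (U t y)) x = ε * deriv (deriv (U t)) x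
  initial : ∀ R : ℝ, 0 < R →
    Tendsto (fun t => ∫ x in Icc (-R) R, |U t x - U₀ x|) (𝓝[>] 0) (𝓝 0)

/-! ### Truncated powers and a polynomial cutoff -/

/-! The method is relative entropy with a moving shift. For a constant state `C`, the function `h =
η(·|C)` is a convex entropy with flux `relFlux`, and across a curve of speed `b` what counts is
`relFlux - b h = (critSpeed - b) h`. Since `A` is strictly convex, `critSpeed` is strictly
increasing in `C` (`critSpeed_lt`), so at each value `v` there is a gap between the critical speeds
of `CR` and `CL`. A speed `b(v)` inside this gap dissipates entropy on both sides of the curve with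
a uniform margin `c`. As `critSpeed` is also monotone in `u`, this persists when the states on the
left are not much below `v` and those on the right not much above it (`exists_dissipative_speed`).

The value `v` is the mean of the solution around the shift at scale `ε`, which makes the equation
for `X` a Lipschitz ODE (`exists_shift`). The one-sided closeness to `v` comes from the `L²` bound
on the positive part of `U₀'`: by Young's inequality `U₀` has the affine one-sided modulus `N (y -
x) + K² / (4 N)` (`ae_prod_sub_le`), and the equation preserves such a modulus
(`IsViscousSolution.sub_le_of_initial`). The latter is proved by doubling the space variable, where
convexity of `A` controls the term produced by the slope `N`. Taking `N` large makes the modulus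
small up to a distance that does not depend on `ε`.

On each half-line the entropy is weighted by a layer equal to `1` up to distance `α/c` from the
shift and then decaying at rate `c/ε`. Before the shift the dissipation margin absorbs the diffusion
of the weight; near and beyond the shift nothing is known, but there the weight is of size `exp
(-α/ε)` (`lintegral_half_line_le`). Adding both sides gives (I) (`exists_shift_lintegral_le`). No
decay at infinity is known beforehand, so every weighted estimate carries a polynomial cutoff whose
derivatives are absorbed by Gronwall's inequality, and the cutoff is removed by Fatou's lemma
(`lintegral_mul_weight_le`). The same inequality applied to truncated cubes is the maximum
principle.

For (II) the equation is tested with a bump that follows the shift (`abs_shift_sub_le`). An exact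
shock would contribute the jump times `σ - X'`, and the discrepancy is controlled by the `L¹`
distance to the shifted shock on a window of half-width `t`. By Cauchy–Schwarz and the estimate
behind (I), with `α = ε log (1/ε)` so that `exp (-α/ε) = ε`, that distance is of order `√(t E)`,
where `E` is the bracket in (II). This yields a bound linear in `t`, which on `(0,T)` implies the
stated power `2/3`. -/

theorem hasDerivAt_max_zero_pow (n : ℕ) (s : ℝ) :
    HasDerivAt (fun s : ℝ => (max s 0) ^ (n + 2)) ((n + 2 : ℝ) * (max s 0) ^ (n + 1)) s := by
  rcases lt_trichotomy s 0 with hs | hs | hs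
  · have h0 : (fun s : ℝ => (max s 0) ^ (n + 2)) =ᶠ[𝓝 s] fun _ => (0 : ℝ) := by
      filter_upwards [Iio_mem_nhds hs] with y hy
      simp [max_eq_right (le_of_lt (show y < 0 from hy))]
    have := (hasDerivAt_const s (0 : ℝ)).congr_of_eventuallyEq h0
    simpa [max_eq_right hs.le] using this
  · subst hs
    simp only [max_self, ne_eq, Nat.add_eq_zero_iff, one_ne_zero, and_false, not_false_eq_true,
      zero_pow, mul_zero]
    rw [hasDerivAt_iff_isLittleO]
    have h1 : (fun y : ℝ => y ^ (n + 2)) =o[𝓝 0] fun y : ℝ => y := by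
      have := Asymptotics.isLittleO_pow_pow (𝕜 := ℝ) (m := 1) (n := n + 2) (by omega)
      simpa using this
    refine Asymptotics.IsLittleO.congr' (f₁ := fun y : ℝ => (max y 0) ^ (n + 2))
      (g₁ := fun y : ℝ => y) ?_ ?_ ?_
    · refine Asymptotics.IsBigO.trans_isLittleO ?_ h1
      refine Asymptotics.IsBigO.of_bound 1 (Eventually.of_forall fun y => ?_)
      rw [one_mul, norm_pow, norm_pow]
      gcongr
      rw [Real.norm_eq_abs, Real.norm_eq_abs, abs_of_nonneg (le_max_right _ _)]
      exact max_le (le_abs_self y) (abs_nonneg y)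
    · exact Eventually.of_forall fun y => by simp
    · exact Eventually.of_forall fun y => by simp
  · have h0 : (fun s : ℝ => (max s 0) ^ (n + 2)) =ᶠ[𝓝 s] fun s => s ^ (n + 2) := by
      filter_upwards [Ioi_mem_nhds hs] with y hy
      simp [max_eq_left (le_of_lt (show 0 < y from hy))]
    have := (hasDerivAt_pow (n + 2) s).congr_of_eventuallyEq h0
    rw [max_eq_left hs.le]
    exact this.congr_deriv (by push_cast; rfl)

/-- A `C²` bump equal to `1` at the origin and supported in `[-R, R]`. -/
noncomputable def cutoff (R x : ℝ) : ℝ := (max (1 - x ^ 2 / R ^ 2) 0) ^ 4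

/-- The derivative of `cutoff R`. -/
noncomputable def cutoffD (R x : ℝ) : ℝ := 4 * (max (1 - x ^ 2 / R ^ 2) 0) ^ 3 * (-(2 * x / R ^ 2))

/-- The second derivative of `cutoff R`. -/
noncomputable def cutoffDD (R x : ℝ) : ℝ :=
  12 * (max (1 - x ^ 2 / R ^ 2) 0) ^ 2 * (-(2 * x / R ^ 2)) ^ 2
    + 4 * (max (1 - x ^ 2 / R ^ 2) 0) ^ 3 * (-(2 / R ^ 2))

theorem hasDerivAt_one_sub_sq_div (R x : ℝ) :
    HasDerivAt (fun x : ℝ => 1 - x ^ 2 / R ^ 2) (-(2 * x / R ^ 2)) x := by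
  have := ((hasDerivAt_pow 2 x).div_const (R ^ 2)).const_sub 1
  simpa using this

theorem hasDerivAt_cutoff (R x : ℝ) : HasDerivAt (cutoff R) (cutoffD R x) x := by
  have := (hasDerivAt_max_zero_pow 2 (1 - x ^ 2 / R ^ 2)).comp x (hasDerivAt_one_sub_sq_div R x)
  refine (this.congr_deriv ?_)
  simp only [cutoffD]; norm_num

theorem hasDerivAt_cutoffD (R x : ℝ) : HasDerivAt (cutoffD R) (cutoffDD R x) x := by
  have h1 := (hasDerivAt_max_zero_pow 1 (1 - x ^ 2 / R ^ 2)).comp x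
    (hasDerivAt_one_sub_sq_div R x)
  have h2 : HasDerivAt (fun x : ℝ => -(2 * x / R ^ 2)) (-(2 / R ^ 2)) x := by
    exact (((hasDerivAt_id x).const_mul 2).div_const (R ^ 2)).neg.congr_deriv (by simp)
  refine ((h1.const_mul 4).mul h2).congr_deriv ?_
  simp only [cutoffDD, Function.comp]; norm_num; ring

theorem continuous_cutoff (R : ℝ) : Continuous (cutoff R) := by
  unfold cutoff; fun_prop

theorem continuous_cutoffD (R : ℝ) : Continuous (cutoffD R) := by
  unfold cutoffD; fun_prop

theorem continuous_cutoffDD (R : ℝ) : Continuous (cutoffDD R) := by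
  unfold cutoffDD; fun_prop

theorem one_sub_sq_div_nonpos {R x : ℝ} (hR : 0 < R) (hx : R ≤ |x|) : 1 - x ^ 2 / R ^ 2 ≤ 0 := by
  rw [sub_nonpos, le_div_iff₀ (by positivity), one_mul, ← sq_abs x]
  gcongr

theorem cutoff_eq_zero {R x : ℝ} (hR : 0 < R) (hx : R ≤ |x|) : cutoff R x = 0 := by
  simp [cutoff, max_eq_right (one_sub_sq_div_nonpos hR hx)]

theorem cutoffD_eq_zero {R x : ℝ} (hR : 0 < R) (hx : R ≤ |x|) : cutoffD R x = 0 := by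
  simp [cutoffD, max_eq_right (one_sub_sq_div_nonpos hR hx)]

theorem cutoffDD_eq_zero {R x : ℝ} (hR : 0 < R) (hx : R ≤ |x|) : cutoffDD R x = 0 := by
  simp [cutoffDD, max_eq_right (one_sub_sq_div_nonpos hR hx)]

theorem cutoff_nonneg (R x : ℝ) : 0 ≤ cutoff R x := by unfold cutoff; positivity

theorem max_one_sub_sq_div_mem (R x : ℝ) : max (1 - x ^ 2 / R ^ 2) 0 ∈ Icc (0 : ℝ) 1 :=
  ⟨le_max_right _ _, max_le (by linarith [show 0 ≤ x ^ 2 / R ^ 2 by positivity]) zero_le_one⟩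

theorem cutoff_le_one (R x : ℝ) : cutoff R x ≤ 1 :=
  pow_le_one₀ (max_one_sub_sq_div_mem R x).1 (max_one_sub_sq_div_mem R x).2

theorem cutoff_zero (R : ℝ) : cutoff R 0 = 1 := by simp [cutoff]

theorem cutoffD_zero (R : ℝ) : cutoffD R 0 = 0 := by simp [cutoffD]

theorem abs_cutoffD_le {R : ℝ} (hR : 0 < R) (x : ℝ) :
    |cutoffD R x| ≤ 8 * ((max (1 - x ^ 2 / R ^ 2) 0) ^ 3 / R) := by
  have hq := (max_one_sub_sq_div_mem R x).1
  rcases le_total R |x| with hx | hx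
  · rw [cutoffD_eq_zero hR hx, abs_zero]; positivity
  · unfold cutoffD
    rw [abs_mul, abs_mul, abs_neg, abs_div, abs_mul, abs_of_nonneg (pow_nonneg hq 3),
      abs_of_pos (by norm_num : (0 : ℝ) < 4), abs_of_pos (by norm_num : (0 : ℝ) < 2),
      abs_of_pos (by positivity : 0 < R ^ 2)]
    have : 2 * |x| / R ^ 2 ≤ 2 / R := by
      rw [div_le_div_iff₀ (by positivity) hR]; nlinarith
    calc _ ≤ 4 * (max (1 - x ^ 2 / R ^ 2) 0) ^ 3 * (2 / R) := by gcongr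
      _ = _ := by ring

theorem abs_cutoffDD_le {R : ℝ} (hR : 0 < R) (x : ℝ) :
    |cutoffDD R x| ≤ 56 * ((max (1 - x ^ 2 / R ^ 2) 0) ^ 2 / R ^ 2) := by
  have hq := (max_one_sub_sq_div_mem R x).1
  have hq1 := (max_one_sub_sq_div_mem R x).2
  rcases le_total R |x| with hx | hx
  · rw [cutoffDD_eq_zero hR hx, abs_zero]; positivity
  · unfold cutoffDD
    set q := max (1 - x ^ 2 / R ^ 2) 0
    have hx2 : x ^ 2 ≤ R ^ 2 := by rw [← sq_abs x]; gcongr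
    have h1 : (-(2 * x / R ^ 2)) ^ 2 ≤ 4 / R ^ 2 := by
      have : (-(2 * x / R ^ 2)) ^ 2 = 4 * (x ^ 2 / R ^ 2) / R ^ 2 := by field_simp; ring
      rw [this]
      gcongr
      have : x ^ 2 / R ^ 2 ≤ 1 := by rw [div_le_one (by positivity)]; exact hx2
      linarith
    have h3 : q ^ 3 ≤ q ^ 2 := pow_le_pow_of_le_one hq hq1 (by norm_num)
    refine (abs_add_le _ _).trans ?_
    have e1 : |12 * q ^ 2 * (-(2 * x / R ^ 2)) ^ 2| ≤ 12 * q ^ 2 * (4 / R ^ 2) := by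
      rw [abs_of_nonneg (by positivity)]; gcongr
    have e2 : |4 * q ^ 3 * (-(2 / R ^ 2))| ≤ 4 * q ^ 2 * (2 / R ^ 2) := by
      rw [abs_mul, abs_neg, abs_of_nonneg (by positivity : 0 ≤ 2 / R ^ 2),
        abs_of_nonneg (by positivity : 0 ≤ 4 * q ^ 3)]
      gcongr
    calc _ ≤ 12 * q ^ 2 * (4 / R ^ 2) + 4 * q ^ 2 * (2 / R ^ 2) := add_le_add e1 e2
      _ = _ := by ring

theorem abs_cutoffD_le_div {R : ℝ} (hR : 0 < R) (x : ℝ) : |cutoffD R x| ≤ 8 / R := by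
  refine (abs_cutoffD_le hR x).trans ?_
  rw [mul_div_assoc']
  gcongr
  have := pow_le_one₀ (n := 3) (max_one_sub_sq_div_mem R x).1 (max_one_sub_sq_div_mem R x).2
  linarith

theorem abs_cutoffDD_le_div {R : ℝ} (hR : 0 < R) (x : ℝ) : |cutoffDD R x| ≤ 56 / R ^ 2 := by
  refine (abs_cutoffDD_le hR x).trans ?_
  rw [mul_div_assoc']
  gcongr
  have := pow_le_one₀ (n := 2) (max_one_sub_sq_div_mem R x).1 (max_one_sub_sq_div_mem R x).2
  linarith

/-- If `q ≥ 1/n`, a factor `1/n` can be traded for the power of `q` lost by differentiating `q⁴`; if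
`q ≤ 1/n`, the left side is itself at most `n⁻⁵`. The remainder `n⁻⁵` is harmless: over a support of
length `2 n²` it integrates to order `n⁻³`, and over the square of that support to order `n⁻¹`. -/
theorem pow_three_div_le {q n : ℝ} (hq : 0 ≤ q) (hn : 1 ≤ n) :
    q ^ 3 / n ^ 2 ≤ q ^ 4 / n + 1 / n ^ 5 := by
  have hn0 : 0 < n := by linarith
  rcases le_total (1 / n) q with h | h
  · have : q ^ 3 / n ^ 2 ≤ q ^ 4 / n := by
      calc q ^ 3 / n ^ 2 = q ^ 3 * (1 / n) / n := by field_simp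
        _ ≤ q ^ 3 * q / n := by gcongr
        _ = _ := by ring
    have : 0 ≤ 1 / n ^ 5 := by positivity
    linarith
  · have : q ^ 3 / n ^ 2 ≤ 1 / n ^ 5 := by
      calc q ^ 3 / n ^ 2 ≤ (1 / n) ^ 3 / n ^ 2 := by gcongr
        _ = _ := by field_simp
    have : 0 ≤ q ^ 4 / n := by positivity
    linarith

theorem pow_two_div_le {q n : ℝ} (hq : 0 ≤ q) (hn : 1 ≤ n) :
    q ^ 2 / (n ^ 2) ^ 2 ≤ q ^ 4 / n + 1 / n ^ 5 := by
  have hn0 : 0 < n := by linarith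
  rcases le_total (1 / n) q with h | h
  · have : q ^ 2 / (n ^ 2) ^ 2 ≤ q ^ 4 / n := by
      calc q ^ 2 / (n ^ 2) ^ 2 = q ^ 2 * (1 / n) ^ 2 / n ^ 2 := by field_simp
        _ ≤ q ^ 2 * q ^ 2 / n ^ 2 := by gcongr
        _ ≤ q ^ 2 * q ^ 2 / n := by
          gcongr
          nlinarith
        _ = _ := by ring
    have : 0 ≤ 1 / n ^ 5 := by positivity
    linarith
  · have : q ^ 2 / (n ^ 2) ^ 2 ≤ 1 / n ^ 5 := by
      calc q ^ 2 / (n ^ 2) ^ 2 ≤ (1 / n) ^ 2 / (n ^ 2) ^ 2 := by gcongr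
        _ = 1 / n ^ 6 := by field_simp
        _ ≤ _ := by
          gcongr
          norm_num
    have : 0 ≤ q ^ 4 / n := by positivity
    linarith

/-- The derivatives of the cutoff at scale `n²` are controlled by the cutoff itself, up to an
error that is negligible compared with the size of the support. -/
theorem abs_cutoffD_sq_le {n : ℝ} (hn : 1 ≤ n) (x : ℝ) :
    |cutoffD (n ^ 2) x| ≤ 56 * (cutoff (n ^ 2) x / n + 1 / n ^ 5) := by
  have hn0 : 0 < n := by linarith
  have h1 := abs_cutoffD_le (R := n ^ 2) (by positivity) x
  have h2 := pow_three_div_le (max_one_sub_sq_div_mem (n ^ 2) x).1 hn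
  have h3 : 0 ≤ cutoff (n ^ 2) x / n + 1 / n ^ 5 := by have := cutoff_nonneg (n ^ 2) x; positivity
  unfold cutoff at h3 ⊢
  linarith

theorem abs_cutoffDD_sq_le {n : ℝ} (hn : 1 ≤ n) (x : ℝ) :
    |cutoffDD (n ^ 2) x| ≤ 56 * (cutoff (n ^ 2) x / n + 1 / n ^ 5) := by
  have h1 := abs_cutoffDD_le (R := n ^ 2) (by positivity) x
  have h2 := pow_two_div_le (max_one_sub_sq_div_mem (n ^ 2) x).1 hn
  unfold cutoff
  linarith

theorem cutoff_mono {R R' : ℝ} (hR : 0 < R) (h : R ≤ R') (x : ℝ) : cutoff R x ≤ cutoff R' x := by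
  unfold cutoff
  gcongr

theorem tendsto_cutoff (x : ℝ) : Tendsto (fun R => cutoff R x) atTop (𝓝 1) := by
  have h1 : Tendsto (fun R : ℝ => x ^ 2 / R ^ 2) atTop (𝓝 0) :=
    tendsto_const_nhds.div_atTop (tendsto_pow_atTop two_ne_zero)
  have h2 : Tendsto (fun R : ℝ => (max (1 - x ^ 2 / R ^ 2) 0) ^ 4) atTop
      (𝓝 ((max (1 - 0) 0) ^ 4)) :=
    ((tendsto_const_nhds.sub h1).max tendsto_const_nhds).pow 4
  simpa [cutoff] using h2

/-! ### Gronwall's inequality from the initial time -/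

/-- The function `f(s) exp (-C s) - e s` is antitone on the open interval. The initial value enters
only through some times tending to `0`, because solutions live on `0 < t < T` and attain their data
weakly. Dropping a factor `exp (-C s) ≤ 1` from `f₀` is what calls for `max f₀ 0`. -/
theorem le_exp_mul_of_deriv_le {f f' : ℝ → ℝ} {T C e f₀ t : ℝ} (hC : 0 ≤ C) (he : 0 ≤ e)
    (hf : ∀ s ∈ Ioo 0 T, HasDerivAt f (f' s) s) (hf' : ∀ s ∈ Ioo 0 T, f' s ≤ C * f s + e)
    (h0 : ∀ δ > 0, ∃ᶠ s in 𝓝[>] (0 : ℝ), f s ≤ f₀ + δ) (ht : t ∈ Ioo 0 T) :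
    f t ≤ Real.exp (C * t) * (max f₀ 0 + e * t) := by
  set G : ℝ → ℝ := fun s => f s * Real.exp (-(C * s)) - e * s with hG
  have hGd : ∀ s ∈ Ioo 0 T, HasDerivAt G
      (f' s * Real.exp (-(C * s)) + f s * (Real.exp (-(C * s)) * (-C)) - e) s := by
    intro s hs
    have h1 : HasDerivAt (fun s : ℝ => Real.exp (-(C * s))) (Real.exp (-(C * s)) * (-C)) s := by
      have := ((hasDerivAt_id s).const_mul C).neg.exp
      simpa using this
    have h2 : HasDerivAt (fun s : ℝ => e * s) e s := by
      simpa using (hasDerivAt_id s).const_mul e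
    exact ((hf s hs).mul h1).sub h2
  have hanti : AntitoneOn G (Ioo 0 T) := by
    refine antitoneOn_of_deriv_nonpos (convex_Ioo 0 T)
      (fun s hs => (hGd s hs).continuousAt.continuousWithinAt)
      (fun s hs => (hGd s (interior_subset hs)).differentiableAt.differentiableWithinAt) ?_
    intro s hs
    rw [interior_Ioo] at hs
    rw [(hGd s hs).deriv]
    have h1 := hf' s hs
    have hp := Real.exp_pos (-(C * s))
    have hp1 : Real.exp (-(C * s)) ≤ 1 := by
      rw [Real.exp_le_one_iff]; nlinarith [hs.1]
    nlinarith
  have hGt : G t ≤ max f₀ 0 := by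
    refine le_of_forall_pos_le_add fun δ hδ => ?_
    have hev : ∀ᶠ s in 𝓝[>] (0 : ℝ), s ∈ Ioo 0 t := Ioo_mem_nhdsGT ht.1
    obtain ⟨s, hs1, hs2⟩ := ((h0 δ hδ).and_eventually hev).exists
    have h1 := hanti ⟨hs2.1, hs2.2.trans ht.2⟩ ht hs2.2.le
    have hp := Real.exp_pos (-(C * s))
    have hp1 : Real.exp (-(C * s)) ≤ 1 := by
      rw [Real.exp_le_one_iff]; nlinarith [hs2.1]
    refine h1.trans ?_
    have h3 : f s * Real.exp (-(C * s)) ≤ max f₀ 0 + δ := by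
      calc f s * Real.exp (-(C * s)) ≤ (max f₀ 0 + δ) * Real.exp (-(C * s)) := by
            gcongr; exact hs1.trans (by gcongr; exact le_max_left _ _)
        _ ≤ (max f₀ 0 + δ) * 1 := by
            gcongr
        _ = _ := mul_one _
    have : 0 ≤ e * s := mul_nonneg he hs2.1.le
    simp only [hG]; linarith
  have h4 : f t = Real.exp (C * t) * (G t + e * t) := by
    simp only [hG]
    rw [sub_add_cancel, mul_comm, mul_assoc, ← Real.exp_add]; simp
  rw [h4]
  gcongr

/-! ### Regularity of viscous solutions -/

namespace IsViscousSolution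

variable {A : ℝ → ℝ} {ε T : ℝ} {U₀ : ℝ → ℝ} {U : ℝ → ℝ → ℝ}

theorem hasDerivAt_space (hU : IsViscousSolution A ε T U₀ U) {t : ℝ} (ht : t ∈ Ioo 0 T) (x : ℝ) :
    HasDerivAt (U t) (deriv (U t) x) x :=
  ((hU.contDiff_space t ht).differentiable (by norm_num) x).hasDerivAt

theorem hasDerivAt_deriv_space (hU : IsViscousSolution A ε T U₀ U) {t : ℝ} (ht : t ∈ Ioo 0 T)
    (x : ℝ) : HasDerivAt (deriv (U t)) (deriv (deriv (U t)) x) x := by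
  have h : ContDiff ℝ (1 + 1) (U t) := hU.contDiff_space t ht
  exact ((contDiff_succ_iff_deriv.1 h).2.2.differentiable (by norm_num) x).hasDerivAt

theorem continuous_space (hU : IsViscousSolution A ε T U₀ U) {t : ℝ} (ht : t ∈ Ioo 0 T) :
    Continuous (U t) := (hU.contDiff_space t ht).continuous

theorem continuous_deriv_space (hU : IsViscousSolution A ε T U₀ U) {t : ℝ} (ht : t ∈ Ioo 0 T) :
    Continuous (deriv (U t)) :=
  continuous_iff_continuousAt.2 fun x => (hU.hasDerivAt_deriv_space ht x).continuousAt

theorem continuous_slice {f : ℝ × ℝ → ℝ} (hf : ContinuousOn f (Ioo 0 T ×ˢ univ)) {t : ℝ}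
    (ht : t ∈ Ioo 0 T) : Continuous fun x => f (t, x) :=
  hf.comp_continuous (by fun_prop) fun _ => ⟨ht, mem_univ _⟩

theorem continuous_deriv_deriv_space (hU : IsViscousSolution A ε T U₀ U) {t : ℝ}
    (ht : t ∈ Ioo 0 T) : Continuous (deriv (deriv (U t))) :=
  continuous_slice hU.continuousOn_deriv_deriv_space ht

theorem continuous_deriv_time (hU : IsViscousSolution A ε T U₀ U) {t : ℝ} (ht : t ∈ Ioo 0 T) :
    Continuous fun x => deriv (fun s => U s x) t :=
  continuous_slice hU.continuousOn_deriv_time ht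

theorem deriv_time_eq (hA : ContDiff ℝ 2 A) (hU : IsViscousSolution A ε T U₀ U) {t : ℝ}
    (ht : t ∈ Ioo 0 T) (x : ℝ) :
    deriv (fun s => U s x) t =
      ε * deriv (deriv (U t)) x - deriv A (U t x) * deriv (U t) x := by
  have h1 : HasDerivAt (fun y => A (U t y)) (deriv A (U t x) * deriv (U t) x) x :=
    ((hA.differentiable (by norm_num) (U t x)).hasDerivAt).comp x (hU.hasDerivAt_space ht x)
  have h2 := hU.equation t ht x
  rw [h1.deriv] at h2
  linarith

end IsViscousSolution

/-! ### The weak form of the equation against a moving weight -/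

theorem exists_abs_le_of_eq_zero {φ : ℝ → ℝ} (hφ : Continuous φ) {R : ℝ}
    (h0 : ∀ y, R ≤ |y| → φ y = 0) : ∃ D, 0 ≤ D ∧ ∀ y, |φ y| ≤ D := by
  obtain ⟨D, hD⟩ := (isCompact_Icc (a := -R) (b := R)).exists_bound_of_continuousOn hφ.continuousOn
  refine ⟨max D 0, le_max_right _ _, fun y => ?_⟩
  rcases le_total R |y| with hy | hy
  · rw [h0 y hy]; simp
  · exact (hD y (abs_le.1 hy)).trans (le_max_left _ _)

theorem hasCompactSupport_of_eq_zero {f : ℝ → ℝ} {R : ℝ} (h0 : ∀ y, R ≤ |y| → f y = 0) :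
    HasCompactSupport f := by
  refine HasCompactSupport.intro (isCompact_Icc (a := -R) (b := R)) fun x hx => h0 x ?_
  by_contra hlt
  exact hx (abs_le.1 (not_le.1 hlt).le)

theorem hasCompactSupport_comp_sub {f : ℝ → ℝ} {R : ℝ} (h0 : ∀ y, R ≤ |y| → f y = 0) (a : ℝ) :
    HasCompactSupport fun x => f (x - a) := by
  refine hasCompactSupport_of_eq_zero (R := R + |a|) fun x hx => h0 _ ?_
  have := abs_sub_abs_le_abs_sub x a
  linarith

section WeakForm

variable {A : ℝ → ℝ} {ε T : ℝ} {U₀ : ℝ → ℝ} {U : ℝ → ℝ → ℝ}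

theorem hasDerivAt_integral_mul_weight_aux (hU : IsViscousSolution A ε T U₀ U)
    {h h1 : ℝ → ℝ} (hh : ∀ u, HasDerivAt h (h1 u) u) (hh1 : Continuous h1)
    {φ φ1 : ℝ → ℝ} (hφ : ∀ y, HasDerivAt φ (φ1 y) y) (hφ1 : Continuous φ1)
    {R : ℝ} (hφ0 : ∀ y, R ≤ |y| → φ y = 0) (hφ10 : ∀ y, R ≤ |y| → φ1 y = 0)
    {X X1 : ℝ → ℝ} (hX : ∀ t ∈ Ioo 0 T, HasDerivAt X (X1 t) t) {V : ℝ}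
    (hV : ∀ t ∈ Ioo 0 T, |X1 t| ≤ V) {t : ℝ} (ht : t ∈ Ioo 0 T) :
    HasDerivAt (fun s => ∫ x, h (U s x) * φ (x - X s))
      (∫ x, (h1 (U t x) * deriv (fun s => U s x) t * φ (x - X t)
        + h (U t x) * (φ1 (x - X t) * (-X1 t)))) t := by
  have hhc : Continuous h := continuous_iff_continuousAt.2 fun u => (hh u).continuousAt
  have hφc : Continuous φ := continuous_iff_continuousAt.2 fun u => (hφ u).continuousAt
  obtain ⟨a, ha0, hat⟩ := exists_between ht.1
  obtain ⟨b, htb, hbT⟩ := exists_between ht.2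
  have hsub : Icc a b ⊆ Ioo 0 T := fun s hs => ⟨ha0.trans_le hs.1, hs.2.trans_lt hbT⟩
  have hXc : ContinuousOn X (Icc a b) := fun s hs =>
    (hX s (hsub hs)).continuousAt.continuousWithinAt
  obtain ⟨L0, hL0⟩ := isCompact_Icc.exists_bound_of_continuousOn hXc
  -- For `s` in `[a, b]` all translates of the support of the weight lie in `[-L, L]`, so a constant
  -- on this one interval dominates.
  set L := R + L0
  have hout : ∀ s ∈ Icc a b, ∀ x ∉ Icc (-L) L, R ≤ |x - X s| := by
    intro s hs x hx
    have h1 := hL0 s hs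
    rw [Real.norm_eq_abs] at h1
    have h2 : L < |x| := by
      by_contra hlt
      exact hx (abs_le.1 (not_lt.1 hlt))
    have := abs_sub_abs_le_abs_sub x (X s)
    simp only [L] at h2
    linarith
  have hKsub : Icc a b ×ˢ Icc (-L) L ⊆ Ioo 0 T ×ˢ (univ : Set ℝ) :=
    fun p hp => ⟨hsub hp.1, mem_univ _⟩
  have hK : IsCompact (Icc a b ×ˢ Icc (-L) L) := isCompact_Icc.prod isCompact_Icc
  have hUc := hU.continuousOn.mono hKsub
  obtain ⟨D1, hD1⟩ := hK.exists_bound_of_continuousOn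
    ((hh1.comp_continuousOn hUc).mul (hU.continuousOn_deriv_time.mono hKsub))
  obtain ⟨D2, hD2⟩ := hK.exists_bound_of_continuousOn (hhc.comp_continuousOn hUc)
  obtain ⟨D3, hD30, hD3⟩ := exists_abs_le_of_eq_zero hφc hφ0
  obtain ⟨D4, hD40, hD4⟩ := exists_abs_le_of_eq_zero hφ1 hφ10
  refine (hasDerivAt_integral_of_dominated_loc_of_deriv_le
    (F := fun s x => h (U s x) * φ (x - X s))
    (F' := fun s x => h1 (U s x) * deriv (fun s => U s x) s * φ (x - X s)
        + h (U s x) * (φ1 (x - X s) * (-X1 s)))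
    (bound := (Icc (-L) L).indicator fun _ => D1 * D3 + D2 * (D4 * V))
    (Ioo_mem_nhds hat htb) ?_ ?_ ?_ ?_ ?_ ?_).2
  · filter_upwards [Ioo_mem_nhds hat htb] with s hs
    have := hU.continuous_space (hsub ⟨hs.1.le, hs.2.le⟩)
    exact (by fun_prop : Continuous fun x => h (U s x) * φ (x - X s)).aestronglyMeasurable
  · have := hU.continuous_space ht
    refine Continuous.integrable_of_hasCompactSupport (by fun_prop) ?_
    exact (hasCompactSupport_comp_sub hφ0 (X t)).mul_left
  · have := hU.continuous_space ht
    have := hU.continuous_deriv_time ht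
    exact (by fun_prop : Continuous fun x => h1 (U t x) * deriv (fun s => U s x) t * φ (x - X t)
        + h (U t x) * (φ1 (x - X t) * (-X1 t))).aestronglyMeasurable
  · refine Eventually.of_forall fun x s hs => ?_
    have hs' : s ∈ Icc a b := ⟨hs.1.le, hs.2.le⟩
    by_cases hx : x ∈ Icc (-L) L
    · rw [indicator_of_mem hx]
      have e1 := hD1 (s, x) ⟨hs', hx⟩
      have e2 := hD2 (s, x) ⟨hs', hx⟩
      have e3 := hD3 (x - X s)
      have e4 := hD4 (x - X s)
      have e5 := hV s (hsub hs')
      simp only [Real.norm_eq_abs, Function.comp] at e1 e2 ⊢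
      refine (abs_add_le _ _).trans (add_le_add ?_ ?_)
      · rw [abs_mul]
        exact mul_le_mul e1 e3 (abs_nonneg _) ((abs_nonneg _).trans e1)
      · rw [abs_mul, abs_mul, abs_neg]
        exact mul_le_mul e2 (mul_le_mul e4 e5 (abs_nonneg _) hD40)
          (by positivity) ((abs_nonneg _).trans e2)
    · rw [indicator_of_notMem hx, hφ0 _ (hout s hs' x hx), hφ10 _ (hout s hs' x hx)]
      simp
  · exact (integrable_indicator_iff measurableSet_Icc).2 (by simp)
  · refine Eventually.of_forall fun x s hs => ?_
    have hs' := hsub ⟨hs.1.le, hs.2.le⟩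
    have e1 : HasDerivAt (fun s => h (U s x)) (h1 (U s x) * deriv (fun s => U s x) s) s :=
      (hh (U s x)).comp s (hU.differentiableAt_time s hs' x).hasDerivAt
    have e2 : HasDerivAt (fun s => φ (x - X s)) (φ1 (x - X s) * (-X1 s)) s :=
      (hφ (x - X s)).comp s ((hX s hs').const_sub x)
    exact e1.mul e2

/-- The balance law for `∫ h(U(t,x)) φ(x - X(t)) dx`. -/
theorem hasDerivAt_integral_mul_weight (hA : ContDiff ℝ 2 A) (hU : IsViscousSolution A ε T U₀ U)
    {h h1 h2 Q : ℝ → ℝ} (hh : ∀ u, HasDerivAt h (h1 u) u) (hh1 : ∀ u, HasDerivAt h1 (h2 u) u)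
    (hh2 : Continuous h2) (hQ : ∀ u, HasDerivAt Q (h1 u * deriv A u) u)
    {φ φ1 φ2 : ℝ → ℝ} (hφ : ∀ y, HasDerivAt φ (φ1 y) y) (hφ1 : ∀ y, HasDerivAt φ1 (φ2 y) y)
    (hφ2 : Continuous φ2) {R : ℝ} (hφ0 : ∀ y, R ≤ |y| → φ y = 0)
    (hφ10 : ∀ y, R ≤ |y| → φ1 y = 0) (hφ20 : ∀ y, R ≤ |y| → φ2 y = 0)
    {X X1 : ℝ → ℝ} (hX : ∀ t ∈ Ioo 0 T, HasDerivAt X (X1 t) t) {V : ℝ}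
    (hV : ∀ t ∈ Ioo 0 T, |X1 t| ≤ V) {t : ℝ} (ht : t ∈ Ioo 0 T) :
    HasDerivAt (fun s => ∫ x, h (U s x) * φ (x - X s))
      (∫ x, ((Q (U t x) - X1 t * h (U t x)) * φ1 (x - X t) + ε * h (U t x) * φ2 (x - X t)
        - ε * h2 (U t x) * (deriv (U t) x) ^ 2 * φ (x - X t))) t := by
  have hhc : Continuous h := continuous_iff_continuousAt.2 fun u => (hh u).continuousAt
  have hh1c : Continuous h1 := continuous_iff_continuousAt.2 fun u => (hh1 u).continuousAt
  have hQc : Continuous Q := continuous_iff_continuousAt.2 fun u => (hQ u).continuousAt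
  have hφc : Continuous φ := continuous_iff_continuousAt.2 fun u => (hφ u).continuousAt
  have hφ1c : Continuous φ1 := continuous_iff_continuousAt.2 fun u => (hφ1 u).continuousAt
  have hAc : Continuous (deriv A) := hA.continuous_deriv (by norm_num)
  refine (hasDerivAt_integral_mul_weight_aux hU hh hh1c hφ hφ1c hφ0 hφ10 hX hV ht).congr_deriv ?_
  have c0 := hU.continuous_space ht
  have c1 := hU.continuous_deriv_space ht
  have c2 := hU.continuous_deriv_deriv_space ht
  have s0 := hasCompactSupport_comp_sub hφ0 (X t)
  have s1 := hasCompactSupport_comp_sub hφ10 (X t)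
  have s2 := hasCompactSupport_comp_sub hφ20 (X t)
  -- All integrations by parts are done at once: the difference of the two integrands is the exact
  -- derivative of the compactly supported `Z`, hence integrates to zero.
  set Z : ℝ → ℝ := fun x => ε * (h1 (U t x) * deriv (U t) x * φ (x - X t))
    - ε * (h (U t x) * φ1 (x - X t)) - Q (U t x) * φ (x - X t)
  set Z' : ℝ → ℝ := fun x =>
    (h1 (U t x) * deriv (fun s => U s x) t * φ (x - X t)
        + h (U t x) * (φ1 (x - X t) * (-X1 t)))
      - ((Q (U t x) - X1 t * h (U t x)) * φ1 (x - X t) + ε * h (U t x) * φ2 (x - X t)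
        - ε * h2 (U t x) * (deriv (U t) x) ^ 2 * φ (x - X t))
  have ct := hU.continuous_deriv_time ht
  have i1 : Integrable fun x => h1 (U t x) * deriv (fun s => U s x) t * φ (x - X t)
        + h (U t x) * (φ1 (x - X t) * (-X1 t)) :=
    Continuous.integrable_of_hasCompactSupport (by fun_prop)
      (s0.mul_left.add s1.mul_right.mul_left)
  have i2 : Integrable fun x =>
      (Q (U t x) - X1 t * h (U t x)) * φ1 (x - X t) + ε * h (U t x) * φ2 (x - X t)
        - ε * h2 (U t x) * (deriv (U t) x) ^ 2 * φ (x - X t) := by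
    refine Continuous.integrable_of_hasCompactSupport (by fun_prop) ?_
    exact (s1.mul_left.add s2.mul_left).sub s0.mul_left
  have hZ : ∀ x, HasDerivAt Z (Z' x) x := by
    intro x
    have d0 := hU.hasDerivAt_space ht x
    have d1 := hU.hasDerivAt_deriv_space ht x
    have dφ : HasDerivAt (fun x => φ (x - X t)) (φ1 (x - X t)) x :=
      ((hφ (x - X t)).comp x ((hasDerivAt_id x).sub_const (X t))).congr_deriv (mul_one _)
    have dφ1 : HasDerivAt (fun x => φ1 (x - X t)) (φ2 (x - X t)) x :=
      ((hφ1 (x - X t)).comp x ((hasDerivAt_id x).sub_const (X t))).congr_deriv (mul_one _)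
    have dh := (hh (U t x)).comp x d0
    have dh1 := (hh1 (U t x)).comp x d0
    have dQ := (hQ (U t x)).comp x d0
    refine (((((dh1.mul d1).mul dφ).const_mul ε).sub ((dh.mul dφ1).const_mul ε)).sub
      (dQ.mul dφ)).congr_deriv ?_
    simp only [Z', Function.comp, Pi.mul_apply]
    rw [hU.deriv_time_eq hA ht x]
    ring
  have i3 : Integrable Z := by
    refine Continuous.integrable_of_hasCompactSupport (by fun_prop) ?_
    exact (s0.mul_left.mul_left.sub s1.mul_left.mul_left).sub s0.mul_left
  have key := integral_eq_zero_of_hasDerivAt_of_integrable hZ (i1.sub i2) i3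
  simp only [Z'] at key
  rw [integral_sub i1 i2] at key
  linarith

end WeakForm

section Entropy

variable {A : ℝ → ℝ} {ε T : ℝ} {U₀ : ℝ → ℝ} {U : ℝ → ℝ → ℝ}

/-! ### Attainment of the initial value -/

theorem abs_sub_le_of_hasDerivAt {f f' : ℝ → ℝ} (hf : ∀ x, HasDerivAt f (f' x) x) {D : ℝ}
    {s : Set ℝ} (hs : Convex ℝ s) (hD : ∀ x ∈ s, |f' x| ≤ D) {x y : ℝ} (hx : x ∈ s) (hy : y ∈ s) :
    |f x - f y| ≤ D * |x - y| := by
  have := Convex.norm_image_sub_le_of_norm_deriv_le (f := f) (C := D) (s := s)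
    (fun x _ => (hf x).differentiableAt)
    (fun x hx => by rw [(hf x).deriv]; exact hD x hx) hs hy hx
  simpa using this

/-- The difference splits as `(h(U) - h(U₀)) χ(x - X) + h(U₀) (χ(x - X) - χ(x))`. The first term is
controlled by the `L¹` convergence on a window enlarged by `1`, which suffices once `|X| < 1`; the
second is of order `|X|`. -/
theorem tendsto_integral_mul_weight (hU : IsViscousSolution A ε T U₀ U) (hT : 0 < T)
    (hm : AEStronglyMeasurable U₀ volume) {B : ℝ} (hB : ∀ t ∈ Ioo 0 T, ∀ x, |U t x| ≤ B)
    (hB0 : ∀ᵐ x, |U₀ x| ≤ B) {h : ℝ → ℝ} (hh : Continuous h) {Lh : ℝ}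
    (hLh : ∀ u ∈ Icc (-B) B, ∀ v ∈ Icc (-B) B, |h u - h v| ≤ Lh * |u - v|) {χ : ℝ → ℝ}
    (hχ : Continuous χ) {Lχ : ℝ} (hLχ : ∀ x y, |χ x - χ y| ≤ Lχ * |x - y|) {R : ℝ}
    (hχ0 : ∀ y, R ≤ |y| → χ y = 0) {X : ℝ → ℝ} (hX : Tendsto X (𝓝[>] 0) (𝓝 0)) (hR : 0 < R) :
    Tendsto (fun t => ∫ x, h (U t x) * χ (x - X t)) (𝓝[>] 0) (𝓝 (∫ x, h (U₀ x) * χ x)) := by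
  obtain ⟨H, hH⟩ := (isCompact_Icc (a := -B) (b := B)).exists_bound_of_continuousOn hh.continuousOn
  obtain ⟨D, hD0, hD⟩ := exists_abs_le_of_eq_zero hχ hχ0
  set I := Icc (-(R + 1)) (R + 1)
  have hlim : Tendsto (fun t => (Lh * D) * (∫ x in I, |U t x - U₀ x|)
      + (H * Lχ * (2 * (R + 1))) * |X t|) (𝓝[>] 0) (𝓝 0) := by
    have h1 := (hU.initial (R + 1) (by linarith)).const_mul (Lh * D)
    have h2 := hX.abs.const_mul (H * Lχ * (2 * (R + 1)))
    have h3 := h1.add h2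
    rwa [abs_zero, mul_zero, mul_zero, add_zero] at h3
  rw [tendsto_iff_norm_sub_tendsto_zero]
  refine squeeze_zero' (Eventually.of_forall fun _ => norm_nonneg _) ?_ hlim
  have hX1 : ∀ᶠ t in 𝓝[>] (0 : ℝ), |X t| < 1 := by
    have := hX.abs
    rw [abs_zero] at this
    exact this.eventually_lt_const zero_lt_one
  filter_upwards [hX1, Ioo_mem_nhdsGT hT] with t hXt ht
  have hc := hU.continuous_space ht
  have i1 : Integrable fun x => h (U t x) * χ (x - X t) :=
    Continuous.integrable_of_hasCompactSupport (by fun_prop)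
      (hasCompactSupport_comp_sub hχ0 (X t)).mul_left
  have i2 : Integrable fun x => h (U₀ x) * χ x := by
    have ic : Integrable χ :=
      hχ.integrable_of_hasCompactSupport (hasCompactSupport_of_eq_zero hχ0)
    refine ic.bdd_mul (c := H) (hh.comp_aestronglyMeasurable hm) ?_
    filter_upwards [hB0] with x hx using hH _ (abs_le.1 hx)
  have i3 : IntegrableOn (fun x => |U t x - U₀ x|) I := by
    have hfin : volume I < ⊤ := by simp [I]
    refine (Measure.integrableOn_of_bounded (s := I) (M := B + B) hfin.ne
      (hc.aestronglyMeasurable.sub hm) ?_).abs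
    filter_upwards [ae_restrict_of_ae hB0] with x hx
    exact (norm_sub_le _ _).trans (add_le_add (hB t ht x) hx)
  rw [← integral_sub i1 i2]
  have hbd : ∀ᵐ x, ‖h (U t x) * χ (x - X t) - h (U₀ x) * χ x‖ ≤
      I.indicator (fun x => Lh * D * |U t x - U₀ x| + H * Lχ * |X t|) x := by
    filter_upwards [hB0] with x hx
    have hu := abs_le.1 (hB t ht x)
    have hu0 := abs_le.1 hx
    by_cases hxI : x ∈ I
    · rw [indicator_of_mem hxI, Real.norm_eq_abs]
      have e1 := hLh _ hu _ hu0
      have e2 := hLχ (x - X t) x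
      have e3 := hH _ hu0
      rw [Real.norm_eq_abs] at e3
      have e4 : |x - X t - x| = |X t| := by
        rw [show x - X t - x = -X t by ring, abs_neg]
      rw [e4] at e2
      have : h (U t x) * χ (x - X t) - h (U₀ x) * χ x =
          (h (U t x) - h (U₀ x)) * χ (x - X t) + h (U₀ x) * (χ (x - X t) - χ x) := by ring
      rw [this]
      refine (abs_add_le _ _).trans ?_
      rw [abs_mul, abs_mul]
      have e5 := mul_le_mul e1 (hD (x - X t)) (abs_nonneg _) ((abs_nonneg _).trans e1)
      have e6 := mul_le_mul e3 e2 (abs_nonneg _) ((abs_nonneg _).trans e3)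
      linarith
    · have hx1 : R + 1 < |x| := by
        by_contra hlt
        exact hxI (abs_le.1 (not_lt.1 hlt))
      have := abs_sub_abs_le_abs_sub x (X t)
      rw [indicator_of_notMem hxI, hχ0 _ (by linarith), hχ0 x (by linarith)]
      simp
  have hfin : volume I ≠ ⊤ := by simp [I]
  have i4 : IntegrableOn (fun x => Lh * D * |U t x - U₀ x| + H * Lχ * |X t|) I :=
    (i3.const_mul _).add (integrableOn_const hfin)
  refine (norm_integral_le_of_norm_le (i4.integrable_indicator measurableSet_Icc) hbd).trans ?_
  rw [integral_indicator measurableSet_Icc, integral_add (i3.const_mul _) (integrableOn_const hfin),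
    integral_const_mul]
  simp only [integral_const, MeasurableSet.univ, measureReal_restrict_apply, univ_inter, I,
    Real.volume_real_Icc, smul_eq_mul]
  rw [max_eq_left (by linarith)]
  apply le_of_eq; ring

/-! ### Weighted entropy inequality -/

/-- This is the commutator estimate for multiplying the weight `φ` by a cutoff `r`. The constant
collects `D` from the flux, `2` from the cross term `2 ε φ' r'`, for which `ε |φ'| ≤ φ` is needed,
and `1` from `ε r''`. -/
theorem weight_rate_le {a h φ φ1 φ2 r r1 r2 E D κ : ℝ} (hε : 0 ≤ ε) (hε1 : ε ≤ 1) (hh : 0 ≤ h)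
    (ha : |a| ≤ D * h) (hφ : 0 ≤ φ) (hφ1 : ε * |φ1| ≤ φ) (hr0 : 0 ≤ r) (hr1 : r ≤ 1)
    (hr : |r1| ≤ κ) (hr' : |r2| ≤ κ) (hE : 0 ≤ E) (hrate : a * φ1 + ε * h * φ2 ≤ E) :
    a * (φ1 * r + φ * r1) + ε * h * (φ2 * r + 2 * φ1 * r1 + φ * r2) ≤
      E + (D + 3) * h * φ * κ := by
  have hκ : 0 ≤ κ := (abs_nonneg _).trans hr
  have e1 : (a * φ1 + ε * h * φ2) * r ≤ E := by
    nlinarith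
  have e2 : a * r1 ≤ D * h * κ :=
    (le_abs_self _).trans (by
      rw [abs_mul]; exact mul_le_mul ha hr (abs_nonneg _) ((abs_nonneg _).trans ha))
  have e3 : (ε * φ1) * r1 ≤ φ * κ :=
    (le_abs_self _).trans (by
      rw [abs_mul, abs_mul, abs_of_nonneg hε]; exact mul_le_mul hφ1 hr (abs_nonneg _) hφ)
  have e4 : ε * r2 ≤ κ := by
    have := le_abs_self r2
    nlinarith
  have e5 := mul_le_mul_of_nonneg_left e2 hφ
  have e6 := mul_le_mul_of_nonneg_left e3 hh
  have e7 := mul_le_mul_of_nonneg_left e4 (mul_nonneg hh hφ)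
  nlinarith

/-- The viscous term `-ε h''(U) (∂ₓU)²` is dropped by convexity. The derivatives of the cutoff at
scale `n²` return `O(1/n)` times the weighted entropy itself, which Gronwall's inequality absorbs
with a factor tending to `1`, plus `O(n⁻³)`. Only boundedness of the solution is used at infinity.
-/
theorem integral_mul_cutoff_le (hA : ContDiff ℝ 2 A) (hU : IsViscousSolution A ε T U₀ U)
    (hε : 0 < ε) (hε1 : ε ≤ 1)
    (hm : AEStronglyMeasurable U₀ volume) {B : ℝ} (hB : ∀ t ∈ Ioo 0 T, ∀ x, |U t x| ≤ B)
    (hB0 : ∀ᵐ x, |U₀ x| ≤ B)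
    {h h1 h2 Q : ℝ → ℝ} (hh : ∀ u, HasDerivAt h (h1 u) u) (hh1 : ∀ u, HasDerivAt h1 (h2 u) u)
    (hh2 : Continuous h2) (hQ : ∀ u, HasDerivAt Q (h1 u * deriv A u) u)
    (hpos : ∀ u, 0 ≤ h u) (hconv : ∀ u, 0 ≤ h2 u) {D : ℝ} (hD : 0 ≤ D)
    (hQD : ∀ u ∈ Icc (-B) B, |Q u| ≤ D * h u) {H : ℝ} (hH : ∀ u ∈ Icc (-B) B, h u ≤ H)
    {φ φ1 φ2 : ℝ → ℝ} (hφ : ∀ y, HasDerivAt φ (φ1 y) y) (hφ1 : ∀ y, HasDerivAt φ1 (φ2 y) y)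
    (hφ2 : Continuous φ2) (hφ0 : ∀ y, 0 ≤ φ y) (hφle : ∀ y, φ y ≤ 1)
    (hφ1le : ∀ y, ε * |φ1 y| ≤ φ y)
    {X X1 : ℝ → ℝ} (hX : ∀ t ∈ Ioo 0 T, HasDerivAt X (X1 t) t) {V : ℝ} (hV0 : 0 ≤ V)
    (hV : ∀ t ∈ Ioo 0 T, |X1 t| ≤ V) (hXlim : Tendsto X (𝓝[>] 0) (𝓝 0))
    {Err : ℝ → ℝ} (hErr : Integrable Err) (hErr0 : ∀ y, 0 ≤ Err y)
    (hrate : ∀ t ∈ Ioo 0 T, ∀ x, (Q (U t x) - X1 t * h (U t x)) * φ1 (x - X t)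
      + ε * h (U t x) * φ2 (x - X t) ≤ Err (x - X t)) {n : ℝ} (hn : 1 ≤ n)
    {I0 : ℝ} (hI0 : 0 ≤ I0) (hinit : ∫ x, h (U₀ x) * (φ x * cutoff (n ^ 2) x) ≤ I0)
    {t : ℝ} (ht : t ∈ Ioo 0 T) :
    ∫ x, h (U t x) * (φ (x - X t) * cutoff (n ^ 2) (x - X t)) ≤
      Real.exp (56 * (D + V + 3) / n * t) *
        (I0 + ((∫ y, Err y) + 112 * (D + V + 3) * H / n ^ 3) * t) := by
  have hn0 : 0 < n := by linarith
  have hR : 0 < n ^ 2 := by positivity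
  have hH0 : 0 ≤ H := (hpos _).trans (hH _ (abs_le.1 (hB t ht 0)))
  have hhc : Continuous h := continuous_iff_continuousAt.2 fun u => (hh u).continuousAt
  have hh1c : Continuous h1 := continuous_iff_continuousAt.2 fun u => (hh1 u).continuousAt
  have hQc : Continuous Q := continuous_iff_continuousAt.2 fun u => (hQ u).continuousAt
  have hφc : Continuous φ := continuous_iff_continuousAt.2 fun u => (hφ u).continuousAt
  have hφ1c : Continuous φ1 := continuous_iff_continuousAt.2 fun u => (hφ1 u).continuousAt
  have cr := continuous_cutoff (n ^ 2)
  have cr1 := continuous_cutoffD (n ^ 2)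
  have cr2 := continuous_cutoffDD (n ^ 2)
  set r := cutoff (n ^ 2)
  set r1 := cutoffD (n ^ 2)
  set r2 := cutoffDD (n ^ 2)
  set ψ : ℝ → ℝ := fun y => φ y * r y
  set ψ1 : ℝ → ℝ := fun y => φ1 y * r y + φ y * r1 y
  set ψ2 : ℝ → ℝ := fun y => φ2 y * r y + 2 * φ1 y * r1 y + φ y * r2 y
  have z0 : ∀ y, n ^ 2 ≤ |y| → r y = 0 := fun y hy => cutoff_eq_zero hR hy
  have z1 : ∀ y, n ^ 2 ≤ |y| → r1 y = 0 := fun y hy => cutoffD_eq_zero hR hy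
  have z2 : ∀ y, n ^ 2 ≤ |y| → r2 y = 0 := fun y hy => cutoffDD_eq_zero hR hy
  have hψ : ∀ y, HasDerivAt ψ (ψ1 y) y := fun y => (hφ y).mul (hasDerivAt_cutoff _ y)
  have hψ1 : ∀ y, HasDerivAt ψ1 (ψ2 y) y := fun y =>
    (((hφ1 y).mul (hasDerivAt_cutoff _ y)).add
      ((hφ y).mul (hasDerivAt_cutoffD _ y))).congr_deriv (by
        change φ2 y * r y + φ1 y * r1 y + (φ1 y * r1 y + φ y * r2 y) = ψ2 y
        simp only [ψ2]; ring)
  have cψ : Continuous ψ := by fun_prop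
  have cψ1 : Continuous ψ1 := by fun_prop
  have cψ2 : Continuous ψ2 := by fun_prop
  have y0 : ∀ y, n ^ 2 ≤ |y| → ψ y = 0 := fun y hy => by simp [ψ, z0 y hy]
  have y1 : ∀ y, n ^ 2 ≤ |y| → ψ1 y = 0 := fun y hy => by simp [ψ1, z0 y hy, z1 y hy]
  have y2 : ∀ y, n ^ 2 ≤ |y| → ψ2 y = 0 := fun y hy => by
    simp [ψ2, z0 y hy, z1 y hy, z2 y hy]
  have hder := fun s hs => hasDerivAt_integral_mul_weight hA hU hh hh1 hh2 hQ hψ hψ1 cψ2 y0 y1 y2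
    hX hV (t := s) hs
  have hT : 0 < T := ht.1.trans ht.2
  set Df := D + V + 3 with hDf
  have hDf0 : 0 ≤ Df := by positivity
  have hlim : Tendsto (fun s => ∫ x, h (U s x) * ψ (x - X s)) (𝓝[>] 0)
      (𝓝 (∫ x, h (U₀ x) * ψ x)) := by
    obtain ⟨Lh, hLh⟩ :=
      (isCompact_Icc (a := -B) (b := B)).exists_bound_of_continuousOn hh1c.continuousOn
    obtain ⟨Lχ, -, hLχ⟩ := exists_abs_le_of_eq_zero cψ1 y1
    exact tendsto_integral_mul_weight hU hT hm hB hB0 hhc (Lh := Lh)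
      (fun u hu v hv => abs_sub_le_of_hasDerivAt hh (convex_Icc _ _) hLh hu hv) cψ (Lχ := Lχ)
      (fun x y => abs_sub_le_of_hasDerivAt hψ convex_univ (fun x _ => hLχ x) (mem_univ x)
        (mem_univ y)) y0 hXlim hR
  have hgr := le_exp_mul_of_deriv_le (f := fun s => ∫ x, h (U s x) * ψ (x - X s)) (T := T)
    (C := 56 * Df / n) (e := (∫ y, Err y) + 112 * Df * H / n ^ 3) (f₀ := I0) (t := t)
    (by positivity) (add_nonneg (integral_nonneg hErr0) (by positivity)) hder ?_ ?_ ht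
  · rwa [max_eq_left hI0] at hgr
  · intro s hs
    have cs := hU.continuous_space hs
    have cs1 := hU.continuous_deriv_space hs
    have s0 := hasCompactSupport_comp_sub y0 (X s)
    have s1 := hasCompactSupport_comp_sub y1 (X s)
    have s2 := hasCompactSupport_comp_sub y2 (X s)
    have i1 : Integrable fun x =>
        (Q (U s x) - X1 s * h (U s x)) * ψ1 (x - X s) + ε * h (U s x) * ψ2 (x - X s)
          - ε * h2 (U s x) * (deriv (U s) x) ^ 2 * ψ (x - X s) := by
      refine Continuous.integrable_of_hasCompactSupport (by fun_prop) ?_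
      exact (s1.mul_left.add s2.mul_left).sub s0.mul_left
    have i2 : Integrable fun x => h (U s x) * ψ (x - X s) :=
      Continuous.integrable_of_hasCompactSupport (by fun_prop) s0.mul_left
    have i3 : Integrable fun x => Err (x - X s) := hErr.comp_sub_right (X s)
    -- The remainder `n⁻⁵` has to be paid only where the cutoff lives, an interval of length `2 n²`;
    -- outside it every term with the weight vanishes.
    set J := Icc (X s - n ^ 2) (X s + n ^ 2)
    have i4 : Integrable (J.indicator fun _ => 56 * Df * H / n ^ 5) :=
      (integrable_indicator_iff measurableSet_Icc).2 (by simp)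
    have hle : ∀ x, (Q (U s x) - X1 s * h (U s x)) * ψ1 (x - X s) + ε * h (U s x) * ψ2 (x - X s)
          - ε * h2 (U s x) * (deriv (U s) x) ^ 2 * ψ (x - X s) ≤
        Err (x - X s) + 56 * Df / n * (h (U s x) * ψ (x - X s))
          + J.indicator (fun _ => 56 * Df * H / n ^ 5) x := by
      intro x
      have hhx := hpos (U s x)
      have hux := abs_le.1 (hB s hs x)
      have hψx : 0 ≤ ψ (x - X s) := mul_nonneg (hφ0 _) (cutoff_nonneg _ _)
      have hdis : 0 ≤ ε * h2 (U s x) * (deriv (U s) x) ^ 2 * ψ (x - X s) := by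
        have := hconv (U s x)
        positivity
      by_cases hxJ : x ∈ J
      · rw [indicator_of_mem hxJ]
        have ha : |Q (U s x) - X1 s * h (U s x)| ≤ (D + V) * h (U s x) := by
          refine (abs_sub _ _).trans ?_
          rw [abs_mul, abs_of_nonneg hhx]
          have := hQD _ hux
          have := mul_le_mul_of_nonneg_right (hV s hs) hhx
          linarith
        have key := weight_rate_le hε.le hε1 hhx ha (hφ0 (x - X s)) (hφ1le (x - X s))
          (cutoff_nonneg (n ^ 2) (x - X s)) (cutoff_le_one (n ^ 2) (x - X s))
          (abs_cutoffD_sq_le hn (x - X s)) (abs_cutoffDD_sq_le hn (x - X s))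
          (hErr0 (x - X s)) (hrate s hs x)
        have hφh : h (U s x) * φ (x - X s) ≤ H := by
          calc h (U s x) * φ (x - X s) ≤ h (U s x) * 1 := by gcongr; exact hφle _
            _ ≤ H := by rw [mul_one]; exact hH _ hux
        have e1 : (D + V + 3) * h (U s x) * φ (x - X s) *
            (56 * (cutoff (n ^ 2) (x - X s) / n + 1 / n ^ 5)) =
            56 * Df / n * (h (U s x) * ψ (x - X s))
              + 56 * Df * (h (U s x) * φ (x - X s)) / n ^ 5 := by
          simp only [ψ, r, hDf]; field_simp
        have e2 : 56 * Df * (h (U s x) * φ (x - X s)) / n ^ 5 ≤ 56 * Df * H / n ^ 5 := by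
          gcongr
        simp only [ψ1, ψ2]
        simp only [r, r1, r2]
        linarith
      · have hout : n ^ 2 ≤ |x - X s| := by
          by_contra hlt
          have := abs_le.1 (not_le.1 hlt).le
          exact hxJ ⟨by linarith, by linarith⟩
        rw [indicator_of_notMem hxJ, y0 _ hout, y1 _ hout, y2 _ hout]
        have := hErr0 (x - X s)
        simpa using this
    refine (integral_mono i1 ((i3.add (i2.const_mul _)).add i4) hle).trans (le_of_eq ?_)
    rw [integral_add' (i3.add (i2.const_mul _)) i4, integral_add' i3 (i2.const_mul _),
      integral_const_mul, integral_sub_right_eq_self Err (X s), integral_indicator measurableSet_Icc]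
    simp only [integral_const, MeasurableSet.univ, measureReal_restrict_apply, univ_inter,
      Real.volume_real_Icc, smul_eq_mul]
    rw [max_eq_left (by linarith)]
    field_simp
    ring
  · intro δ hδ
    exact (hlim.eventually_le_const (u := I0 + δ) (by linarith)).frequently

end Entropy

/-! ### Removal of the cutoff and consequences. -/

section EntropyLimit

variable {A : ℝ → ℝ} {ε T : ℝ} {U₀ : ℝ → ℝ} {U : ℝ → ℝ → ℝ}

/-- A weight `φ` moving along `X` whose production rate is at most `Err` yields an entropy
estimate on the whole line. -/
theorem lintegral_mul_weight_le (hA : ContDiff ℝ 2 A) (hU : IsViscousSolution A ε T U₀ U)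
    (hε : 0 < ε) (hε1 : ε ≤ 1)
    (hm : AEStronglyMeasurable U₀ volume) {B : ℝ} (hB : ∀ t ∈ Ioo 0 T, ∀ x, |U t x| ≤ B)
    (hB0 : ∀ᵐ x, |U₀ x| ≤ B)
    {h h1 h2 Q : ℝ → ℝ} (hh : ∀ u, HasDerivAt h (h1 u) u) (hh1 : ∀ u, HasDerivAt h1 (h2 u) u)
    (hh2 : Continuous h2) (hQ : ∀ u, HasDerivAt Q (h1 u * deriv A u) u)
    (hpos : ∀ u, 0 ≤ h u) (hconv : ∀ u, 0 ≤ h2 u) {D : ℝ} (hD : 0 ≤ D)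
    (hQD : ∀ u ∈ Icc (-B) B, |Q u| ≤ D * h u)
    {φ φ1 φ2 : ℝ → ℝ} (hφ : ∀ y, HasDerivAt φ (φ1 y) y) (hφ1 : ∀ y, HasDerivAt φ1 (φ2 y) y)
    (hφ2 : Continuous φ2) (hφ0 : ∀ y, 0 ≤ φ y) (hφle : ∀ y, φ y ≤ 1)
    (hφ1le : ∀ y, ε * |φ1 y| ≤ φ y)
    {X X1 : ℝ → ℝ} (hX : ∀ t ∈ Ioo 0 T, HasDerivAt X (X1 t) t) {V : ℝ} (hV0 : 0 ≤ V)
    (hV : ∀ t ∈ Ioo 0 T, |X1 t| ≤ V) (hXlim : Tendsto X (𝓝[>] 0) (𝓝 0))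
    {Err : ℝ → ℝ} (hErr : Integrable Err) (hErr0 : ∀ y, 0 ≤ Err y)
    (hrate : ∀ t ∈ Ioo 0 T, ∀ x, (Q (U t x) - X1 t * h (U t x)) * φ1 (x - X t)
      + ε * h (U t x) * φ2 (x - X t) ≤ Err (x - X t))
    {I0 : ℝ} (hI0 : 0 ≤ I0)
    (hinit : ∀ n : ℝ, 1 ≤ n → ∫ x, h (U₀ x) * (φ x * cutoff (n ^ 2) x) ≤ I0)
    {t : ℝ} (ht : t ∈ Ioo 0 T) :
    ∫⁻ x, ENNReal.ofReal (h (U t x) * φ (x - X t)) ≤ ENNReal.ofReal (I0 + (∫ y, Err y) * t) := by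
  have hhc : Continuous h := continuous_iff_continuousAt.2 fun u => (hh u).continuousAt
  have hφc : Continuous φ := continuous_iff_continuousAt.2 fun u => (hφ u).continuousAt
  have cU := hU.continuous_space ht
  obtain ⟨H, hH⟩ := (isCompact_Icc (a := -B) (b := B)).exists_bound_of_continuousOn hhc.continuousOn
  set N : ℕ → ℝ := fun k => (k : ℝ) + 1 with hN
  have hN1 : ∀ k, 1 ≤ N k := fun k => by simp [hN]
  have hNlim : Tendsto N atTop atTop :=
    tendsto_atTop_add_const_right _ _ tendsto_natCast_atTop_atTop
  set b : ℕ → ℝ := fun k => Real.exp (56 * (D + V + 3) / N k * t) *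
        (I0 + ((∫ y, Err y) + 112 * (D + V + 3) * H / N k ^ 3) * t)
  have hblim : Tendsto b atTop (𝓝 (I0 + (∫ y, Err y) * t)) := by
    have h1 : Tendsto (fun k => 56 * (D + V + 3) / N k * t) atTop (𝓝 (0 * t)) :=
      (tendsto_const_nhds.div_atTop hNlim).mul_const t
    have h2 : Tendsto (fun k => 112 * (D + V + 3) * H / N k ^ 3) atTop (𝓝 0) :=
      tendsto_const_nhds.div_atTop ((tendsto_pow_atTop three_ne_zero).comp hNlim)
    have h3 := (Real.continuous_exp.tendsto _).comp h1
    have h4 := ((h2.const_add (∫ y, Err y)).mul_const t).const_add I0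
    simpa using h3.mul h4
  have hF : ∀ x, Tendsto (fun k => ENNReal.ofReal
      (h (U t x) * (φ (x - X t) * cutoff (N k ^ 2) (x - X t)))) atTop
      (𝓝 (ENNReal.ofReal (h (U t x) * φ (x - X t)))) := by
    intro x
    have h1 : Tendsto (fun k => cutoff (N k ^ 2) (x - X t)) atTop (𝓝 1) :=
      (tendsto_cutoff (x - X t)).comp ((tendsto_pow_atTop two_ne_zero).comp hNlim)
    have h2 := (h1.const_mul (φ (x - X t))).const_mul (h (U t x))
    rw [mul_one] at h2
    exact (ENNReal.continuous_ofReal.tendsto _).comp h2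
  have hcont : ∀ k, Continuous fun x =>
      h (U t x) * (φ (x - X t) * cutoff (N k ^ 2) (x - X t)) := fun k => by
    have := continuous_cutoff (N k ^ 2)
    fun_prop
  -- Fatou's lemma for the lower integral: integrability of `h(U) φ` is not known beforehand and is
  -- part of what the estimate delivers.
  calc ∫⁻ x, ENNReal.ofReal (h (U t x) * φ (x - X t))
      = ∫⁻ x, liminf (fun k => ENNReal.ofReal
          (h (U t x) * (φ (x - X t) * cutoff (N k ^ 2) (x - X t)))) atTop := by
        congr 1; ext x; exact (hF x).liminf_eq.symm
    _ ≤ liminf (fun k => ∫⁻ x, ENNReal.ofReal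
          (h (U t x) * (φ (x - X t) * cutoff (N k ^ 2) (x - X t)))) atTop :=
        lintegral_liminf_le fun k => (hcont k).measurable.ennreal_ofReal
    _ ≤ liminf (fun k => ENNReal.ofReal (b k)) atTop := by
        refine liminf_le_liminf (Eventually.of_forall fun k => ?_)
        have hNk : 0 < N k ^ 2 := by have := hN1 k; positivity
        rw [← ofReal_integral_eq_lintegral_ofReal]
        · refine ENNReal.ofReal_le_ofReal ?_
          exact integral_mul_cutoff_le hA hU hε hε1 hm hB hB0 hh hh1 hh2 hQ hpos hconv hD hQD
            (fun u hu => (le_abs_self _).trans (hH u hu)) hφ hφ1 hφ2 hφ0 hφle hφ1le hX hV0 hV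
            hXlim hErr hErr0 hrate (hN1 k) hI0 (hinit _ (hN1 k)) ht
        · refine (hcont k).integrable_of_hasCompactSupport ?_
          exact (hasCompactSupport_comp_sub (f := cutoff (N k ^ 2))
            (fun y hy => cutoff_eq_zero hNk hy) (X t)).mul_left.mul_left
        · exact Eventually.of_forall fun x =>
            mul_nonneg (hpos _) (mul_nonneg (hφ0 _) (cutoff_nonneg _ _))
    _ = ENNReal.ofReal (I0 + (∫ y, Err y) * t) :=
        ((ENNReal.continuous_ofReal.tendsto _).comp hblim).liminf_eq

/-! ### Entropy fluxes and the maximum principle -/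

theorem hasDerivAt_integral_mul_deriv (hA : ContDiff ℝ 2 A) {h1 : ℝ → ℝ} (hh1 : Continuous h1)
    (a u : ℝ) :
    HasDerivAt (fun u => ∫ w in a..u, h1 w * deriv A w) (h1 u * deriv A u) u := by
  have hc : Continuous fun w => h1 w * deriv A w := by
    have := hA.continuous_deriv (by norm_num)
    fun_prop
  exact intervalIntegral.integral_hasDerivAt_right (hc.intervalIntegrable _ _)
    hc.aestronglyMeasurable.stronglyMeasurableAtFilter hc.continuousAt

/-- Since `h'` has the sign of `u - a` and `h` vanishes at `a`, the integral of `|h'|` from `a` to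
`u` is exactly `h(u)`. The flux of such an entropy is therefore bounded by the maximal
characteristic speed times the entropy. -/
theorem abs_integral_mul_deriv_le {h h1 : ℝ → ℝ}
    (hh : ∀ u, HasDerivAt h (h1 u) u) (hh1 : Continuous h1) {a : ℝ} (ha0 : h a = 0)
    (hsign : ∀ u, 0 ≤ (u - a) * h1 u) {B D : ℝ} (hD : ∀ u ∈ Icc (-B) B, |deriv A u| ≤ D)
    (ha : a ∈ Icc (-B) B) {u : ℝ} (hu : u ∈ Icc (-B) B) :
    |∫ w in a..u, h1 w * deriv A w| ≤ D * h u := by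
  have hintg : ∀ a b, ∫ w in a..b, h1 w = h b - h a := fun a b =>
    intervalIntegral.integral_eq_sub_of_hasDerivAt (fun x _ => hh x) (hh1.intervalIntegrable _ _)
  rcases le_total a u with hau | hau
  · have := intervalIntegral.norm_integral_le_of_norm_le (μ := volume) hau
      (f := fun w => h1 w * deriv A w) (g := fun w => D * h1 w)
      (Eventually.of_forall fun w hw => by
        have hw1 : 0 ≤ h1 w := nonneg_of_mul_nonneg_right (hsign w) (by linarith [hw.1])
        rw [Real.norm_eq_abs, abs_mul, abs_of_nonneg hw1, mul_comm]
        gcongr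
        exact hD w ⟨ha.1.trans hw.1.le, hw.2.trans hu.2⟩)
      ((hh1.intervalIntegrable _ _).const_mul D)
    rw [intervalIntegral.integral_const_mul, hintg, ha0, sub_zero] at this
    exact this
  · rw [intervalIntegral.integral_symm, abs_neg]
    have := intervalIntegral.norm_integral_le_of_norm_le (μ := volume) hau
      (f := fun w => h1 w * deriv A w) (g := fun w => D * (-h1 w))
      (Eventually.of_forall fun w hw => by
        have hw1 : h1 w ≤ 0 ∨ w = a := by
          rcases eq_or_lt_of_le hw.2 with h | h
          · exact Or.inr h
          · exact Or.inl (by have := hsign w; nlinarith)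
        have hw2 : h1 w ≤ 0 := by
          rcases hw1 with h | h
          · exact h
          -- At `w = a` the sign condition says nothing; the sign of `h1 a` follows by continuity
          -- from the left.
          · have hmem : a ∈ closure (Iio a) := by rw [closure_Iio]; exact self_mem_Iic
            have hcl : IsClosed {w | h1 w ≤ 0} := isClosed_le hh1 continuous_const
            rw [h]
            exact closure_minimal (fun w hw => by
              have := hsign w
              have hw' : w < a := hw
              show h1 w ≤ 0
              nlinarith) hcl hmem
        rw [Real.norm_eq_abs, abs_mul, abs_of_nonpos hw2, mul_comm]
        gcongr
        · linarith
        · exact hD w ⟨hu.1.trans hw.1.le, hw.2.trans ha.2⟩)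
      ((hh1.intervalIntegrable _ _).neg.const_mul D)
    rw [intervalIntegral.integral_const_mul, intervalIntegral.integral_neg, hintg, ha0, zero_sub,
      neg_neg] at this
    exact this

/-- The truncated cube `(s u - M)₊³` is a convex `C²` entropy that vanishes on the initial data.
With the constant weight and no shift its integral cannot grow, so it stays zero, and continuity
turns almost everywhere into everywhere. The sign `s` treats both bounds together. -/
theorem IsViscousSolution.sign_mul_le (hA : ContDiff ℝ 2 A) (hU : IsViscousSolution A ε T U₀ U)
    (hε : 0 < ε) (hε1 : ε ≤ 1) (hm : AEStronglyMeasurable U₀ volume) {M : ℝ} (hM0 : 0 ≤ M)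
    (hM : ∀ᵐ x, |U₀ x| ≤ M) {s : ℝ} (hs : s = 1 ∨ s = -1) {t : ℝ} (ht : t ∈ Ioo 0 T) (x : ℝ) :
    s * U t x ≤ M := by
  have hs2 : s * s = 1 := by rcases hs with rfl | rfl <;> norm_num
  have hsa : |s| = 1 := by rcases hs with rfl | rfl <;> norm_num
  obtain ⟨B', hB'⟩ := hU.bounded
  set B := max B' M
  have hB : ∀ t ∈ Ioo 0 T, ∀ x, |U t x| ≤ B := fun t ht x => (hB' t ht x).trans (le_max_left _ _)
  have hB0 : ∀ᵐ x, |U₀ x| ≤ B := hM.mono fun x hx => hx.trans (le_max_right _ _)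
  set h : ℝ → ℝ := fun u => (max (s * u - M) 0) ^ 3
  set h1 : ℝ → ℝ := fun u => 3 * (max (s * u - M) 0) ^ 2 * s
  set h2 : ℝ → ℝ := fun u => 6 * max (s * u - M) 0
  have hlin : ∀ u, HasDerivAt (fun u : ℝ => s * u - M) s u := fun u =>
    (((hasDerivAt_id u).const_mul s).sub_const M).congr_deriv (mul_one s)
  have hh : ∀ u, HasDerivAt h (h1 u) u := fun u => by
    have := (hasDerivAt_max_zero_pow 1 (s * u - M)).comp u (hlin u)
    refine this.congr_deriv ?_
    simp only [h1]; norm_num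
  have hh1 : ∀ u, HasDerivAt h1 (h2 u) u := fun u => by
    have := (((hasDerivAt_max_zero_pow 0 (s * u - M)).comp u (hlin u)).const_mul 3).mul_const s
    refine this.congr_deriv ?_
    simp only [h2]; norm_num
    linear_combination 6 * max (s * u - M) 0 * hs2
  have hh2 : Continuous h2 := by fun_prop
  have hh1c : Continuous h1 := by fun_prop
  have hhc : Continuous h := by fun_prop
  have hpos : ∀ u, 0 ≤ h u := fun u => by positivity
  obtain ⟨D, hD⟩ := (isCompact_Icc (a := -B) (b := B)).exists_bound_of_continuousOn
    (hA.continuous_deriv (by norm_num)).continuousOn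
  have hsM : s * M ∈ Icc (-B) B := by
    rw [mem_Icc, ← abs_le, abs_mul, hsa, one_mul, abs_of_nonneg hM0]
    exact le_max_right _ _
  have hD0 : 0 ≤ D := (norm_nonneg _).trans (hD _ hsM)
  have key := lintegral_mul_weight_le hA hU hε hε1 hm hB hB0 hh hh1 hh2
    (Q := fun u => ∫ w in (s * M)..u, h1 w * deriv A w)
    (hasDerivAt_integral_mul_deriv hA hh1c (s * M)) hpos (fun u => by positivity) hD0
    (fun u hu => abs_integral_mul_deriv_le hh hh1c
      (by simp only [h]; rw [← mul_assoc, hs2]; simp)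
      (fun u => by
        have e : (u - s * M) * h1 u = (s * u - s * s * M) * (3 * (max (s * u - M) 0) ^ 2) := by
          simp only [h1]; ring
        rw [e, hs2, one_mul]
        rcases le_total (s * u - M) 0 with h0 | h0
        · simp [max_eq_right h0]
        · positivity) hD hsM hu)
    (φ := fun _ => 1) (φ1 := fun _ => 0) (φ2 := fun _ => 0)
    (fun y => hasDerivAt_const _ _) (fun y => hasDerivAt_const _ _) continuous_const
    (fun y => zero_le_one) (fun y => le_rfl) (fun y => by simp)
    (X := fun _ => 0) (X1 := fun _ => 0) (fun t _ => hasDerivAt_const _ _) le_rfl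
    (fun t _ => by simp) tendsto_const_nhds (Err := fun _ => 0) (integrable_zero _ _ _)
    (fun _ => le_rfl) (fun t _ x => by simp) le_rfl (fun n hn => by
      refine le_of_eq (integral_eq_zero_of_ae ?_)
      filter_upwards [hM] with x hx
      have : s * U₀ x - M ≤ 0 := by
        have := le_abs_self (s * U₀ x)
        rw [abs_mul, hsa, one_mul] at this
        linarith
      simp [h, max_eq_right this]) ht
  simp only [mul_one, integral_zero, zero_mul, add_zero, ENNReal.ofReal_zero,
    nonpos_iff_eq_zero] at key
  have cU := hU.continuous_space ht
  rw [lintegral_eq_zero_iff (by fun_prop)] at key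
  have hall : ∀ x, ENNReal.ofReal (h (U t x)) = 0 := by
    have := (Continuous.ae_eq_iff_eq volume (f := fun x => ENNReal.ofReal (h (U t x)))
      (g := fun _ => 0) (ENNReal.continuous_ofReal.comp (hhc.comp cU)) continuous_const).1 key
    exact fun x => congrFun this x
  have hx := hall x
  rw [ENNReal.ofReal_eq_zero] at hx
  by_contra hlt
  have hp : 0 < s * U t x - M := by linarith
  have : 0 < h (U t x) := by simp only [h]; rw [max_eq_left hp.le]; positivity
  linarith

/-- The maximum principle. -/
theorem IsViscousSolution.abs_le (hA : ContDiff ℝ 2 A) (hU : IsViscousSolution A ε T U₀ U)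
    (hε : 0 < ε) (hε1 : ε ≤ 1) (hm : AEStronglyMeasurable U₀ volume) {M : ℝ} (hM0 : 0 ≤ M)
    (hM : ∀ᵐ x, |U₀ x| ≤ M) {t : ℝ} (ht : t ∈ Ioo 0 T) (x : ℝ) : |U t x| ≤ M := by
  have h1 := hU.sign_mul_le hA hε hε1 hm hM0 hM (Or.inl rfl) ht x
  have h2 := hU.sign_mul_le hA hε hε1 hm hM0 hM (Or.inr rfl) ht x
  rw [_root_.abs_le]
  constructor <;> linarith

end EntropyLimit

/-! ### Truncated Kruzhkov fluxes -/

/-- At a zero of `W` both `f` and its derivative vanish, so `f` is `o(z - y)` there and cutting it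
off to zero on part of a neighbourhood does no harm. This permits differentiation of truncated
fluxes across the boundary of the set where the truncation is active. -/
theorem hasDerivAt_ite_pos {f W : ℝ → ℝ} {f' y : ℝ} (hf : HasDerivAt f f' y)
    (hW : ContinuousAt W y) (h0 : W y = 0 → f y = 0 ∧ f' = 0) :
    HasDerivAt (fun y => if 0 < W y then f y else 0) (if 0 < W y then f' else 0) y := by
  rcases lt_trichotomy (W y) 0 with h | h | h
  · rw [if_neg (not_lt.2 h.le)]
    refine (hasDerivAt_const y (0 : ℝ)).congr_of_eventuallyEq ?_
    filter_upwards [hW.eventually_lt_const h] with z hz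
    rw [if_neg (not_lt.2 hz.le)]
  · obtain ⟨h1, h2⟩ := h0 h
    subst h2
    rw [ite_self]
    rw [hasDerivAt_iff_isLittleO] at hf ⊢
    refine Asymptotics.IsBigO.trans_isLittleO (Asymptotics.IsBigO.of_bound 1 ?_) hf
    refine Eventually.of_forall fun z => ?_
    simp only [h, lt_irrefl, if_false, h1, smul_zero, sub_zero, one_mul]
    split_ifs
    · exact le_rfl
    · simp
  · rw [if_pos h]
    refine hf.congr_of_eventuallyEq ?_
    filter_upwards [hW.eventually_const_lt h] with z hz
    rw [if_pos hz]

theorem abs_sub_le_sub_of_abs_deriv_le {f f' g g' : ℝ → ℝ} (hf : ∀ w, HasDerivAt f (f' w) w)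
    (hg : ∀ w, HasDerivAt g (g' w) w) {a b : ℝ} (hab : a ≤ b)
    (hle : ∀ w ∈ Icc a b, |f' w| ≤ g' w) : |f b - f a| ≤ g b - g a := by
  have mono : ∀ {F F' : ℝ → ℝ}, (∀ w, HasDerivAt F (F' w) w) → (∀ w ∈ Icc a b, 0 ≤ F' w) →
      F a ≤ F b := by
    intro F F' hF hF'
    refine monotoneOn_of_deriv_nonneg (convex_Icc a b)
      (fun w _ => (hF w).continuousAt.continuousWithinAt)
      (fun w _ => (hF w).differentiableAt.differentiableWithinAt)
      (fun w hw => ?_) (left_mem_Icc.2 hab) (right_mem_Icc.2 hab) hab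
    rw [(hF w).deriv]
    exact hF' w (interior_subset hw)
  have h1 := mono (fun w => (hg w).sub (hf w)) fun w hw => by
    have := abs_le.1 (hle w hw); linarith
  have h2 := mono (fun w => (hg w).add (hf w)) fun w hw => by
    have := abs_le.1 (hle w hw); linarith
  simp only [Pi.sub_apply, Pi.add_apply] at h1 h2
  rw [abs_le]
  constructor <;> linarith

/-- The `j`-th moment `∫₀ᵛ wʲ A'(w) dw` of the characteristic speed. -/
noncomputable def speedMoment (A : ℝ → ℝ) (j : ℕ) (v : ℝ) : ℝ := ∫ w in (0 : ℝ)..v, w ^ j * deriv A w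

/-- `∫_c^u 3 (w - c)² A'(w) dw`. -/
noncomputable def cubicFlux (A : ℝ → ℝ) (c u : ℝ) : ℝ :=
  3 * ((speedMoment A 2 u - speedMoment A 2 c) - 2 * c * (speedMoment A 1 u - speedMoment A 1 c)
    + c ^ 2 * (A u - A c))

/-- `∫_c^u 6 (w - c) A'(w) dw`. -/
noncomputable def quadFlux (A : ℝ → ℝ) (c u : ℝ) : ℝ :=
  6 * ((speedMoment A 1 u - speedMoment A 1 c) - c * (A u - A c))

section Flux

variable {A : ℝ → ℝ}

theorem hasDerivAt_speedMoment (hA : ContDiff ℝ 2 A) (j : ℕ) (v : ℝ) :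
    HasDerivAt (speedMoment A j) (v ^ j * deriv A v) v :=
  hasDerivAt_integral_mul_deriv hA (by fun_prop) 0 v

theorem continuous_speedMoment (hA : ContDiff ℝ 2 A) (j : ℕ) : Continuous (speedMoment A j) :=
  continuous_iff_continuousAt.2 fun v => (hasDerivAt_speedMoment hA j v).continuousAt

@[simp] theorem cubicFlux_self (c : ℝ) : cubicFlux A c c = 0 := by simp [cubicFlux]

@[simp] theorem quadFlux_self (c : ℝ) : quadFlux A c c = 0 := by simp [quadFlux]

/-- Expanding `(w - c)²` into moments separates `c` from the integration variable, so a moving base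
point is handled by the chain rule. The integrand vanishes at `w = c`, hence the motion of `c`
leaves only the `quadFlux` term. -/
theorem hasDerivAt_cubicFlux_comp (hA : ContDiff ℝ 2 A) {c u : ℝ → ℝ} {c' u' y : ℝ}
    (hc : HasDerivAt c c' y) (hu : HasDerivAt u u' y) :
    HasDerivAt (fun y => cubicFlux A (c y) (u y))
      (3 * (u y - c y) ^ 2 * deriv A (u y) * u' - c' * quadFlux A (c y) (u y)) y := by
  have a0 := fun v => (hA.differentiable (by norm_num) v).hasDerivAt
  have m1 := hasDerivAt_speedMoment hA 1
  have m2 := hasDerivAt_speedMoment hA 2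
  refine (((((m2 _).comp y hu).sub ((m2 _).comp y hc)).sub
    ((hc.const_mul 2).mul (((m1 _).comp y hu).sub ((m1 _).comp y hc)))).add
    ((hc.pow 2).mul (((a0 _).comp y hu).sub ((a0 _).comp y hc)))).const_mul 3 |>.congr_deriv ?_
  simp only [quadFlux, Pi.sub_apply, Function.comp, Pi.pow_apply]
  push_cast
  ring

theorem hasDerivAt_cubicFlux (hA : ContDiff ℝ 2 A) (c u : ℝ) :
    HasDerivAt (cubicFlux A c) (3 * (u - c) ^ 2 * deriv A u) u :=
  (hasDerivAt_cubicFlux_comp hA (hasDerivAt_const u c) (hasDerivAt_id u)).congr_deriv (by simp)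

theorem hasDerivAt_quadFlux (hA : ContDiff ℝ 2 A) (c u : ℝ) :
    HasDerivAt (quadFlux A c) (6 * (u - c) * deriv A u) u := by
  have a0 := (hA.differentiable (by norm_num) u).hasDerivAt
  have m1 := hasDerivAt_speedMoment hA 1 u
  refine (((m1.sub_const (speedMoment A 1 c)).sub
    ((a0.sub_const (A c)).const_mul c)).const_mul 6).congr_deriv ?_
  ring

theorem abs_cubicFlux_le (hA : ContDiff ℝ 2 A) {B D : ℝ}
    (hD : ∀ u ∈ Icc (-B) B, |deriv A u| ≤ D) {c u : ℝ} (hc : c ∈ Icc (-B) B)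
    (hu : u ∈ Icc (-B) B) : |cubicFlux A c u| ≤ D * |u - c| ^ 3 := by
  have hg : ∀ w, HasDerivAt (fun w => D * (w - c) ^ 3) (D * (3 * (w - c) ^ 2)) w := fun w =>
    ((((hasDerivAt_id w).sub_const c).pow 3).const_mul D).congr_deriv (by simp)
  have hle : ∀ w ∈ Icc (-B) B, |3 * (w - c) ^ 2 * deriv A w| ≤ D * (3 * (w - c) ^ 2) := by
    intro w hw
    rw [abs_mul, abs_of_nonneg (by positivity : (0 : ℝ) ≤ 3 * (w - c) ^ 2), mul_comm]
    gcongr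
    exact hD w hw
  rcases le_total c u with h | h
  · have := abs_sub_le_sub_of_abs_deriv_le (hasDerivAt_cubicFlux hA c) hg h fun w hw =>
      hle w ⟨hc.1.trans hw.1, hw.2.trans hu.2⟩
    rw [cubicFlux_self] at this
    rw [abs_of_nonneg (sub_nonneg.2 h)]
    simpa using this
  · have := abs_sub_le_sub_of_abs_deriv_le (hasDerivAt_cubicFlux hA c) hg h fun w hw =>
      hle w ⟨hu.1.trans hw.1, hw.2.trans hc.2⟩
    rw [cubicFlux_self, zero_sub, abs_neg] at this
    rw [abs_of_nonpos (sub_nonpos.2 h)]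
    refine this.trans (le_of_eq ?_)
    ring

/-- Here convexity of the flux enters the doubling argument. After substitution the difference is
the integral of `6 w (A'(d - w) - A'(c + w))` over `0 ≤ w ≤ W`. If `d - w ≤ c + w` the integrand has
the good sign; otherwise the two points are at most `d - c ≤ W` apart and the Lipschitz bound on
`A'` gives `6 w L W`. -/
theorem quadFlux_sub_le (hA : ContDiff ℝ 2 A) (hmono : Monotone (deriv A)) {B L : ℝ} (hL0 : 0 ≤ L)
    (hL : ∀ u ∈ Icc (-B) B, ∀ v ∈ Icc (-B) B, |deriv A u - deriv A v| ≤ L * |u - v|)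
    {c d W : ℝ} (hW : 0 ≤ W) (hcd : d - c ≤ W) (h1 : d - W ∈ Icc (-B) B) (h2 : d ∈ Icc (-B) B)
    (h3 : c ∈ Icc (-B) B) (h4 : c + W ∈ Icc (-B) B) :
    quadFlux A d (d - W) - quadFlux A c (c + W) ≤ 3 * L * W ^ 3 := by
  set G : ℝ → ℝ := fun w => 3 * L * W * w ^ 2 - quadFlux A d (d - w) + quadFlux A c (c + w)
  have hG : ∀ w, HasDerivAt G (6 * w * (L * W - (deriv A (d - w) - deriv A (c + w)))) w := by
    intro w
    have e1 := (hasDerivAt_quadFlux hA d (d - w)).comp w ((hasDerivAt_id w).const_sub d)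
    have e2 := (hasDerivAt_quadFlux hA c (c + w)).comp w ((hasDerivAt_id w).const_add c)
    refine ((((hasDerivAt_pow 2 w).const_mul (3 * L * W)).sub e1).add e2).congr_deriv ?_
    push_cast; ring
  have hmonoG : G 0 ≤ G W := by
    refine monotoneOn_of_deriv_nonneg (convex_Icc 0 W)
      (fun w _ => (hG w).continuousAt.continuousWithinAt)
      (fun w _ => (hG w).differentiableAt.differentiableWithinAt)
      (fun w hw => ?_) (left_mem_Icc.2 hW) (right_mem_Icc.2 hW) hW
    have hw' := interior_subset hw
    rw [(hG w).deriv]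
    refine mul_nonneg (by linarith [hw'.1]) ?_
    rcases le_total (d - w) (c + w) with h | h
    · have := hmono h
      have : 0 ≤ L * W := by positivity
      linarith
    · have e := hL (d - w) ⟨h1.1.trans (by linarith [hw'.2]), by linarith [h2.2, hw'.1]⟩ (c + w)
        ⟨by linarith [h3.1, hw'.1], by linarith [h4.2, hw'.2]⟩
      rw [abs_of_nonneg (sub_nonneg.2 h)] at e
      have e2 := le_abs_self (deriv A (d - w) - deriv A (c + w))
      have : L * (d - w - (c + w)) ≤ L * W := by
        gcongr; linarith [hw'.1]
      linarith
  simp only [G] at hmonoG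
  simp only [sub_zero, add_zero, quadFlux_self, ne_eq, OfNat.ofNat_ne_zero, not_false_eq_true,
    zero_pow, mul_zero] at hmonoG
  nlinarith

end Flux

/-! ### Doubling of the space variable -/

section Doubling

variable {A : ℝ → ℝ} {ε N k : ℝ} {u u1 u2 r r1 r2 : ℝ → ℝ}

/-- The positive part of `u(y) - u(x) - N (y - x) - k`. -/
noncomputable def excess (N k : ℝ) (u : ℝ → ℝ) (x y : ℝ) : ℝ :=
  max (u y - u x - N * (y - x) - k) 0

/-- This is the flux in the variable `y`, relative to the base level `u x + N (y - x) + k`, which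
itself moves with slope `N`; that motion produces the `quadFlux` term. Writing the upper endpoint as
base level plus `excess` makes it equal to `u y` where the truncation is active and makes both
fluxes vanish elsewhere, so no case distinction is left in the statement. -/
theorem hasDerivAt_doubling_right (hA : ContDiff ℝ 2 A) (hu : ∀ y, HasDerivAt u (u1 y) y)
    (hu1 : ∀ y, HasDerivAt u1 (u2 y) y) (hr : ∀ y, HasDerivAt r (r1 y) y)
    (hr1 : ∀ y, HasDerivAt r1 (r2 y) y) (x y : ℝ) :
    HasDerivAt (fun y => ε * (3 * excess N k u x y ^ 2 * (u1 y - N)) * r y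
        - ε * excess N k u x y ^ 3 * r1 y
        - cubicFlux A (u x + N * (y - x) + k) (u x + N * (y - x) + k + excess N k u x y) * r y)
      (3 * excess N k u x y ^ 2 * (ε * u2 y - deriv A (u y) * u1 y) * r y
        + 6 * ε * excess N k u x y * (u1 y - N) ^ 2 * r y - ε * excess N k u x y ^ 3 * r2 y
        + N * quadFlux A (u x + N * (y - x) + k) (u x + N * (y - x) + k + excess N k u x y) * r y
        - cubicFlux A (u x + N * (y - x) + k) (u x + N * (y - x) + k + excess N k u x y) * r1 y)
      y := by
  set W : ℝ → ℝ := fun y => u y - u x - N * (y - x) - k with hWdef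
  have hlin : HasDerivAt (fun y => N * (y - x)) N y :=
    (((hasDerivAt_id y).sub_const x).const_mul N).congr_deriv (mul_one N)
  have hW : HasDerivAt W (u1 y - N) y := (((hu y).sub_const (u x)).sub hlin).sub_const k
  have hc : HasDerivAt (fun y => u x + N * (y - x) + k) N y :=
    (hlin.const_add (u x)).add_const k
  have hK := hasDerivAt_cubicFlux_comp hA hc (hu y)
  have hraw : HasDerivAt (fun y => ε * (3 * W y ^ 2 * (u1 y - N)) * r y - ε * W y ^ 3 * r1 y
        - cubicFlux A (u x + N * (y - x) + k) (u y) * r y)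
      (3 * W y ^ 2 * (ε * u2 y - deriv A (u y) * u1 y) * r y
        + 6 * ε * W y * (u1 y - N) ^ 2 * r y - ε * W y ^ 3 * r2 y
        + N * quadFlux A (u x + N * (y - x) + k) (u y) * r y
        - cubicFlux A (u x + N * (y - x) + k) (u y) * r1 y) y := by
    refine ((((((hW.pow 2).const_mul 3).mul ((hu1 y).sub_const N)).const_mul ε).mul (hr y)).sub
      (((hW.pow 3).const_mul ε).mul (hr1 y)) |>.sub (hK.mul (hr y))).congr_deriv ?_
    simp only [hWdef, Pi.pow_apply, Pi.mul_apply]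
    push_cast
    ring
  have huW : ∀ y, W y = 0 → u y = u x + N * (y - x) + k := fun y h => by
    simp only [hWdef] at h; linarith
  have hite := hasDerivAt_ite_pos hraw hW.continuousAt (fun h => by
    rw [h, huW y h]; simp)
  have hcW : ∀ y, u x + N * (y - x) + k + W y = u y := fun y => by simp only [hWdef]; ring
  have hex : ∀ y, excess N k u x y = max (W y) 0 := fun y => rfl
  refine (hite.congr_of_eventuallyEq (Eventually.of_forall fun y => ?_)).congr_deriv ?_
  · simp only [hex]
    split_ifs with h
    · rw [max_eq_left h.le, hcW]
    · rw [max_eq_right (not_lt.1 h)]; simp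
  · simp only [hex]
    split_ifs with h
    · rw [max_eq_left h.le, hcW]
    · rw [max_eq_right (not_lt.1 h)]; simp

theorem hasDerivAt_doubling_left (hA : ContDiff ℝ 2 A) (hu : ∀ y, HasDerivAt u (u1 y) y)
    (hu1 : ∀ y, HasDerivAt u1 (u2 y) y) (hr : ∀ y, HasDerivAt r (r1 y) y)
    (hr1 : ∀ y, HasDerivAt r1 (r2 y) y) (x y : ℝ) :
    HasDerivAt (fun x => ε * (3 * excess N k u x y ^ 2 * (N - u1 x)) * r x
        - ε * excess N k u x y ^ 3 * r1 x
        + cubicFlux A (u y - N * (y - x) - k) (u y - N * (y - x) - k - excess N k u x y) * r x)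
      (-(3 * excess N k u x y ^ 2 * (ε * u2 x - deriv A (u x) * u1 x) * r x)
        + 6 * ε * excess N k u x y * (N - u1 x) ^ 2 * r x - ε * excess N k u x y ^ 3 * r2 x
        - N * quadFlux A (u y - N * (y - x) - k) (u y - N * (y - x) - k - excess N k u x y) * r x
        + cubicFlux A (u y - N * (y - x) - k) (u y - N * (y - x) - k - excess N k u x y) * r1 x)
      x := by
  set W : ℝ → ℝ := fun x => u y - u x - N * (y - x) - k with hWdef
  have hlin : HasDerivAt (fun x => N * (y - x)) (-N) x :=
    (((hasDerivAt_id x).const_sub y).const_mul N).congr_deriv (by ring)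
  have hW : HasDerivAt W (N - u1 x) x :=
    ((((hu x).const_sub (u y)).sub hlin).sub_const k).congr_deriv (by ring)
  have hc : HasDerivAt (fun x => u y - N * (y - x) - k) N x :=
    ((hlin.const_sub (u y)).sub_const k).congr_deriv (neg_neg N)
  have hK := hasDerivAt_cubicFlux_comp hA hc (hu x)
  have hraw : HasDerivAt (fun x => ε * (3 * W x ^ 2 * (N - u1 x)) * r x - ε * W x ^ 3 * r1 x
        + cubicFlux A (u y - N * (y - x) - k) (u x) * r x)
      (-(3 * W x ^ 2 * (ε * u2 x - deriv A (u x) * u1 x) * r x)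
        + 6 * ε * W x * (N - u1 x) ^ 2 * r x - ε * W x ^ 3 * r2 x
        - N * quadFlux A (u y - N * (y - x) - k) (u x) * r x
        + cubicFlux A (u y - N * (y - x) - k) (u x) * r1 x) x := by
    refine ((((((hW.pow 2).const_mul 3).mul ((hu1 x).const_sub N)).const_mul ε).mul (hr x)).sub
      (((hW.pow 3).const_mul ε).mul (hr1 x)) |>.add (hK.mul (hr x))).congr_deriv ?_
    simp only [hWdef, Pi.pow_apply, Pi.mul_apply]
    push_cast
    ring
  have huW : ∀ x, W x = 0 → u x = u y - N * (y - x) - k := fun x h => by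
    simp only [hWdef] at h; linarith
  have hite := hasDerivAt_ite_pos hraw hW.continuousAt (fun h => by
    rw [h, huW x h]; simp)
  have hcW : ∀ x, u y - N * (y - x) - k - W x = u x := fun x => by simp only [hWdef]; ring
  have hex : ∀ x, excess N k u x y = max (W x) 0 := fun y => rfl
  refine (hite.congr_of_eventuallyEq (Eventually.of_forall fun x => ?_)).congr_deriv ?_
  · simp only [hex]
    split_ifs with h
    · rw [max_eq_left h.le, hcW]
    · rw [max_eq_right (not_lt.1 h)]; simp
  · simp only [hex]
    split_ifs with h
    · rw [max_eq_left h.le, hcW]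
    · rw [max_eq_right (not_lt.1 h)]; simp

theorem excess_nonneg (x y : ℝ) : 0 ≤ excess N k u x y := le_max_right _ _

theorem excess_self (hk : 0 ≤ k) (x : ℝ) : excess N k u x x = 0 :=
  max_eq_right (by simp [hk])

theorem excess_le {B : ℝ} (hN : 0 ≤ N) (hk : 0 ≤ k) (hB : ∀ x, |u x| ≤ B) {x y : ℝ} (hxy : x < y) :
    excess N k u x y ≤ 2 * B := by
  have h1 := abs_le.1 (hB x)
  have h2 := abs_le.1 (hB y)
  refine max_le ?_ (by linarith)
  have : 0 ≤ N * (y - x) := mul_nonneg hN (by linarith)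
  linarith

end Doubling

/-! ### The doubled inequality, pointwise and integrated. -/

section DoublingIntegral

variable {A : ℝ → ℝ} {ε N k : ℝ} {u u1 u2 r r1 r2 : ℝ → ℝ}

/-- The time rate is an exact `y`-derivative plus an exact `x`-derivative up to three kinds of
terms: the viscous squares, which have a favourable sign; the `N` term, bounded by `quadFlux_sub_le`
applied with `c + w = u y` and `d - w = u x`; and four terms with derivatives of the cutoff, which
give the constant `112 (ε + D)` and the remainder in `δ`. -/
theorem doubling_rate_le (hA : ContDiff ℝ 2 A) (hmono : Monotone (deriv A)) {B D L δ : ℝ}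
    (hε : 0 ≤ ε) (hN : 0 ≤ N) (hk : 0 ≤ k) (hD : ∀ u ∈ Icc (-B) B, |deriv A u| ≤ D)
    (hL0 : 0 ≤ L)
    (hL : ∀ u ∈ Icc (-B) B, ∀ v ∈ Icc (-B) B, |deriv A u - deriv A v| ≤ L * |u - v|)
    (hB : ∀ x, |u x| ≤ B) (hδ : 0 ≤ δ) (hr0 : ∀ y, 0 ≤ r y) (hrle : ∀ y, r y ≤ 1)
    (hr1 : ∀ y, |r1 y| ≤ 56 * (r y + δ)) (hr2 : ∀ y, |r2 y| ≤ 56 * (r y + δ)) {x y : ℝ}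
    (hxy : x < y) :
    3 * excess N k u x y ^ 2 * ((ε * u2 y - deriv A (u y) * u1 y) -
        (ε * u2 x - deriv A (u x) * u1 x)) * (r x * r y) ≤
      (3 * excess N k u x y ^ 2 * (ε * u2 y - deriv A (u y) * u1 y) * r y
        + 6 * ε * excess N k u x y * (u1 y - N) ^ 2 * r y - ε * excess N k u x y ^ 3 * r2 y
        + N * quadFlux A (u x + N * (y - x) + k) (u x + N * (y - x) + k + excess N k u x y) * r y
        - cubicFlux A (u x + N * (y - x) + k) (u x + N * (y - x) + k + excess N k u x y) * r1 y)
        * r x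
      + (-(3 * excess N k u x y ^ 2 * (ε * u2 x - deriv A (u x) * u1 x) * r x)
        + 6 * ε * excess N k u x y * (N - u1 x) ^ 2 * r x - ε * excess N k u x y ^ 3 * r2 x
        - N * quadFlux A (u y - N * (y - x) - k) (u y - N * (y - x) - k - excess N k u x y) * r x
        + cubicFlux A (u y - N * (y - x) - k) (u y - N * (y - x) - k - excess N k u x y) * r1 x)
        * r y
      + (112 * (ε + D) + 3 * N * L) * (excess N k u x y ^ 3 * (r x * r y))
      + 112 * (ε + D) * (2 * B) ^ 3 * δ := by
  have hD0 : 0 ≤ D := (abs_nonneg _).trans (hD _ (abs_le.1 (hB 0)))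
  have hB0 : 0 ≤ B := (abs_nonneg _).trans (hB 0)
  have hw0 := excess_nonneg (N := N) (k := k) (u := u) x y
  have hwle := excess_le hN hk hB hxy (u := u)
  set w := excess N k u x y with hw
  set c := u x + N * (y - x) + k with hc
  set d := u y - N * (y - x) - k with hd
  have hNxy : 0 ≤ N * (y - x) := mul_nonneg hN (by linarith)
  rcases hw0.eq_or_lt with hz | hpos
  · rw [← hz]
    simp only [add_zero, sub_zero, quadFlux_self, cubicFlux_self]
    have : 0 ≤ 112 * (ε + D) * (2 * B) ^ 3 * δ := by positivity
    linarith
  · have hwW : w = u y - u x - N * (y - x) - k := by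
      rcases max_choice (u y - u x - N * (y - x) - k) 0 with h | h
      · exact h
      · exact absurd (hw.trans h) hpos.ne'
    have hcw : c + w = u y := by rw [hwW, hc]; ring
    have hdw : d - w = u x := by rw [hwW, hd]; ring
    have hux := abs_le.1 (hB x)
    have huy := abs_le.1 (hB y)
    have hcB : c ∈ Icc (-B) B := ⟨by linarith, by linarith⟩
    have hdB : d ∈ Icc (-B) B := ⟨by linarith, by linarith⟩
    have hcwB : c + w ∈ Icc (-B) B := by rw [hcw]; exact huy
    have hdwB : d - w ∈ Icc (-B) B := by rw [hdw]; exact hux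
    have ea := abs_cubicFlux_le hA hD hcB hcwB
    have eb := abs_cubicFlux_le hA hD hdB hdwB
    have eq2 := quadFlux_sub_le hA hmono hL0 hL hpos.le (by linarith : d - c ≤ w) hdwB hdB hcB hcwB
    rw [add_sub_cancel_left, abs_of_pos hpos] at ea
    rw [show d - w - d = -w by ring, abs_neg, abs_of_pos hpos] at eb
    set a := cubicFlux A c (c + w)
    set b := cubicFlux A d (d - w)
    set qc := quadFlux A c (c + w)
    set qd := quadFlux A d (d - w)
    have hx0 := hr0 x
    have hy0 := hr0 y
    have hx1 := hrle x
    have hy1 := hrle y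
    have hw3 : 0 ≤ w ^ 3 := by positivity
    have hrr : 0 ≤ r x * r y := mul_nonneg hx0 hy0
    have cross : ∀ {p q s g : ℝ}, |g| ≤ 56 * (q + δ) → 0 ≤ p → p ≤ 1 → |s| ≤ w ^ 3 →
        s * g * p ≤ 56 * w ^ 3 * (p * q + δ) := by
      intro p q s g hg hp hp1 hs
      have h1 : s * g ≤ w ^ 3 * (56 * (q + δ)) :=
        (le_abs_self _).trans (by rw [abs_mul]; exact mul_le_mul hs hg (abs_nonneg _) hw3)
      have h2 := mul_le_mul_of_nonneg_right h1 hp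
      have h3 : w ^ 3 * 56 * δ * p ≤ w ^ 3 * 56 * δ * 1 := by gcongr
      nlinarith
    have hwabs : |w ^ 3| ≤ w ^ 3 := le_of_eq (abs_of_nonneg hw3)
    have crossD : ∀ {p q s g : ℝ}, |g| ≤ 56 * (q + δ) → 0 ≤ p → p ≤ 1 → |s| ≤ D * w ^ 3 →
        s * g * p ≤ 56 * (D * w ^ 3) * (p * q + δ) := by
      intro p q s g hg hp hp1 hs
      have h1 : s * g ≤ D * w ^ 3 * (56 * (q + δ)) :=
        (le_abs_self _).trans (by rw [abs_mul]; exact mul_le_mul hs hg (abs_nonneg _) (by positivity))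
      have h2 := mul_le_mul_of_nonneg_right h1 hp
      have h3 : D * w ^ 3 * 56 * δ * p ≤ D * w ^ 3 * 56 * δ * 1 := by gcongr
      nlinarith
    have t1 := mul_le_mul_of_nonneg_left (cross (hr2 y) hx0 hx1 hwabs) hε
    have t2 := mul_le_mul_of_nonneg_left (cross (hr2 x) hy0 hy1 hwabs) hε
    have t3 := crossD (hr1 y) hx0 hx1 ea
    have t4 := crossD (s := -b) (hr1 x) hy0 hy1 (by rwa [abs_neg])
    have t5 : N * (qd - qc) * (r x * r y) ≤ N * (3 * L * w ^ 3) * (r x * r y) := by gcongr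
    have t6 : 0 ≤ 6 * ε * w * ((u1 y - N) ^ 2 + (N - u1 x) ^ 2) * (r x * r y) := by positivity
    have t7 : 112 * (ε + D) * w ^ 3 * δ ≤ 112 * (ε + D) * (2 * B) ^ 3 * δ := by gcongr
    linarith [t1, t2, t3, t4, t5, t6, t7]

theorem continuous_cubicFlux_comp {α : Type*} [TopologicalSpace α] (hA : ContDiff ℝ 2 A)
    {f g : α → ℝ} (hf : Continuous f) (hg : Continuous g) :
    Continuous fun p => cubicFlux A (f p) (g p) := by
  have h1 := continuous_speedMoment hA 1
  have h2 := continuous_speedMoment hA 2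
  have h0 := hA.continuous
  unfold cubicFlux
  fun_prop

theorem continuous_quadFlux_comp {α : Type*} [TopologicalSpace α] (hA : ContDiff ℝ 2 A)
    {f g : α → ℝ} (hf : Continuous f) (hg : Continuous g) :
    Continuous fun p => quadFlux A (f p) (g p) := by
  have h1 := continuous_speedMoment hA 1
  have h0 := hA.continuous
  unfold quadFlux
  fun_prop

theorem continuous_excess (hu : Continuous u) :
    Continuous fun p : ℝ × ℝ => excess N k u p.1 p.2 := by
  unfold excess
  fun_prop

theorem integrable_ite_lt {f : ℝ × ℝ → ℝ} (hf : Continuous f) (R : ℝ) :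
    Integrable (fun p : ℝ × ℝ => if p.1 < p.2 then f p else 0)
      ((volume.restrict (Icc (-R) R)).prod (volume.restrict (Icc (-R) R))) := by
  rw [Measure.prod_restrict]
  have h1 : IntegrableOn f (Icc (-R) R ×ˢ Icc (-R) R) (volume.prod volume) :=
    hf.continuousOn.integrableOn_compact (isCompact_Icc.prod isCompact_Icc)
  have hms : MeasurableSet {p : ℝ × ℝ | p.1 < p.2} := measurableSet_lt measurable_fst measurable_snd
  have h2 := Integrable.indicator h1 hms
  refine h2.congr (Eventually.of_forall fun p => ?_)
  simp [indicator_apply]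

theorem setIntegral_ite_lt_right {F f : ℝ → ℝ} (hF : ∀ y, HasDerivAt F (f y) y)
    (hf : Continuous f) {R x : ℝ} (hx : x ∈ Icc (-R) R) (hx0 : F x = 0) (hR : F R = 0) :
    ∫ y in Icc (-R) R, (if x < y then f y else 0) = 0 := by
  have h1 : ∀ y, (if x < y then f y else 0) = (Ioi x).indicator f y := fun y => by
    simp [indicator_apply]
  simp_rw [h1]
  rw [setIntegral_indicator measurableSet_Ioi]
  have h2 : Icc (-R) R ∩ Ioi x = Ioc x R := by
    ext y
    simp only [mem_inter_iff, mem_Icc, mem_Ioi, mem_Ioc]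
    exact ⟨fun h => ⟨h.2, h.1.2⟩, fun h => ⟨⟨hx.1.trans h.1.le, h.2⟩, h.1⟩⟩
  rw [h2, ← intervalIntegral.integral_of_le hx.2,
    intervalIntegral.integral_eq_sub_of_hasDerivAt (fun y _ => hF y) (hf.intervalIntegrable _ _),
    hx0, hR, sub_zero]

theorem setIntegral_ite_lt_left {F f : ℝ → ℝ} (hF : ∀ x, HasDerivAt F (f x) x)
    (hf : Continuous f) {R y : ℝ} (hy : y ∈ Icc (-R) R) (hy0 : F y = 0) (hR : F (-R) = 0) :
    ∫ x in Icc (-R) R, (if x < y then f x else 0) = 0 := by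
  have h1 : ∀ x, (if x < y then f x else 0) = (Iio y).indicator f x := fun y => by
    simp [indicator_apply]
  simp_rw [h1]
  rw [setIntegral_indicator measurableSet_Iio]
  have h2 : Icc (-R) R ∩ Iio y = Ico (-R) y := by
    ext x
    simp only [mem_inter_iff, mem_Icc, mem_Iio, mem_Ico]
    exact ⟨fun h => ⟨h.1.1, h.2⟩, fun h => ⟨⟨h.1, h.2.le.trans hy.2⟩, h.2⟩⟩
  rw [h2, setIntegral_congr_set Ico_ae_eq_Ioc, ← intervalIntegral.integral_of_le hy.1,
    intervalIntegral.integral_eq_sub_of_hasDerivAt (fun y _ => hF y) (hf.intervalIntegrable _ _),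
    hy0, hR, sub_zero]

theorem integral_doubling_rate_le (hA : ContDiff ℝ 2 A) (hmono : Monotone (deriv A)) {B D L δ R : ℝ}
    (hε : 0 ≤ ε) (hN : 0 ≤ N) (hk : 0 ≤ k) (hD : ∀ u ∈ Icc (-B) B, |deriv A u| ≤ D)
    (hL0 : 0 ≤ L)
    (hL : ∀ u ∈ Icc (-B) B, ∀ v ∈ Icc (-B) B, |deriv A u - deriv A v| ≤ L * |u - v|)
    (hB : ∀ x, |u x| ≤ B) (hδ : 0 ≤ δ) (hr0 : ∀ y, 0 ≤ r y) (hrle : ∀ y, r y ≤ 1)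
    (hr1 : ∀ y, |r1 y| ≤ 56 * (r y + δ)) (hr2 : ∀ y, |r2 y| ≤ 56 * (r y + δ))
    (hu : ∀ y, HasDerivAt u (u1 y) y)
    (hu1 : ∀ y, HasDerivAt u1 (u2 y) y) (hu2 : Continuous u2) (hr : ∀ y, HasDerivAt r (r1 y) y)
    (hr1' : ∀ y, HasDerivAt r1 (r2 y) y) (hr2' : Continuous r2) (hR : 0 ≤ R)
    (z0 : ∀ y, R ≤ |y| → r y = 0) (z1 : ∀ y, R ≤ |y| → r1 y = 0) :
    ∫ p : ℝ × ℝ, (if p.1 < p.2 then 3 * excess N k u p.1 p.2 ^ 2 *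
        ((ε * u2 p.2 - deriv A (u p.2) * u1 p.2) - (ε * u2 p.1 - deriv A (u p.1) * u1 p.1)) *
        (r p.1 * r p.2) else 0)
        ∂((volume.restrict (Icc (-R) R)).prod (volume.restrict (Icc (-R) R))) ≤
      (112 * (ε + D) + 3 * N * L) *
        ∫ p : ℝ × ℝ, (if p.1 < p.2 then excess N k u p.1 p.2 ^ 3 * (r p.1 * r p.2) else 0)
          ∂((volume.restrict (Icc (-R) R)).prod (volume.restrict (Icc (-R) R)))
      + 112 * (ε + D) * (2 * B) ^ 3 * δ * (2 * R) ^ 2 := by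
  have cu : Continuous u := continuous_iff_continuousAt.2 fun u => (hu u).continuousAt
  have cu1 : Continuous u1 := continuous_iff_continuousAt.2 fun u => (hu1 u).continuousAt
  have cr : Continuous r := continuous_iff_continuousAt.2 fun u => (hr u).continuousAt
  have cr1 : Continuous r1 := continuous_iff_continuousAt.2 fun u => (hr1' u).continuousAt
  have cA : Continuous (deriv A) := hA.continuous_deriv (by norm_num)
  have cw : Continuous fun p : ℝ × ℝ => excess N k u p.1 p.2 := continuous_excess cu
  have hB0 : 0 ≤ B := (abs_nonneg _).trans (hB 0)
  have hD0 : 0 ≤ D := (abs_nonneg _).trans (hD _ (abs_le.1 (hB 0)))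
  set μ := volume.restrict (Icc (-R) R)
  set f0 : ℝ × ℝ → ℝ := fun p => 3 * excess N k u p.1 p.2 ^ 2 *
        ((ε * u2 p.2 - deriv A (u p.2) * u1 p.2) - (ε * u2 p.1 - deriv A (u p.1) * u1 p.1)) *
        (r p.1 * r p.2) with hf0
  set RD : ℝ × ℝ → ℝ := fun p =>
      (3 * excess N k u p.1 p.2 ^ 2 * (ε * u2 p.2 - deriv A (u p.2) * u1 p.2) * r p.2
        + 6 * ε * excess N k u p.1 p.2 * (u1 p.2 - N) ^ 2 * r p.2
        - ε * excess N k u p.1 p.2 ^ 3 * r2 p.2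
        + N * quadFlux A (u p.1 + N * (p.2 - p.1) + k)
            (u p.1 + N * (p.2 - p.1) + k + excess N k u p.1 p.2) * r p.2
        - cubicFlux A (u p.1 + N * (p.2 - p.1) + k)
            (u p.1 + N * (p.2 - p.1) + k + excess N k u p.1 p.2) * r1 p.2) with hRD
  set LD : ℝ × ℝ → ℝ := fun p =>
      (-(3 * excess N k u p.1 p.2 ^ 2 * (ε * u2 p.1 - deriv A (u p.1) * u1 p.1) * r p.1)
        + 6 * ε * excess N k u p.1 p.2 * (N - u1 p.1) ^ 2 * r p.1
        - ε * excess N k u p.1 p.2 ^ 3 * r2 p.1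
        - N * quadFlux A (u p.2 - N * (p.2 - p.1) - k)
            (u p.2 - N * (p.2 - p.1) - k - excess N k u p.1 p.2) * r p.1
        + cubicFlux A (u p.2 - N * (p.2 - p.1) - k)
            (u p.2 - N * (p.2 - p.1) - k - excess N k u p.1 p.2) * r1 p.1) with hLD
  have cf0 : Continuous f0 := by fun_prop
  have cRD : Continuous RD := by
    have e1 := continuous_cubicFlux_comp hA
      (f := fun p : ℝ × ℝ => u p.1 + N * (p.2 - p.1) + k)
      (g := fun p : ℝ × ℝ => u p.1 + N * (p.2 - p.1) + k + excess N k u p.1 p.2)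
      (by fun_prop) (by fun_prop)
    have e2 := continuous_quadFlux_comp hA
      (f := fun p : ℝ × ℝ => u p.1 + N * (p.2 - p.1) + k)
      (g := fun p : ℝ × ℝ => u p.1 + N * (p.2 - p.1) + k + excess N k u p.1 p.2)
      (by fun_prop) (by fun_prop)
    fun_prop
  have cLD : Continuous LD := by
    have e1 := continuous_cubicFlux_comp hA
      (f := fun p : ℝ × ℝ => u p.2 - N * (p.2 - p.1) - k)
      (g := fun p : ℝ × ℝ => u p.2 - N * (p.2 - p.1) - k - excess N k u p.1 p.2)
      (by fun_prop) (by fun_prop)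
    have e2 := continuous_quadFlux_comp hA
      (f := fun p : ℝ × ℝ => u p.2 - N * (p.2 - p.1) - k)
      (g := fun p : ℝ × ℝ => u p.2 - N * (p.2 - p.1) - k - excess N k u p.1 p.2)
      (by fun_prop) (by fun_prop)
    fun_prop
  have i0 := integrable_ite_lt cf0 R
  have i1 := integrable_ite_lt (f := fun p => RD p * r p.1) (by fun_prop) R
  have i2 := integrable_ite_lt (f := fun p => LD p * r p.2) (by fun_prop) R
  have i3 := integrable_ite_lt
    (f := fun p : ℝ × ℝ => excess N k u p.1 p.2 ^ 3 * (r p.1 * r p.2)) (by fun_prop) R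
  -- For fixed `x` the flux vanishes at `y = R` through the cutoff, and on the diagonal because `k ≥
  -- 0` makes the excess zero there. The restriction to `x < y` thus creates no boundary term.
  have hI1 : ∫ p : ℝ × ℝ, (if p.1 < p.2 then RD p * r p.1 else 0) ∂(μ.prod μ) = 0 := by
    rw [integral_prod _ i1]
    refine integral_eq_zero_of_ae ?_
    filter_upwards [ae_restrict_mem measurableSet_Icc] with x hx
    refine setIntegral_ite_lt_right
      (fun y => (hasDerivAt_doubling_right (ε := ε) (N := N) (k := k) hA hu hu1 hr hr1' x
        y).mul_const (r x))
      ((cRD.comp (by fun_prop : Continuous fun y : ℝ => (x, y))).mul continuous_const) hx ?_ ?_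
    · rw [excess_self hk]; simp
    · rw [z0 R (le_abs_self R), z1 R (le_abs_self R)]; simp
  have hI2 : ∫ p : ℝ × ℝ, (if p.1 < p.2 then LD p * r p.2 else 0) ∂(μ.prod μ) = 0 := by
    rw [integral_prod_symm _ i2]
    refine integral_eq_zero_of_ae ?_
    filter_upwards [ae_restrict_mem measurableSet_Icc] with y hy
    have hRa : R ≤ |(-R)| := by rw [abs_neg]; exact le_abs_self R
    refine setIntegral_ite_lt_left
      (fun x => (hasDerivAt_doubling_left (ε := ε) (N := N) (k := k) hA hu hu1 hr hr1' x
        y).mul_const (r y))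
      ((cLD.comp (by fun_prop : Continuous fun x : ℝ => (x, y))).mul continuous_const) hy ?_ ?_
    · rw [excess_self hk]; simp
    · rw [z0 _ hRa, z1 _ hRa]; simp
  have hle : ∀ p : ℝ × ℝ, (if p.1 < p.2 then f0 p else 0) ≤
      (((if p.1 < p.2 then RD p * r p.1 else 0) + (if p.1 < p.2 then LD p * r p.2 else 0))
      + (112 * (ε + D) + 3 * N * L) *
        (if p.1 < p.2 then excess N k u p.1 p.2 ^ 3 * (r p.1 * r p.2) else 0))
      + 112 * (ε + D) * (2 * B) ^ 3 * δ := by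
    intro p
    split_ifs with hp
    · exact doubling_rate_le hA hmono hε hN hk hD hL0 hL hB hδ hr0 hrle hr1 hr2 hp
    · have : 0 ≤ 112 * (ε + D) * (2 * B) ^ 3 * δ := by positivity
      simpa using this
  refine (integral_mono i0 (((i1.add i2).add (i3.const_mul _)).add (integrable_const _))
    hle).trans (le_of_eq ?_)
  rw [integral_add' ((i1.add i2).add (i3.const_mul _)) (integrable_const _),
    integral_add' (i1.add i2) (i3.const_mul _), integral_add' i1 i2, hI1, hI2, integral_const_mul,
    integral_const]
  have hμ : (μ.prod μ).real univ = (2 * R) ^ 2 := by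
    rw [← univ_prod_univ, measureReal_prod_prod]
    simp only [μ, MeasurableSet.univ, measureReal_restrict_apply, univ_inter, Real.volume_real_Icc]
    rw [max_eq_left (by linarith)]
    ring
  rw [hμ, smul_eq_mul]
  ring

end DoublingIntegral

/-! ### Propagation of the one-sided modulus. -/

section OneSided

variable {A : ℝ → ℝ} {ε T : ℝ} {U₀ : ℝ → ℝ} {U : ℝ → ℝ → ℝ} {N k : ℝ}

/-- The doubled functional `∬_{x<y} (u(y) - u(x) - N (y - x) - k)₊³ r(x) r(y)`. -/
noncomputable def doubledExcess (N k R : ℝ) (u : ℝ → ℝ) : ℝ :=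
  ∫ p : ℝ × ℝ, (if p.1 < p.2 then
      excess N k u p.1 p.2 ^ 3 * (cutoff R p.1 * cutoff R p.2) else 0)
    ∂((volume.restrict (Icc (-R) R)).prod (volume.restrict (Icc (-R) R)))

theorem hasDerivAt_doubledExcess (hA : ContDiff ℝ 2 A) (hU : IsViscousSolution A ε T U₀ U) {B : ℝ}
    (hB : ∀ t ∈ Ioo 0 T, ∀ x, |U t x| ≤ B) (hN : 0 ≤ N) (hk : 0 ≤ k) (R : ℝ) {t : ℝ}
    (ht : t ∈ Ioo 0 T) :
    HasDerivAt (fun s => doubledExcess N k R (U s))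
      (∫ p : ℝ × ℝ, (if p.1 < p.2 then 3 * excess N k (U t) p.1 p.2 ^ 2 *
        ((ε * deriv (deriv (U t)) p.2 - deriv A (U t p.2) * deriv (U t) p.2) -
          (ε * deriv (deriv (U t)) p.1 - deriv A (U t p.1) * deriv (U t) p.1)) *
        (cutoff R p.1 * cutoff R p.2) else 0)
        ∂((volume.restrict (Icc (-R) R)).prod (volume.restrict (Icc (-R) R)))) t := by
  have cr := continuous_cutoff R
  obtain ⟨a, ha0, hat⟩ := exists_between ht.1
  obtain ⟨b, htb, hbT⟩ := exists_between ht.2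
  have hsub : Icc a b ⊆ Ioo 0 T := fun s hs => ⟨ha0.trans_le hs.1, hs.2.trans_lt hbT⟩
  have hKsub : Icc a b ×ˢ Icc (-R) R ⊆ Ioo 0 T ×ˢ (univ : Set ℝ) :=
    fun p hp => ⟨hsub hp.1, mem_univ _⟩
  obtain ⟨D1, hD1⟩ := (isCompact_Icc.prod isCompact_Icc).exists_bound_of_continuousOn
    (hU.continuousOn_deriv_time.mono hKsub)
  simp_rw [← hU.deriv_time_eq hA ht]
  have hcont : ∀ s ∈ Ioo 0 T, Continuous fun p : ℝ × ℝ =>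
      excess N k (U s) p.1 p.2 ^ 3 * (cutoff R p.1 * cutoff R p.2) := fun s hs => by
    have := continuous_excess (N := N) (k := k) (hU.continuous_space hs)
    fun_prop
  refine (hasDerivAt_integral_of_dominated_loc_of_deriv_le
    (F := fun s (p : ℝ × ℝ) => if p.1 < p.2 then
      excess N k (U s) p.1 p.2 ^ 3 * (cutoff R p.1 * cutoff R p.2) else 0)
    (F' := fun s (p : ℝ × ℝ) => if p.1 < p.2 then 3 * excess N k (U s) p.1 p.2 ^ 2 *
        (deriv (fun s => U s p.2) s - deriv (fun s => U s p.1) s) *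
        (cutoff R p.1 * cutoff R p.2) else 0)
    (bound := fun _ => 3 * (2 * B) ^ 2 * (D1 + D1) * 1)
    (Ioo_mem_nhds hat htb) ?_ ?_ ?_ ?_ ?_ ?_).2
  · filter_upwards [Ioo_mem_nhds hat htb] with s hs
    exact (integrable_ite_lt (hcont s (hsub ⟨hs.1.le, hs.2.le⟩)) R).aestronglyMeasurable
  · exact integrable_ite_lt (hcont t ht) R
  · have h1 := continuous_excess (N := N) (k := k) (hU.continuous_space ht)
    have h2 := hU.continuous_deriv_time ht
    have h3 : Continuous fun p : ℝ × ℝ => deriv (fun s => U s p.2) t := h2.comp continuous_snd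
    have h4 : Continuous fun p : ℝ × ℝ => deriv (fun s => U s p.1) t := h2.comp continuous_fst
    exact (integrable_ite_lt (f := fun p : ℝ × ℝ => 3 * excess N k (U t) p.1 p.2 ^ 2 *
        (deriv (fun s => U s p.2) t - deriv (fun s => U s p.1) t) *
        (cutoff R p.1 * cutoff R p.2)) (by fun_prop) R).aestronglyMeasurable
  · rw [Measure.prod_restrict]
    filter_upwards [ae_restrict_mem (measurableSet_Icc.prod measurableSet_Icc)] with p hp s hs
    have hs' : s ∈ Icc a b := ⟨hs.1.le, hs.2.le⟩
    have e1 : |deriv (fun s => U s p.1) s| ≤ D1 := hD1 (s, p.1) ⟨hs', hp.1⟩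
    have e2 : |deriv (fun s => U s p.2) s| ≤ D1 := hD1 (s, p.2) ⟨hs', hp.2⟩
    have hD10 : 0 ≤ D1 := (abs_nonneg _).trans e1
    split_ifs with hlt
    · have hw0 := excess_nonneg (N := N) (k := k) (u := U s) p.1 p.2
      have hwle := excess_le hN hk (hB s (hsub hs')) hlt
      have hrr : |cutoff R p.1 * cutoff R p.2| ≤ 1 := by
        rw [abs_of_nonneg (mul_nonneg (cutoff_nonneg _ _) (cutoff_nonneg _ _))]
        exact mul_le_one₀ (cutoff_le_one _ _) (cutoff_nonneg _ _) (cutoff_le_one _ _)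
      rw [norm_mul, norm_mul, Real.norm_eq_abs, Real.norm_eq_abs, Real.norm_eq_abs,
        abs_of_nonneg (by positivity : 0 ≤ 3 * excess N k (U s) p.1 p.2 ^ 2)]
      gcongr
      exact (abs_sub _ _).trans (add_le_add e2 e1)
    · rw [norm_zero]; positivity
  · exact integrable_const _
  · refine Eventually.of_forall fun p s hs => ?_
    have hs' := hsub ⟨hs.1.le, hs.2.le⟩
    by_cases hlt : p.1 < p.2
    · simp only [if_pos hlt]
      have e1 := ((hU.differentiableAt_time s hs' p.2).hasDerivAt.sub
        (hU.differentiableAt_time s hs' p.1).hasDerivAt).sub_const (N * (p.2 - p.1)) |>.sub_const k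
      have e2 := (hasDerivAt_max_zero_pow 1
        (U s p.2 - U s p.1 - N * (p.2 - p.1) - k)).comp s e1
      refine (e2.mul_const (cutoff R p.1 * cutoff R p.2)).congr_deriv ?_
      simp only [excess]
      norm_num
    · simp only [if_neg hlt]
      exact hasDerivAt_const _ _

/-- As the initial value satisfies the modulus almost everywhere, the excess of `U t` at `(x, y)` is
at most the sum of `|U t - U₀|` at `x` and at `y`. Bounding two factors of the cube by `2 B` leaves
a quantity controlled by the `L¹` distance on the window, which tends to zero. -/
theorem frequently_doubledExcess_le (hU : IsViscousSolution A ε T U₀ U) (hT : 0 < T)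
    (hm : AEStronglyMeasurable U₀ volume) {B : ℝ}
    (hB : ∀ t ∈ Ioo 0 T, ∀ x, |U t x| ≤ B) (hB0 : ∀ᵐ x, |U₀ x| ≤ B) (hN : 0 ≤ N) (hk : 0 ≤ k)
    (hinit : ∀ᵐ p : ℝ × ℝ ∂(volume.prod volume), p.1 < p.2 →
      U₀ p.2 - U₀ p.1 ≤ N * (p.2 - p.1) + k) {R : ℝ} (hR : 0 < R) {δ : ℝ} (hδ : 0 < δ) :
    ∃ᶠ s in 𝓝[>] (0 : ℝ), doubledExcess N k R (U s) ≤ 0 + δ := by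
  set μ := volume.restrict (Icc (-R) R)
  have hlim : Tendsto (fun t => (2 * B) ^ 2 * (2 * (2 * R) * ∫ x in Icc (-R) R, |U t x - U₀ x|))
      (𝓝[>] 0) (𝓝 0) := by
    have := ((hU.initial R hR).const_mul (2 * (2 * R))).const_mul ((2 * B) ^ 2)
    rwa [mul_zero, mul_zero] at this
  refine Eventually.frequently ?_
  filter_upwards [hlim.eventually_lt_const hδ, Ioo_mem_nhdsGT hT] with t ht1 ht
  rw [zero_add]
  refine le_trans ?_ ht1.le
  have hc := hU.continuous_space ht
  have hfi : Integrable (fun x => |U t x - U₀ x|) μ := by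
    have hfin : volume (Icc (-R) R) < ⊤ := by simp
    refine (Measure.integrableOn_of_bounded (s := Icc (-R) R) (M := B + B) hfin.ne
      (hc.aestronglyMeasurable.sub hm) ?_).abs
    filter_upwards [ae_restrict_of_ae hB0] with x hx
    exact (norm_sub_le _ _).trans (add_le_add (hB t ht x) hx)
  have i1 : Integrable (fun p : ℝ × ℝ => |U t p.1 - U₀ p.1|) (μ.prod μ) := hfi.comp_fst μ
  have i2 : Integrable (fun p : ℝ × ℝ => |U t p.2 - U₀ p.2|) (μ.prod μ) := hfi.comp_snd μ
  have cr := continuous_cutoff R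
  have cw := continuous_excess (N := N) (k := k) hc
  have i0 := integrable_ite_lt (f := fun p : ℝ × ℝ =>
      excess N k (U t) p.1 p.2 ^ 3 * (cutoff R p.1 * cutoff R p.2)) (by fun_prop) R
  have hle : (fun p : ℝ × ℝ => if p.1 < p.2 then
      excess N k (U t) p.1 p.2 ^ 3 * (cutoff R p.1 * cutoff R p.2) else 0) ≤ᵐ[μ.prod μ]
      fun p => (2 * B) ^ 2 * (|U t p.2 - U₀ p.2| + |U t p.1 - U₀ p.1|) := by
    have hae := hinit
    replace hae : ∀ᵐ p : ℝ × ℝ ∂(μ.prod μ), p.1 < p.2 →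
      U₀ p.2 - U₀ p.1 ≤ N * (p.2 - p.1) + k := by
      rw [Measure.prod_restrict]
      exact ae_restrict_of_ae hae
    filter_upwards [hae] with p hp
    split_ifs with hlt
    · have hw0 := excess_nonneg (N := N) (k := k) (u := U t) p.1 p.2
      have hwle := excess_le hN hk (hB t ht) hlt
      have hp' := hp hlt
      have hw1 : excess N k (U t) p.1 p.2 ≤ |U t p.2 - U₀ p.2| + |U t p.1 - U₀ p.1| := by
        refine max_le ?_ (by positivity)
        have := le_abs_self (U t p.2 - U₀ p.2)
        have := neg_abs_le (U t p.1 - U₀ p.1)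
        linarith
      have hrr : cutoff R p.1 * cutoff R p.2 ≤ 1 :=
        mul_le_one₀ (cutoff_le_one _ _) (cutoff_nonneg _ _) (cutoff_le_one _ _)
      calc excess N k (U t) p.1 p.2 ^ 3 * (cutoff R p.1 * cutoff R p.2)
          ≤ excess N k (U t) p.1 p.2 ^ 3 * 1 := by gcongr
        _ = excess N k (U t) p.1 p.2 ^ 2 * excess N k (U t) p.1 p.2 := by ring
        _ ≤ _ := by gcongr
    · positivity
  refine (integral_mono_ae i0 ((i2.add i1).const_mul _) hle).trans (le_of_eq ?_)
  simp only [Pi.add_apply]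
  rw [integral_const_mul, integral_add i2 i1, integral_fun_fst (μ := μ) (ν := μ)
    (fun x => |U t x - U₀ x|), integral_fun_snd (μ := μ) (ν := μ) (fun x => |U t x - U₀ x|)]
  have hμ : μ.real univ = 2 * R := by
    simp only [μ, MeasurableSet.univ, measureReal_restrict_apply, univ_inter, Real.volume_real_Icc]
    rw [max_eq_left (by linarith)]
    ring
  rw [hμ, smul_eq_mul]
  ring

theorem doubledExcess_le (hA : ContDiff ℝ 2 A) (hmono : Monotone (deriv A))
    (hU : IsViscousSolution A ε T U₀ U) (hε : 0 < ε)
    (hm : AEStronglyMeasurable U₀ volume) {B D L : ℝ}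
    (hB : ∀ t ∈ Ioo 0 T, ∀ x, |U t x| ≤ B) (hB0 : ∀ᵐ x, |U₀ x| ≤ B) (hN : 0 ≤ N) (hk : 0 ≤ k)
    (hinit : ∀ᵐ p : ℝ × ℝ ∂(volume.prod volume), p.1 < p.2 →
      U₀ p.2 - U₀ p.1 ≤ N * (p.2 - p.1) + k)
    (hD : ∀ u ∈ Icc (-B) B, |deriv A u| ≤ D) (hL0 : 0 ≤ L)
    (hL : ∀ u ∈ Icc (-B) B, ∀ v ∈ Icc (-B) B, |deriv A u - deriv A v| ≤ L * |u - v|)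
    {n : ℝ} (hn : 1 ≤ n) {t : ℝ} (ht : t ∈ Ioo 0 T) :
    doubledExcess N k (n ^ 2) (U t) ≤
      Real.exp ((112 * (ε + D) + 3 * N * L) * t) * (448 * (ε + D) * (2 * B) ^ 3 / n * t) := by
  have hn0 : 0 < n := by linarith
  have hB' : 0 ≤ B := (abs_nonneg _).trans (hB t ht 0)
  have hD0 : 0 ≤ D := (abs_nonneg _).trans (hD _ (abs_le.1 (hB t ht 0)))
  have hgr := le_exp_mul_of_deriv_le (f := fun s => doubledExcess N k (n ^ 2) (U s)) (T := T)
    (C := 112 * (ε + D) + 3 * N * L) (e := 448 * (ε + D) * (2 * B) ^ 3 / n) (f₀ := 0) (t := t)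
    (by positivity) (by positivity)
    (fun s hs => hasDerivAt_doubledExcess hA hU hB hN hk (n ^ 2) hs) ?_
    (fun δ hδ => frequently_doubledExcess_le hU (ht.1.trans ht.2) hm hB hB0 hN hk hinit
      (by positivity) hδ) ht
  · rwa [max_self, zero_add] at hgr
  · intro s hs
    -- The gain `1/n` in front of the cutoff is given up: the initial excess is zero, so the
    -- Gronwall rate need only be bounded. The remainder `n⁻⁵` over the square of side `2 n²` leaves
    -- the source term of order `1/n`.
    have hδ : ∀ y, 56 * (cutoff (n ^ 2) y / n + 1 / n ^ 5) ≤
        56 * (cutoff (n ^ 2) y + 1 / n ^ 5) := fun y => by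
      gcongr
      exact div_le_self (cutoff_nonneg _ _) hn
    refine (integral_doubling_rate_le hA hmono hε.le hN hk hD hL0 hL (hB s hs)
      (δ := 1 / n ^ 5) (by positivity) (cutoff_nonneg (n ^ 2)) (cutoff_le_one (n ^ 2))
      (fun y => (abs_cutoffD_sq_le hn y).trans (hδ y))
      (fun y => (abs_cutoffDD_sq_le hn y).trans (hδ y))
      (hU.hasDerivAt_space hs) (hU.hasDerivAt_deriv_space hs) (hU.continuous_deriv_deriv_space hs)
      (hasDerivAt_cutoff (n ^ 2)) (hasDerivAt_cutoffD (n ^ 2)) (continuous_cutoffDD (n ^ 2))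
      (by positivity) (fun y hy => cutoff_eq_zero (by positivity) hy)
      (fun y hy => cutoffD_eq_zero (by positivity) hy)).trans (le_of_eq ?_)
    unfold doubledExcess
    congr 1
    field_simp
    ring

theorem doubledExcess_mono {R R' : ℝ} (hR : 0 < R) (h : R ≤ R') {u : ℝ → ℝ} (hu : Continuous u) :
    doubledExcess N k R u ≤ doubledExcess N k R' u := by
  have cr := continuous_cutoff R
  have cr' := continuous_cutoff R'
  have cw := continuous_excess (N := N) (k := k) hu
  have i1 := integrable_ite_lt (f := fun p : ℝ × ℝ =>
      excess N k u p.1 p.2 ^ 3 * (cutoff R p.1 * cutoff R p.2)) (by fun_prop) R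
  have i2 := integrable_ite_lt (f := fun p : ℝ × ℝ =>
      excess N k u p.1 p.2 ^ 3 * (cutoff R' p.1 * cutoff R' p.2)) (by fun_prop) R'
  unfold doubledExcess
  simp only [Measure.prod_restrict] at *
  have hsub : Icc (-R) R ×ˢ Icc (-R) R ⊆ Icc (-R') R' ×ˢ Icc (-R') R' :=
    prod_mono (Icc_subset_Icc (by linarith) h) (Icc_subset_Icc (by linarith) h)
  refine (integral_mono i1 (IntegrableOn.mono_set i2 hsub) fun p => ?_).trans
    (setIntegral_mono_set i2 (Eventually.of_forall fun p => ?_) hsub.eventuallyLE)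
  · have := excess_nonneg (N := N) (k := k) (u := u) p.1 p.2
    have := cutoff_nonneg R p.1
    have := cutoff_nonneg R p.2
    have := cutoff_nonneg R' p.1
    have h1 := cutoff_mono hR h p.1
    have h2 := cutoff_mono hR h p.2
    dsimp only
    split_ifs
    · gcongr
    · exact le_rfl
  · have := excess_nonneg (N := N) (k := k) (u := u) p.1 p.2
    have := cutoff_nonneg R' p.1
    have := cutoff_nonneg R' p.2
    dsimp only [Pi.zero_apply]
    split_ifs
    · positivity
    · exact le_rfl

/-- A point with positive excess would, by continuity, have an open neighbourhood on which the
nonnegative integrand is positive, contradicting a vanishing integral. -/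
theorem excess_eq_zero_of_doubledExcess_nonpos {R : ℝ} (hR : 0 < R) {u : ℝ → ℝ}
    (hu : Continuous u) (h : doubledExcess N k R u ≤ 0) {x y : ℝ} (hxy : x < y) (hx : |x| < R)
    (hy : |y| < R) : excess N k u x y = 0 := by
  by_contra hne
  have cr := continuous_cutoff R
  have cw := continuous_excess (N := N) (k := k) hu
  have i1 := integrable_ite_lt (f := fun p : ℝ × ℝ =>
      excess N k u p.1 p.2 ^ 3 * (cutoff R p.1 * cutoff R p.2)) (by fun_prop) R
  unfold doubledExcess at h
  rw [Measure.prod_restrict] at h i1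
  have hpos : 0 ≤ fun p : ℝ × ℝ => (if p.1 < p.2 then
      excess N k u p.1 p.2 ^ 3 * (cutoff R p.1 * cutoff R p.2) else 0) := fun p => by
    have := excess_nonneg (N := N) (k := k) (u := u) p.1 p.2
    have := cutoff_nonneg R p.1
    have := cutoff_nonneg R p.2
    dsimp only [Pi.zero_apply]
    split_ifs
    · positivity
    · exact le_rfl
  have h0 := (integral_eq_zero_iff_of_nonneg hpos i1).1 (le_antisymm h (integral_nonneg hpos))
  set O : Set (ℝ × ℝ) := {p | p.1 < p.2 ∧ 0 < excess N k u p.1 p.2 ∧ |p.1| < R ∧ |p.2| < R}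
  have hO : IsOpen O := by
    have o1 : IsOpen {p : ℝ × ℝ | |p.1| < R} := isOpen_lt (by fun_prop) continuous_const
    have o2 : IsOpen {p : ℝ × ℝ | |p.2| < R} := isOpen_lt (by fun_prop) continuous_const
    exact (isOpen_lt continuous_fst continuous_snd).inter
      ((isOpen_lt continuous_const cw).inter (o1.inter o2))
  have hmem : (x, y) ∈ O := ⟨hxy, lt_of_le_of_ne (excess_nonneg x y) (Ne.symm hne), hx, hy⟩
  have hmeas : 0 < (volume.prod volume : Measure (ℝ × ℝ)) O := hO.measure_pos _ ⟨_, hmem⟩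
  have hcut : ∀ z : ℝ, |z| < R → 0 < cutoff R z := fun z hz => by
    have : 0 < 1 - z ^ 2 / R ^ 2 := by
      rw [sub_pos, div_lt_one (by positivity), ← sq_abs z]
      gcongr
    unfold cutoff
    rw [max_eq_left this.le]
    positivity
  have hsub : O ⊆ Icc (-R) R ×ˢ Icc (-R) R := fun p hp =>
    ⟨abs_le.1 hp.2.2.1.le, abs_le.1 hp.2.2.2.le⟩
  have h1 := ae_restrict_of_ae_restrict_of_subset hsub h0
  have h2 : ∀ᵐ p ∂((volume.prod volume : Measure (ℝ × ℝ)).restrict O), False := by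
    filter_upwards [h1, ae_restrict_mem hO.measurableSet] with p hp hpO
    simp only [Pi.zero_apply, if_pos hpO.1] at hp
    have := hcut _ hpO.2.2.1
    have := hcut _ hpO.2.2.2
    have := hpO.2.1
    have : 0 < excess N k u p.1 p.2 ^ 3 * (cutoff R p.1 * cutoff R p.2) := by positivity
    linarith
  simp only [eventually_false_iff_eq_bot, ae_eq_bot, Measure.restrict_eq_zero] at h2
  exact hmeas.ne' h2

/-- An affine one-sided modulus of continuity is propagated by the equation. -/
theorem IsViscousSolution.sub_le_of_initial (hA : ContDiff ℝ 2 A) (hmono : Monotone (deriv A))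
    (hU : IsViscousSolution A ε T U₀ U) (hε : 0 < ε)
    (hm : AEStronglyMeasurable U₀ volume) {B : ℝ}
    (hB : ∀ t ∈ Ioo 0 T, ∀ x, |U t x| ≤ B) (hB0 : ∀ᵐ x, |U₀ x| ≤ B) (hN : 0 ≤ N) (hk : 0 ≤ k)
    (hinit : ∀ᵐ p : ℝ × ℝ ∂(volume.prod volume), p.1 < p.2 →
      U₀ p.2 - U₀ p.1 ≤ N * (p.2 - p.1) + k)
    {t : ℝ} (ht : t ∈ Ioo 0 T) {x y : ℝ} (hxy : x < y) :
    U t y - U t x ≤ N * (y - x) + k := by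
  have cA : Continuous (deriv A) := hA.continuous_deriv (by norm_num)
  have hA2 : ContDiff ℝ (1 + 1) A := hA
  have hA1 : ContDiff ℝ 1 (deriv A) := (contDiff_succ_iff_deriv.1 hA2).2.2
  obtain ⟨D, hD⟩ := (isCompact_Icc (a := -B) (b := B)).exists_bound_of_continuousOn cA.continuousOn
  obtain ⟨L, hL⟩ := (isCompact_Icc (a := -B) (b := B)).exists_bound_of_continuousOn
    (hA1.continuous_deriv le_rfl).continuousOn
  have hL0 : 0 ≤ L := (norm_nonneg _).trans (hL _ (_root_.abs_le.1 (hB t ht 0)))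
  have hL' : ∀ u ∈ Icc (-B) B, ∀ v ∈ Icc (-B) B, |deriv A u - deriv A v| ≤ L * |u - v| :=
    fun u hu v hv => abs_sub_le_of_hasDerivAt
      (fun w => (hA1.differentiable (by norm_num) w).hasDerivAt) (convex_Icc _ _) hL hu hv
  have hc := hU.continuous_space ht
  set m := |x| + |y| + 1
  have hm1 : 1 ≤ m := by have := abs_nonneg x; have := abs_nonneg y; simp only [m]; linarith
  have hmm : m ≤ m ^ 2 := by nlinarith
  -- The window `m²` contains both points and stays fixed, while the estimate is taken on larger
  -- windows `n²` and becomes zero as `n → ∞`.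
  have hzero : doubledExcess N k (m ^ 2) (U t) ≤ 0 := by
    have hlim : Tendsto (fun n : ℝ => Real.exp ((112 * (ε + D) + 3 * N * L) * t) *
        (448 * (ε + D) * (2 * B) ^ 3 / n * t)) atTop (𝓝 0) := by
      have h1 : Tendsto (fun n : ℝ => 448 * (ε + D) * (2 * B) ^ 3 / n) atTop (𝓝 0) :=
        tendsto_const_nhds.div_atTop tendsto_id
      have h2 := (h1.mul_const t).const_mul (Real.exp ((112 * (ε + D) + 3 * N * L) * t))
      rwa [zero_mul, mul_zero] at h2
    refine ge_of_tendsto hlim ?_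
    filter_upwards [eventually_ge_atTop m] with n hn
    refine (doubledExcess_mono (by positivity) ?_ hc).trans
      (doubledExcess_le hA hmono hU hε hm hB hB0 hN hk hinit hD hL0 hL' (hm1.trans hn) ht)
    gcongr
  have h0 := excess_eq_zero_of_doubledExcess_nonpos (by positivity) hc hzero hxy
    (by have := abs_nonneg y; simp only [m] at hmm ⊢; linarith)
    (by have := abs_nonneg x; simp only [m] at hmm ⊢; linarith)
  have := le_max_left (U t y - U t x - N * (y - x) - k) 0
  rw [show max (U t y - U t x - N * (y - x) - k) 0 = 0 from h0] at this
  linarith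

end OneSided

/-! ### The relative flux and the admissible shock speeds -/

section RelativeFlux

variable {A η : ℝ → ℝ}

/-- The flux `∫_C^u (η'(w) - η'(C)) A'(w) dw` of the relative entropy. -/
noncomputable def relFlux (A η : ℝ → ℝ) (u C : ℝ) : ℝ :=
  ∫ w in C..u, (deriv η w - deriv η C) * deriv A w

theorem ContDiff.hasDerivAt_deriv_of_two (hη : ContDiff ℝ 2 η) (u : ℝ) :
    HasDerivAt (deriv η) (deriv (deriv η) u) u := by
  have h : ContDiff ℝ (1 + 1) η := hη
  exact ((contDiff_succ_iff_deriv.1 h).2.2.differentiable (by norm_num) u).hasDerivAt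

theorem ContDiff.continuous_deriv_deriv (hη : ContDiff ℝ 2 η) :
    Continuous (deriv (deriv η)) := by
  have h : ContDiff ℝ (1 + 1) η := hη
  exact (contDiff_succ_iff_deriv.1 h).2.2.continuous_deriv le_rfl

theorem ContDiff.hasDerivAt_of_two (hη : ContDiff ℝ 2 η) (u : ℝ) : HasDerivAt η (deriv η u) u :=
  (hη.differentiable (by norm_num) u).hasDerivAt

theorem hasDerivAt_relEntropy_left (hη : ContDiff ℝ 2 η) (C u : ℝ) :
    HasDerivAt (fun u => relEntropy η u C) (deriv η u - deriv η C) u :=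
  (((hη.hasDerivAt_of_two u).sub_const (η C)).sub
    (((hasDerivAt_id u).sub_const C).const_mul (deriv η C))).congr_deriv (by simp)

theorem hasDerivAt_relEntropy_right (hη : ContDiff ℝ 2 η) (u C : ℝ) :
    HasDerivAt (fun C => relEntropy η u C) (-(deriv (deriv η) C * (u - C))) C :=
  (((hη.hasDerivAt_of_two C).const_sub (η u)).sub
    ((hη.hasDerivAt_deriv_of_two C).mul ((hasDerivAt_id C).const_sub u))).congr_deriv (by
      simp only [id]; ring)

theorem hasDerivAt_relFlux_left (hA : ContDiff ℝ 2 A) (hη : ContDiff ℝ 2 η) (C u : ℝ) :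
    HasDerivAt (fun u => relFlux A η u C) ((deriv η u - deriv η C) * deriv A u) u :=
  hasDerivAt_integral_mul_deriv hA (h1 := fun w => deriv η w - deriv η C)
    ((hη.continuous_deriv (by norm_num)).sub continuous_const) C u

theorem hasDerivAt_relFlux_right (hA : ContDiff ℝ 2 A) (hη : ContDiff ℝ 2 η) (u C : ℝ) :
    HasDerivAt (fun C => relFlux A η u C) (-(deriv (deriv η) C * (A u - A C))) C := by
  have cη := hη.continuous_deriv (by norm_num)
  have cA := hA.continuous_deriv (by norm_num)
  set G : ℝ → ℝ := fun v => ∫ w in (0 : ℝ)..v, deriv η w * deriv A w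
  have hG := hasDerivAt_integral_mul_deriv hA cη 0
  have hform : ∀ C, relFlux A η u C = G u - G C - deriv η C * (A u - A C) := by
    intro C
    have i1 : ∀ a b, IntervalIntegrable (fun w => deriv η w * deriv A w) volume a b := fun a b =>
      (cη.mul cA).intervalIntegrable a b
    have i2 : IntervalIntegrable (fun w => deriv η C * deriv A w) volume C u :=
      (continuous_const.mul cA).intervalIntegrable C u
    unfold relFlux
    simp_rw [sub_mul]
    rw [intervalIntegral.integral_sub (i1 _ _) i2, intervalIntegral.integral_const_mul,
      intervalIntegral.integral_eq_sub_of_hasDerivAt (fun x _ => hA.hasDerivAt_of_two x)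
        (cA.intervalIntegrable _ _), intervalIntegral.integral_interval_sub_left (i1 _ _) (i1 _ _)]
  rw [funext hform]
  refine (((hG C).const_sub (G u)).sub ((hη.hasDerivAt_deriv_of_two C).mul
    ((hA.hasDerivAt_of_two C).const_sub (A u)))).congr_deriv ?_
  ring

@[simp] theorem relEntropy_self (C : ℝ) : relEntropy η C C = 0 := by simp [relEntropy]

@[simp] theorem relFlux_self (C : ℝ) : relFlux A η C C = 0 := by simp [relFlux]

theorem strictMono_deriv_of_pos (hηc : ∀ x, 0 < deriv (deriv η) x) : StrictMono (deriv η) :=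
  strictMono_of_deriv_pos hηc

theorem relEntropy_lt_left (hη : ContDiff ℝ 2 η) (hηc : ∀ x, 0 < deriv (deriv η) x) {C p q : ℝ}
    (hpq : p < q) (hC : C ≤ p) : relEntropy η p C < relEntropy η q C := by
  obtain ⟨ξ, hξ, he⟩ := exists_hasDerivAt_eq_slope (fun u => relEntropy η u C)
    (fun u => deriv η u - deriv η C) hpq
    (fun w _ => (hasDerivAt_relEntropy_left hη C w).continuousAt.continuousWithinAt)
    (fun w _ => hasDerivAt_relEntropy_left hη C w)
  have h1 := strictMono_deriv_of_pos hηc (hC.trans_lt hξ.1)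
  rw [eq_div_iff (by linarith)] at he
  have := mul_pos (sub_pos.2 h1) (sub_pos.2 hpq)
  linarith

theorem relEntropy_gt_left (hη : ContDiff ℝ 2 η) (hηc : ∀ x, 0 < deriv (deriv η) x) {C p q : ℝ}
    (hpq : p < q) (hC : q ≤ C) : relEntropy η q C < relEntropy η p C := by
  obtain ⟨ξ, hξ, he⟩ := exists_hasDerivAt_eq_slope (fun u => relEntropy η u C)
    (fun u => deriv η u - deriv η C) hpq
    (fun w _ => (hasDerivAt_relEntropy_left hη C w).continuousAt.continuousWithinAt)
    (fun w _ => hasDerivAt_relEntropy_left hη C w)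
  have h1 := strictMono_deriv_of_pos hηc (hξ.2.trans_le hC)
  rw [eq_div_iff (by linarith)] at he
  have := mul_pos (sub_pos.2 h1) (sub_pos.2 hpq)
  linarith

theorem relEntropy_lt_right (hη : ContDiff ℝ 2 η) (hηc : ∀ x, 0 < deriv (deriv η) x) {u p q : ℝ}
    (hpq : p < q) (hu : u ≤ p) : relEntropy η u p < relEntropy η u q := by
  obtain ⟨ξ, hξ, he⟩ := exists_hasDerivAt_eq_slope (fun C => relEntropy η u C)
    (fun C => -(deriv (deriv η) C * (u - C))) hpq
    (fun w _ => (hasDerivAt_relEntropy_right hη u w).continuousAt.continuousWithinAt)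
    (fun w _ => hasDerivAt_relEntropy_right hη u w)
  have h1 : 0 < deriv (deriv η) ξ * (ξ - u) := mul_pos (hηc ξ) (by linarith [hξ.1])
  rw [eq_div_iff (by linarith)] at he
  have := mul_pos h1 (sub_pos.2 hpq)
  linarith

theorem relEntropy_gt_right (hη : ContDiff ℝ 2 η) (hηc : ∀ x, 0 < deriv (deriv η) x) {u p q : ℝ}
    (hpq : p < q) (hu : q ≤ u) : relEntropy η u q < relEntropy η u p := by
  obtain ⟨ξ, hξ, he⟩ := exists_hasDerivAt_eq_slope (fun C => relEntropy η u C)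
    (fun C => -(deriv (deriv η) C * (u - C))) hpq
    (fun w _ => (hasDerivAt_relEntropy_right hη u w).continuousAt.continuousWithinAt)
    (fun w _ => hasDerivAt_relEntropy_right hη u w)
  have h1 : 0 < deriv (deriv η) ξ * (u - ξ) := mul_pos (hηc ξ) (by linarith [hξ.2])
  rw [eq_div_iff (by linarith)] at he
  have := mul_pos h1 (sub_pos.2 hpq)
  linarith

theorem relEntropy_pos (hη : ContDiff ℝ 2 η) (hηc : ∀ x, 0 < deriv (deriv η) x) {u C : ℝ}
    (h : u ≠ C) : 0 < relEntropy η u C := by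
  rcases h.lt_or_gt with h | h
  · simpa using relEntropy_gt_left hη hηc h le_rfl
  · simpa using relEntropy_lt_left hη hηc h le_rfl

theorem relEntropy_nonneg (hη : ContDiff ℝ 2 η) (hηc : ∀ x, 0 < deriv (deriv η) x) (u C : ℝ) :
    0 ≤ relEntropy η u C := by
  rcases eq_or_ne u C with rfl | h
  · simp
  · exact (relEntropy_pos hη hηc h).le

/-- Cauchy's mean value theorem: in `u`, flux and entropy have derivatives with ratio `A'`. The
common factor `η'(ξ) - η'(C)` can be cancelled because `C` is not between `p` and `q`. -/
theorem exists_relFlux_sub_left (hA : ContDiff ℝ 2 A) (hη : ContDiff ℝ 2 η)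
    (hηc : ∀ x, 0 < deriv (deriv η) x) {C p q : ℝ} (hpq : p < q) (hC : C ∉ Ioo p q) :
    ∃ ξ ∈ Ioo p q, relFlux A η q C - relFlux A η p C =
      deriv A ξ * (relEntropy η q C - relEntropy η p C) := by
  obtain ⟨ξ, hξ, he⟩ := exists_ratio_hasDerivAt_eq_ratio_slope (fun u => relEntropy η u C)
    (fun u => deriv η u - deriv η C) hpq
    (fun w _ => (hasDerivAt_relEntropy_left hη C w).continuousAt.continuousWithinAt)
    (fun w _ => hasDerivAt_relEntropy_left hη C w) (fun u => relFlux A η u C)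
    (fun u => (deriv η u - deriv η C) * deriv A u)
    (fun w _ => (hasDerivAt_relFlux_left hA hη C w).continuousAt.continuousWithinAt)
    (fun w _ => hasDerivAt_relFlux_left hA hη C w)
  refine ⟨ξ, hξ, ?_⟩
  have hne : deriv η ξ - deriv η C ≠ 0 := sub_ne_zero.2 fun h =>
    hC ((strictMono_deriv_of_pos hηc).injective h ▸ hξ)
  apply mul_right_cancel₀ hne
  linear_combination he

/-- The same mean value theorem in the reference state: differentiating in `C`, the factor `η''(C)`
cancels and the ratio is a secant slope of `A` through `u`. -/
theorem exists_relFlux_sub_right (hA : ContDiff ℝ 2 A) (hη : ContDiff ℝ 2 η)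
    (hηc : ∀ x, 0 < deriv (deriv η) x) {u p q : ℝ} (hpq : p < q) (hu : u ∉ Ioo p q) :
    ∃ ξ ∈ Ioo p q, relFlux A η u q - relFlux A η u p =
      (A ξ - A u) / (ξ - u) * (relEntropy η u q - relEntropy η u p) := by
  obtain ⟨ξ, hξ, he⟩ := exists_ratio_hasDerivAt_eq_ratio_slope (fun C => relEntropy η u C)
    (fun C => -(deriv (deriv η) C * (u - C))) hpq
    (fun w _ => (hasDerivAt_relEntropy_right hη u w).continuousAt.continuousWithinAt)
    (fun w _ => hasDerivAt_relEntropy_right hη u w) (fun C => relFlux A η u C)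
    (fun C => -(deriv (deriv η) C * (A u - A C)))
    (fun w _ => (hasDerivAt_relFlux_right hA hη u w).continuousAt.continuousWithinAt)
    (fun w _ => hasDerivAt_relFlux_right hA hη u w)
  refine ⟨ξ, hξ, ?_⟩
  have hne : ξ - u ≠ 0 := sub_ne_zero.2 fun h => hu (h ▸ hξ)
  have hne2 := (hηc ξ).ne'
  have : (relFlux A η u q - relFlux A η u p) * (ξ - u) =
      (A ξ - A u) * (relEntropy η u q - relEntropy η u p) := by
    apply mul_left_cancel₀ hne2
    linear_combination he
  field_simp
  linear_combination this

/-- The critical speed `relFlux / relEntropy`, extended by continuity to `u = C`. -/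
noncomputable def critSpeed (A η : ℝ → ℝ) (u C : ℝ) : ℝ :=
  if u = C then deriv A C else relFlux A η u C / relEntropy η u C

theorem relFlux_eq (hη : ContDiff ℝ 2 η) (hηc : ∀ x, 0 < deriv (deriv η) x) (u C : ℝ) :
    relFlux A η u C = critSpeed A η u C * relEntropy η u C := by
  unfold critSpeed
  split_ifs with h
  · subst h; simp
  · rw [div_mul_cancel₀ _ (relEntropy_pos hη hηc h).ne']

theorem exists_critSpeed_eq_of_lt (hA : ContDiff ℝ 2 A) (hη : ContDiff ℝ 2 η)
    (hηc : ∀ x, 0 < deriv (deriv η) x) {u C : ℝ} (h : u < C) :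
    ∃ ξ ∈ Ioo u C, critSpeed A η u C = deriv A ξ := by
  obtain ⟨ξ, hξ, he⟩ := exists_relFlux_sub_left hA hη hηc (C := C) h (by simp)
  refine ⟨ξ, hξ, ?_⟩
  rw [critSpeed, if_neg h.ne, div_eq_iff (relEntropy_pos hη hηc h.ne).ne']
  simp only [relFlux_self, relEntropy_self] at he
  linarith

theorem exists_critSpeed_eq_of_gt (hA : ContDiff ℝ 2 A) (hη : ContDiff ℝ 2 η)
    (hηc : ∀ x, 0 < deriv (deriv η) x) {u C : ℝ} (h : C < u) :
    ∃ ξ ∈ Ioo C u, critSpeed A η u C = deriv A ξ := by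
  obtain ⟨ξ, hξ, he⟩ := exists_relFlux_sub_left hA hη hηc (C := C) h (by simp)
  refine ⟨ξ, hξ, ?_⟩
  rw [critSpeed, if_neg h.ne', div_eq_iff (relEntropy_pos hη hηc h.ne').ne']
  simp only [relFlux_self, relEntropy_self] at he
  linarith

theorem continuous_critSpeed (hA : ContDiff ℝ 2 A) (hη : ContDiff ℝ 2 η)
    (hηc : ∀ x, 0 < deriv (deriv η) x) (C : ℝ) : Continuous fun u => critSpeed A η u C := by
  rw [continuous_iff_continuousAt]
  intro u
  rcases eq_or_ne u C with rfl | h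
  · have cA : ContinuousAt (deriv A) u := (hA.continuous_deriv (by norm_num)).continuousAt
    rw [Metric.continuousAt_iff] at cA ⊢
    intro e he
    obtain ⟨δ, hδ, hδ'⟩ := cA e he
    refine ⟨δ, hδ, fun v hv => ?_⟩
    have hself : critSpeed A η u u = deriv A u := by simp [critSpeed]
    rw [hself]
    rw [Real.dist_eq] at hv
    have hv' := abs_lt.1 hv
    rcases lt_trichotomy v u with hlt | rfl | hlt
    · obtain ⟨ξ, hξ, hE⟩ := exists_critSpeed_eq_of_lt hA hη hηc hlt
      rw [hE]
      refine hδ' ?_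
      rw [Real.dist_eq, abs_lt]
      constructor <;> linarith [hξ.1, hξ.2]
    · rw [hself]; simpa using he
    · obtain ⟨ξ, hξ, hE⟩ := exists_critSpeed_eq_of_gt hA hη hηc hlt
      rw [hE]
      refine hδ' ?_
      rw [Real.dist_eq, abs_lt]
      constructor <;> linarith [hξ.1, hξ.2]
  · have h1 : ContinuousAt (fun u => relFlux A η u C / relEntropy η u C) u :=
      (hasDerivAt_relFlux_left hA hη C u).continuousAt.div
        (hasDerivAt_relEntropy_left hη C u).continuousAt (relEntropy_pos hη hηc h).ne'
    refine h1.congr ?_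
    filter_upwards [isOpen_ne.mem_nhds h] with v hv
    rw [critSpeed, if_neg hv]

/-- For `C < p < q` the critical speed at `q` is a weighted mean of the one at `p` and some `A'(ξ)`
with `ξ > p`, while the one at `p` is `A'(ζ)` with `ζ < p`; monotonicity of `A'` compares them. The
side `q < C` is symmetric, and `A'(C)` separates values on opposite sides. -/
theorem monotone_critSpeed (hA : ContDiff ℝ 2 A) (hmono : StrictMono (deriv A))
    (hη : ContDiff ℝ 2 η)
    (hηc : ∀ x, 0 < deriv (deriv η) x) (C : ℝ) : Monotone fun u => critSpeed A η u C := by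
  have hself : critSpeed A η C C = deriv A C := by simp [critSpeed]
  have hle : ∀ u, u ≤ C → critSpeed A η u C ≤ deriv A C := fun u hu => by
    rcases hu.eq_or_lt with rfl | h
    · exact hself.le
    · obtain ⟨ξ, hξ, hE⟩ := exists_critSpeed_eq_of_lt hA hη hηc h
      rw [hE]; exact hmono.monotone hξ.2.le
  have hge : ∀ u, C ≤ u → deriv A C ≤ critSpeed A η u C := fun u hu => by
    rcases hu.eq_or_lt with rfl | h
    · exact hself.ge
    · obtain ⟨ξ, hξ, hE⟩ := exists_critSpeed_eq_of_gt hA hη hηc h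
      rw [hE]; exact hmono.monotone hξ.1.le
  refine monotone_iff_forall_lt.2 fun p q hpq => ?_
  rcases lt_or_ge C p with hC | hC
  · obtain ⟨ξ, hξ, hE⟩ := exists_relFlux_sub_left hA hη hηc hpq (C := C)
      (fun h => by linarith [h.1])
    obtain ⟨ζ, hζ, hF⟩ := exists_critSpeed_eq_of_gt hA hη hηc hC
    have e1 := relFlux_eq (A := A) hη hηc p C
    have e2 := relFlux_eq (A := A) hη hηc q C
    have hq := relEntropy_pos hη hηc (hC.trans hpq).ne'
    have hlt := relEntropy_lt_left hη hηc hpq hC.le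
    have hA' : critSpeed A η p C ≤ deriv A ξ := by
      rw [hF]; exact hmono.monotone (hζ.2.trans hξ.1).le
    have := mul_le_mul_of_nonneg_right hA' (sub_nonneg.2 hlt.le)
    refine le_of_mul_le_mul_right ?_ hq
    linarith
  · rcases lt_or_ge q C with hC' | hC'
    · obtain ⟨ξ, hξ, hE⟩ := exists_relFlux_sub_left hA hη hηc hpq (C := C)
        (fun h => by linarith [h.2])
      obtain ⟨ζ, hζ, hF⟩ := exists_critSpeed_eq_of_lt hA hη hηc hC'
      have e1 := relFlux_eq (A := A) hη hηc p C
      have e2 := relFlux_eq (A := A) hη hηc q C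
      have hp := relEntropy_pos hη hηc (hpq.trans hC').ne
      have hlt := relEntropy_gt_left hη hηc hpq hC'.le
      have hA' : deriv A ξ ≤ critSpeed A η q C := by
        rw [hF]; exact hmono.monotone (hξ.2.trans hζ.1).le
      have := mul_le_mul_of_nonneg_right hA' (sub_nonneg.2 hlt.le)
      refine le_of_mul_le_mul_right ?_ hp
      linarith
    · exact (hle p hC).trans (hge q hC')

/-- When `u` lies outside `[p, q]`, moving `C` away from `u` averages in a larger or smaller secant
slope of `A` through `u`, and strict convexity orders these slopes strictly. If `u` lies in `[p,
q]`, the value `A'(u)` separates the two speeds. This strict order at `CR < CL` is the gap that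
makes the shock stable. -/
theorem critSpeed_lt (hA : ContDiff ℝ 2 A) (hAconv : StrictConvexOn ℝ univ A)
    (hmono : StrictMono (deriv A)) (hη : ContDiff ℝ 2 η)
    (hηc : ∀ x, 0 < deriv (deriv η) x) (u : ℝ) {p q : ℝ} (hpq : p < q) :
    critSpeed A η u p < critSpeed A η u q := by
  have hself : critSpeed A η u u = deriv A u := by simp [critSpeed]
  have hle : ∀ C, C < u → critSpeed A η u C < deriv A u := fun C h => by
    obtain ⟨ξ, hξ, hE⟩ := exists_critSpeed_eq_of_gt hA hη hηc h
    rw [hE]; exact hmono hξ.2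
  have hge : ∀ C, u < C → deriv A u < critSpeed A η u C := fun C h => by
    obtain ⟨ξ, hξ, hE⟩ := exists_critSpeed_eq_of_lt hA hη hηc h
    rw [hE]; exact hmono hξ.1
  have e1 := relFlux_eq (A := A) hη hηc u p
  have e2 := relFlux_eq (A := A) hη hηc u q
  rcases lt_trichotomy u p with hu | rfl | hu
  · obtain ⟨ξ, hξ, hE⟩ := exists_relFlux_sub_right hA hη hηc hpq (u := u)
      (fun h => by linarith [h.1])
    obtain ⟨ζ, hζ, hF⟩ := exists_relFlux_sub_right hA hη hηc hu (u := u) (by simp)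
    have hs := hAconv.secant_strict_mono (mem_univ u) (mem_univ ζ) (mem_univ ξ) hζ.1.ne'
      (hu.trans hξ.1).ne' (hζ.2.trans hξ.1)
    have hp := relEntropy_pos hη hηc hu.ne
    have hq := relEntropy_pos hη hηc (hu.trans hpq).ne
    have hlt := relEntropy_lt_right hη hηc hpq hu.le
    simp only [relFlux_self, relEntropy_self, sub_zero] at hF
    have hsp : critSpeed A η u p = (A ζ - A u) / (ζ - u) := by
      rw [e1] at hF; exact mul_right_cancel₀ hp.ne' hF
    rw [← hsp] at hs
    have := mul_lt_mul_of_pos_right hs (sub_pos.2 hlt)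
    refine lt_of_mul_lt_mul_right ?_ hq.le
    linarith
  · rw [hself]; exact hge q hpq
  · rcases lt_trichotomy u q with hu' | rfl | hu'
    · exact (hle p hu).trans (hge q hu')
    · rw [hself]; exact hle p hpq
    · obtain ⟨ξ, hξ, hE⟩ := exists_relFlux_sub_right hA hη hηc hpq (u := u)
        (fun h => by linarith [h.2])
      obtain ⟨ζ, hζ, hF⟩ := exists_relFlux_sub_right hA hη hηc hu' (u := u) (by simp)
      have hs := hAconv.secant_strict_mono (mem_univ u) (mem_univ ξ) (mem_univ ζ)
        (hξ.2.trans hu').ne hζ.2.ne (hξ.2.trans hζ.1)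
      have hp := relEntropy_pos hη hηc hu.ne'
      have hq := relEntropy_pos hη hηc hu'.ne'
      have hlt := relEntropy_gt_right hη hηc hpq hu'.le
      simp only [relFlux_self, relEntropy_self, zero_sub] at hF
      have hsp : critSpeed A η u q = (A ζ - A u) / (ζ - u) := by
        rw [e2] at hF
        refine mul_right_cancel₀ hq.ne' ?_
        linarith
      rw [← hsp] at hs
      have := mul_lt_mul_of_pos_right hs (sub_pos.2 hlt)
      refine lt_of_mul_lt_mul_right ?_ hp.le
      linarith

/-- A Lipschitz choice of shock speed `b(v)` which is dissipative with a uniform margin, for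
states on the left that are not much below `v` and states on the right not much above `v`. -/
theorem exists_dissipative_speed (hA : ContDiff ℝ 2 A) (hAconv : StrictConvexOn ℝ univ A)
    (hη : ContDiff ℝ 2 η) (hηc : ∀ x, 0 < deriv (deriv η) x) {CL CR : ℝ} (hC : CR < CL) {B : ℝ}
    (hB : 0 ≤ B) :
    ∃ (b : ℝ → ℝ) (Lb : ℝ≥0) (V c κ : ℝ), LipschitzWith Lb b ∧ 0 ≤ V ∧ (∀ v, |b v| ≤ V) ∧
      0 < c ∧ c ≤ 1 ∧ 0 < κ ∧ ∀ u ∈ Icc (-B) B, ∀ v ∈ Icc (-B) B,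
        (v - κ ≤ u → c * relEntropy η u CL ≤ relFlux A η u CL - b v * relEntropy η u CL) ∧
        (u ≤ v + κ → relFlux A η u CR - b v * relEntropy η u CR ≤ -c * relEntropy η u CR) := by
  have hmono : StrictMono (deriv A) := by
    rw [← strictMonoOn_univ]
    exact hAconv.strictMonoOn_deriv fun x _ => hA.differentiable (by norm_num) x
  set aL : ℝ → ℝ := fun u => critSpeed A η u CL
  set aR : ℝ → ℝ := fun u => critSpeed A η u CR
  have cL : Continuous aL := continuous_critSpeed hA hη hηc CL
  have cR : Continuous aR := continuous_critSpeed hA hη hηc CR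
  have mL : Monotone aL := monotone_critSpeed hA hmono hη hηc CL
  have mR : Monotone aR := monotone_critSpeed hA hmono hη hηc CR
  have hne : (Icc (-B) B).Nonempty := ⟨0, by simp [hB]⟩
  obtain ⟨u0, hu0, hmin⟩ := isCompact_Icc.exists_isMinOn hne (cL.sub cR).continuousOn
  set g := aL u0 - aR u0
  have hg : 0 < g := sub_pos.2 (critSpeed_lt hA hAconv hmono hη hηc u0 hC)
  have hgap : ∀ u ∈ Icc (-B) B, g ≤ aL u - aR u := fun u hu => hmin hu
  -- The midpoint of the gap is only known to be continuous, while the ODE for the shift needs a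
  -- Lipschitz speed; a polynomial approximation repairs this at a cost of `g / 8`.
  obtain ⟨P, hP⟩ := exists_polynomial_near_of_continuousOn (-B) B (fun u => (aL u + aR u) / 2)
    (by fun_prop) (g / 8) (by positivity)
  have hunif : ∀ {a : ℝ → ℝ}, Continuous a → ∃ κ > 0, ∀ u ∈ Icc (-B) B, ∀ v ∈ Icc (-B) B,
      |u - v| ≤ κ → |a u - a v| ≤ g / 8 := by
    intro a ha
    have := isCompact_Icc.uniformContinuousOn_of_continuous (s := Icc (-B) B) ha.continuousOn
    rw [Metric.uniformContinuousOn_iff] at this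
    obtain ⟨δ, hδ, h⟩ := this (g / 8) (by positivity)
    refine ⟨δ / 2, by positivity, fun u hu v hv huv => ?_⟩
    have := h u hu v hv (by rw [Real.dist_eq]; linarith)
    rw [Real.dist_eq] at this
    exact this.le
  obtain ⟨κ1, hκ1, h1⟩ := hunif cL
  obtain ⟨κ2, hκ2, h2⟩ := hunif cR
  obtain ⟨V, hV⟩ := (isCompact_Icc (a := -B) (b := B)).exists_bound_of_continuousOn
    P.continuous.continuousOn
  obtain ⟨L, hL⟩ := (isCompact_Icc (a := -B) (b := B)).exists_bound_of_continuousOn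
    P.derivative.continuous.continuousOn
  have hBB : -B ≤ B := by linarith
  -- Projecting onto `[-B, B]` makes the speed bounded and Lipschitz on the whole line. The margin
  -- is half the gap, minus `g / 8` for the approximation and `g / 8` for replacing `u` by `v`,
  -- hence `g / 4`; the cap at `1` serves `ε |φ'| ≤ φ` for the layer weight.
  refine ⟨fun v => P.eval (projIcc (-B) B hBB v : ℝ), L.toNNReal, max V 0, min (g / 4) 1,
    min κ1 κ2, ?_, le_max_right _ _, fun v => ?_, by positivity, min_le_right _ _,
    by positivity, ?_⟩
  · refine LipschitzWith.of_dist_le_mul fun v w => ?_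
    have e1 := abs_sub_le_of_hasDerivAt (fun x => P.hasDerivAt x) (convex_Icc (-B) B) hL
      (projIcc (-B) B hBB v).2 (projIcc (-B) B hBB w).2
    rw [Real.dist_eq, Real.dist_eq]
    refine e1.trans ?_
    have e2 := (LipschitzWith.projIcc hBB).dist_le_mul v w
    rw [Subtype.dist_eq, Real.dist_eq, Real.dist_eq, NNReal.coe_one, one_mul] at e2
    exact mul_le_mul (Real.le_coe_toNNReal L) e2 (abs_nonneg _) (NNReal.coe_nonneg _)
  · exact (hV _ (projIcc (-B) B hBB v).2).trans (le_max_left _ _)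
  · intro u hu v hv
    have hproj : (projIcc (-B) B hBB v : ℝ) = v := by rw [projIcc_of_mem hBB hv]
    dsimp only
    rw [hproj]
    have hPv := abs_lt.1 (hP v hv)
    have hgv := hgap v hv
    have ec : min (g / 4) 1 ≤ g / 4 := min_le_left _ _
    constructor
    · intro huv
      have hau : aL v - g / 8 ≤ aL u := by
        rcases le_total v u with h | h
        · have := mL h; linarith
        · have e := abs_le.1 (h1 u hu v hv (by
            rw [abs_of_nonpos (by linarith)]
            have := min_le_left κ1 κ2
            linarith))
          linarith [e.1]
      rw [relFlux_eq hη hηc, ← sub_mul]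
      refine mul_le_mul_of_nonneg_right ?_ (relEntropy_nonneg hη hηc _ _)
      change _ ≤ aL u - _
      linarith
    · intro huv
      have hau : aR u ≤ aR v + g / 8 := by
        rcases le_total u v with h | h
        · have := mR h; linarith
        · have e := abs_le.1 (h2 u hu v hv (by
            rw [abs_of_nonneg (by linarith)]
            have := min_le_right κ1 κ2
            linarith))
          linarith [e.2]
      rw [relFlux_eq hη hηc, ← sub_mul]
      refine mul_le_mul_of_nonneg_right ?_ (relEntropy_nonneg hη hηc _ _)
      change aR u - _ ≤ _
      linarith

end RelativeFlux

/-! ### The one-sided modulus of the initial value -/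

section Initial

variable {U₀ g : ℝ → ℝ}

theorem integral_sq_le_of_eLpNorm_le (hg2 : MemLp g 2 volume) {K : ℝ≥0}
    (hK : eLpNorm g 2 volume ≤ (K : ℝ≥0∞)) : ∫ x, g x ^ 2 ≤ (K : ℝ) ^ 2 := by
  rw [hg2.eLpNorm_eq_integral_rpow_norm (by norm_num) (by norm_num)] at hK
  have h0 : 0 ≤ ∫ x, g x ^ 2 := integral_nonneg fun x => by positivity
  have h1 : ∫ x, ‖g x‖ ^ (2 : ℝ≥0∞).toReal = ∫ x, g x ^ 2 := by
    congr 1; ext x; simp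
  rw [h1] at hK
  have h2 : ((∫ x, g x ^ 2) ^ ((2 : ℝ≥0∞).toReal⁻¹)) ≤ K := by
    rw [← ENNReal.ofReal_coe_nnreal] at hK
    exact (ENNReal.ofReal_le_ofReal_iff K.2).1 hK
  have h3 : (∫ x, g x ^ 2) ^ ((2 : ℝ≥0∞).toReal⁻¹) = Real.sqrt (∫ x, g x ^ 2) := by
    rw [Real.sqrt_eq_rpow]; norm_num
  rw [h3] at h2
  calc ∫ x, g x ^ 2 = Real.sqrt (∫ x, g x ^ 2) ^ 2 := (Real.sq_sqrt h0).symm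
    _ ≤ (K : ℝ) ^ 2 := by gcongr

/-- The test function `θ` is a mollified indicator of `[x, y]`, with values in `[0, 1]` and
derivative the difference of the two mollifiers. Against it the negative part of the derivative
measure can be discarded, and Young's inequality bounds `∫ g θ` by `N ∫ θ² + ∫ g² / (4 N)`, where
the support of `θ` has length `y - x` plus twice the mollification radius. -/
theorem mollified_sub_le (hloc : LocallyIntegrable U₀ volume) (hg : HasDerivPosPart U₀ g)
    (hg2 : MemLp g 2 volume) {K : ℝ≥0} (hK : eLpNorm g 2 volume ≤ (K : ℝ≥0∞)) {N : ℝ} (hN : 0 < N)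
    (φ : ContDiffBump (0 : ℝ)) {x y : ℝ} (hxy : x < y) :
    (∫ z, U₀ z * φ.normed volume (z - y)) - ∫ z, U₀ z * φ.normed volume (z - x) ≤
      N * (y - x + 2 * φ.rOut) + (K : ℝ) ^ 2 / (4 * N) := by
  obtain ⟨hgm, hg0, μp, μn, hder, hμp⟩ := hg
  set ρ := φ.normed volume
  have hρ : ContDiff ℝ ∞ ρ := φ.contDiff_normed
  have hρc : Continuous ρ := hρ.continuous
  have hρ0 : ∀ z, 0 ≤ ρ z := fun z => φ.nonneg_normed z
  have hρ1 : ∫ z, ρ z = 1 := φ.integral_normed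
  have hρi : Integrable ρ := φ.integrable_normed
  have hδ := φ.rOut_pos
  set δ := φ.rOut
  have hρz : ∀ z, δ ≤ |z| → ρ z = 0 := fun z hz => by
    have : z ∉ Function.support ρ := by
      rw [φ.support_normed_eq]; simpa [Real.dist_eq] using hz
    simpa using this
  set Φ : ℝ → ℝ := fun s => ∫ w in (0 : ℝ)..s, ρ w
  have hΦ : ∀ s, HasDerivAt Φ (ρ s) s := fun s =>
    intervalIntegral.integral_hasDerivAt_right (hρc.intervalIntegrable _ _)
      hρc.aestronglyMeasurable.stronglyMeasurableAtFilter hρc.continuousAt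
  have hΦs : ContDiff ℝ ∞ Φ := by
    rw [contDiff_infty_iff_deriv]
    refine ⟨fun s => (hΦ s).differentiableAt, ?_⟩
    rwa [funext fun s => (hΦ s).deriv]
  set θ : ℝ → ℝ := fun z => Φ (z - x) - Φ (z - y)
  have hθs : ContDiff ℝ ∞ θ := by
    have h1 : ContDiff ℝ ∞ fun z : ℝ => z - x := contDiff_id.sub contDiff_const
    have h2 : ContDiff ℝ ∞ fun z : ℝ => z - y := contDiff_id.sub contDiff_const
    exact (hΦs.comp h1).sub (hΦs.comp h2)
  have hθc : Continuous θ := hθs.continuous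
  have hθd : ∀ z, HasDerivAt θ (ρ (z - x) - ρ (z - y)) z := fun z => by
    have h1 := (hΦ (z - x)).comp z ((hasDerivAt_id z).sub_const x)
    have h2 := (hΦ (z - y)).comp z ((hasDerivAt_id z).sub_const y)
    exact (h1.sub h2).congr_deriv (by ring)
  have hθi : ∀ z, θ z = ∫ w in (z - y)..(z - x), ρ w := fun z =>
    intervalIntegral.integral_interval_sub_left (hρc.intervalIntegrable _ _)
      (hρc.intervalIntegrable _ _)
  have hθ0 : ∀ z, 0 ≤ θ z := fun z => by
    rw [hθi]
    exact intervalIntegral.integral_nonneg (by linarith) fun w _ => hρ0 w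
  have hθ1 : ∀ z, θ z ≤ 1 := fun z => by
    rw [hθi, intervalIntegral.integral_of_le (by linarith), ← hρ1]
    exact setIntegral_le_integral hρi (Eventually.of_forall hρ0)
  have hθz : ∀ z ∉ Icc (x - δ) (y + δ), θ z = 0 := fun z hz => by
    rw [hθi]
    rw [mem_Icc, not_and_or, not_le, not_le] at hz
    rw [intervalIntegral.integral_congr (g := fun _ => 0), intervalIntegral.integral_zero]
    intro w hw
    rw [uIcc_of_le (by linarith)] at hw
    refine hρz w ?_
    rcases hz with hz | hz
    · rw [abs_of_nonpos (by linarith [hw.2])]; linarith [hw.2]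
    · rw [abs_of_nonneg (by linarith [hw.1])]; linarith [hw.1]
  have hθcs : HasCompactSupport θ := HasCompactSupport.intro isCompact_Icc hθz
  have key := hder.integral_mul_deriv θ hθs hθcs
  have hμn : 0 ≤ ∫ z, θ z ∂μn := integral_nonneg hθ0
  have hμpi : ∫ z, θ z ∂μp = ∫ z, g z * θ z := by
    rw [hμp, integral_withDensity_eq_integral_toReal_smul₀ hgm.ennreal_ofReal
      (Eventually.of_forall fun z => ENNReal.ofReal_lt_top)]
    refine integral_congr_ae ?_
    filter_upwards [hg0] with z hz
    rw [ENNReal.toReal_ofReal hz, smul_eq_mul]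
  have hUi : ∀ a, Integrable fun z => U₀ z * ρ (z - a) := fun a => by
    have := hloc.integrable_smul_right_of_hasCompactSupport (g := fun z => ρ (z - a))
      (by fun_prop) (hasCompactSupport_comp_sub hρz a)
    simpa using this
  have hlhs : ∫ z, U₀ z * deriv θ z = (∫ z, U₀ z * ρ (z - x)) - ∫ z, U₀ z * ρ (z - y) := by
    rw [← integral_sub (hUi x) (hUi y)]
    congr 1; ext z
    rw [(hθd z).deriv]; ring
  rw [hlhs, hμpi] at key
  have hg2i : Integrable fun z => g z ^ 2 := hg2.integrable_sq
  have hθ2i : Integrable fun z => θ z ^ 2 :=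
    Continuous.integrable_of_hasCompactSupport (by fun_prop) 
      (HasCompactSupport.intro isCompact_Icc fun z hz => by rw [hθz z hz]; norm_num)
  have hθ2 : ∫ z, θ z ^ 2 ≤ y - x + 2 * δ := by
    have hle : ∀ z, θ z ^ 2 ≤ (Icc (x - δ) (y + δ)).indicator (fun _ => (1 : ℝ)) z := fun z => by
      by_cases hz : z ∈ Icc (x - δ) (y + δ)
      · rw [indicator_of_mem hz]; exact pow_le_one₀ (hθ0 z) (hθ1 z)
      · rw [indicator_of_notMem hz, hθz z hz]; norm_num
    refine (integral_mono hθ2i ((integrable_indicator_iff measurableSet_Icc).2 (by simp))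
      hle).trans ?_
    rw [integral_indicator measurableSet_Icc]
    simp only [integral_const, MeasurableSet.univ, measureReal_restrict_apply, univ_inter,
      Real.volume_real_Icc, smul_eq_mul, mul_one]
    rw [max_eq_left (by linarith)]
    linarith
  have hgθ : ∫ z, g z * θ z ≤ N * (∫ z, θ z ^ 2) + (∫ z, g z ^ 2) / (4 * N) := by
    rw [← integral_const_mul, ← integral_div, ← integral_add (hθ2i.const_mul N) (hg2i.div_const _)]
    refine integral_mono_of_nonneg ?_ ((hθ2i.const_mul N).add (hg2i.div_const _)) ?_
    · filter_upwards [hg0] with z hz using mul_nonneg hz (hθ0 z)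
    · refine Eventually.of_forall fun z => ?_
      have e : N * θ z ^ 2 + g z ^ 2 / (4 * N) - g z * θ z = (2 * N * θ z - g z) ^ 2 / (4 * N) := by
        field_simp; ring
      have : 0 ≤ (2 * N * θ z - g z) ^ 2 / (4 * N) := by positivity
      dsimp only
      linarith
  have hgK : (∫ z, g z ^ 2) / (4 * N) ≤ (K : ℝ) ^ 2 / (4 * N) := by
    gcongr
    exact integral_sq_le_of_eLpNorm_le hg2 hK
  have hNθ := mul_le_mul_of_nonneg_left hθ2 hN.le
  linarith

/-- Mollifications converge at almost every point, hence both coordinates are good for almost every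
pair. The modulus is kept affine, with a free slope `N`, because this is the form that the doubling
argument propagates. -/
theorem ae_prod_sub_le (hloc : LocallyIntegrable U₀ volume) (hg : HasDerivPosPart U₀ g)
    (hg2 : MemLp g 2 volume) {K : ℝ≥0} (hK : eLpNorm g 2 volume ≤ (K : ℝ≥0∞)) {N : ℝ}
    (hN : 0 < N) :
    ∀ᵐ p : ℝ × ℝ ∂(volume.prod volume), p.1 < p.2 →
      U₀ p.2 - U₀ p.1 ≤ N * (p.2 - p.1) + (K : ℝ) ^ 2 / (4 * N) := by
  set φ : ℕ → ContDiffBump (0 : ℝ) := fun n =>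
    ⟨1 / ((n : ℝ) + 1), 2 / ((n : ℝ) + 1), by positivity, by gcongr; norm_num⟩
  have hout : Tendsto (fun n => (φ n).rOut) atTop (𝓝 0) :=
    tendsto_const_nhds.div_atTop (tendsto_atTop_add_const_right _ _ tendsto_natCast_atTop_atTop)
  have hae := ContDiffBump.ae_convolution_tendsto_right_of_locallyIntegrable (φ := φ) (K := 2)
    hout (Eventually.of_forall fun n => by simp only [φ]; apply le_of_eq; ring) hloc
  have hconv : ∀ n x, convolution ((φ n).normed volume) U₀ (ContinuousLinearMap.lsmul ℝ ℝ)
      volume x = ∫ z, U₀ z * (φ n).normed volume (z - x) := fun n x => by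
    rw [convolution_eq_swap]
    congr 1; ext z
    rw [ContinuousLinearMap.lsmul_apply, smul_eq_mul, mul_comm, ← (φ n).normed_neg (x - z),
      neg_sub]
  simp_rw [hconv] at hae
  filter_upwards [Measure.quasiMeasurePreserving_fst.ae hae,
    Measure.quasiMeasurePreserving_snd.ae hae] with p h1 h2 hlt
  have hr : Tendsto (fun n => N * (p.2 - p.1 + 2 * (φ n).rOut) + (K : ℝ) ^ 2 / (4 * N)) atTop
      (𝓝 (N * (p.2 - p.1 + 2 * 0) + (K : ℝ) ^ 2 / (4 * N))) :=
    (((hout.const_mul 2).const_add _).const_mul N).add_const _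
  rw [mul_zero, add_zero] at hr
  exact le_of_tendsto_of_tendsto' (h2.sub h1) hr fun n =>
    mollified_sub_le hloc hg hg2 hK hN (φ n) hlt

end Initial

/-! ### The shift -/

section Shift

variable {A : ℝ → ℝ} {ε T : ℝ} {U₀ : ℝ → ℝ} {U : ℝ → ℝ → ℝ}

theorem integrable_cutoff {R : ℝ} (hR : 0 < R) : Integrable (cutoff R) :=
  (continuous_cutoff R).integrable_of_hasCompactSupport
    (hasCompactSupport_of_eq_zero fun _ hy => cutoff_eq_zero hR hy)

theorem integral_cutoff_pos {R : ℝ} (hR : 0 < R) : 0 < ∫ z, cutoff R z :=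
  (continuous_cutoff R).integral_pos_of_hasCompactSupport_nonneg_nonzero
    (hasCompactSupport_of_eq_zero fun _ hy => cutoff_eq_zero hR hy)
    (fun z => cutoff_nonneg R z) (x := 0) (by simp [cutoff_zero])

/-- The average of `u` around `x` at scale `R`. -/
noncomputable def localMean (R : ℝ) (u : ℝ → ℝ) (x : ℝ) : ℝ :=
  (∫ z, u z * cutoff R (z - x)) / ∫ z, cutoff R z

theorem localMean_le {R : ℝ} (hR : 0 < R) {u : ℝ → ℝ} (hu : Continuous u) {x a : ℝ}
    (h : ∀ z, |z - x| < R → u z ≤ a) : localMean R u x ≤ a := by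
  unfold localMean
  rw [div_le_iff₀ (integral_cutoff_pos hR), ← integral_sub_right_eq_self (cutoff R) x,
    ← integral_const_mul]
  have cr := continuous_cutoff R
  have hs := hasCompactSupport_comp_sub (fun y hy => cutoff_eq_zero hR hy) x
  refine integral_mono (Continuous.integrable_of_hasCompactSupport (by fun_prop) hs.mul_left)
    (Continuous.integrable_of_hasCompactSupport (by fun_prop) hs.mul_left) fun z => ?_
  dsimp only
  rcases lt_or_ge |z - x| R with hz | hz
  · exact mul_le_mul_of_nonneg_right (h z hz) (cutoff_nonneg _ _)
  · rw [cutoff_eq_zero hR hz]; simp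

theorem le_localMean {R : ℝ} (hR : 0 < R) {u : ℝ → ℝ} (hu : Continuous u) {x a : ℝ}
    (h : ∀ z, |z - x| < R → a ≤ u z) : a ≤ localMean R u x := by
  have := localMean_le hR hu.neg (x := x) (a := -a) fun z hz => neg_le_neg (h z hz)
  unfold localMean at *
  simp only [Pi.neg_apply, neg_mul, integral_neg, neg_div] at this
  linarith

theorem abs_integral_mul_le_of_support {R D : ℝ} (hR : 0 ≤ R) {f : ℝ → ℝ} {x : ℝ}
    (hf : ∀ z, |f z| ≤ D) (h0 : ∀ z, R ≤ |z - x| → f z = 0) : |∫ z, f z| ≤ D * (2 * R) := by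
  have hle : ∀ z, ‖f z‖ ≤ (Icc (x - R) (x + R)).indicator (fun _ => D) z := fun z => by
    by_cases hz : z ∈ Icc (x - R) (x + R)
    · rw [indicator_of_mem hz]; exact hf z
    · rw [indicator_of_notMem hz, h0 z, norm_zero]
      by_contra hlt
      have := abs_lt.1 (not_le.1 hlt)
      exact hz ⟨by linarith, by linarith⟩
  have := norm_integral_le_of_norm_le ((integrable_indicator_iff (f := fun _ : ℝ => D)
    (s := Icc (x - R) (x + R)) (μ := volume) measurableSet_Icc).2 (by simp))
    (Eventually.of_forall hle)
  rw [integral_indicator measurableSet_Icc] at this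
  simp only [integral_const, MeasurableSet.univ, measureReal_restrict_apply, univ_inter,
    Real.volume_real_Icc, smul_eq_mul] at this
  rw [max_eq_left (by linarith)] at this
  rw [Real.norm_eq_abs] at this
  linarith

theorem abs_integral_mul_cutoff_sub_le {R B : ℝ} (hR : 0 < R) {u : ℝ → ℝ} (hu : Continuous u)
    (hB : ∀ z, |u z| ≤ B) (x y : ℝ) :
    |(∫ z, u z * cutoff R (z - x)) - ∫ z, u z * cutoff R (z - y)| ≤ 32 * B * |x - y| := by
  have hB0 : 0 ≤ B := (abs_nonneg _).trans (hB 0)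
  have cr := continuous_cutoff R
  have i : ∀ a, Integrable fun z => u z * cutoff R (z - a) := fun a =>
    Continuous.integrable_of_hasCompactSupport (by fun_prop)
      (hasCompactSupport_comp_sub (fun y hy => cutoff_eq_zero hR hy) a).mul_left
  rw [← integral_sub (i x) (i y)]
  set D := B * (8 / R * |x - y|)
  set I : ℝ → Set ℝ := fun a => Icc (a - R) (a + R)
  have hout : ∀ a z, z ∉ I a → cutoff R (z - a) = 0 := fun a z hz => by
    refine cutoff_eq_zero hR ?_
    by_contra hlt
    have := abs_lt.1 (not_le.1 hlt)
    exact hz ⟨by linarith, by linarith⟩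
  have hD0 : 0 ≤ D := by positivity
  have hle : ∀ z, ‖u z * cutoff R (z - x) - u z * cutoff R (z - y)‖ ≤
      (I x).indicator (fun _ => D) z + (I y).indicator (fun _ => D) z := fun z => by
    have h1 : ‖u z * cutoff R (z - x) - u z * cutoff R (z - y)‖ ≤ D := by
      rw [← mul_sub, Real.norm_eq_abs, abs_mul]
      refine mul_le_mul (hB z) ?_ (abs_nonneg _) hB0
      have := abs_sub_le_of_hasDerivAt (hasDerivAt_cutoff R) convex_univ
        (fun w _ => abs_cutoffD_le_div hR w) (mem_univ (z - x)) (mem_univ (z - y))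
      rwa [show z - x - (z - y) = -(x - y) by ring, abs_neg] at this
    have hx0 : 0 ≤ (I x).indicator (fun _ => D) z := indicator_nonneg (fun _ _ => hD0) z
    have hy0 : 0 ≤ (I y).indicator (fun _ => D) z := indicator_nonneg (fun _ _ => hD0) z
    by_cases hzx : z ∈ I x
    · rw [indicator_of_mem hzx]; linarith
    · by_cases hzy : z ∈ I y
      · rw [indicator_of_mem hzy]; linarith
      · rw [hout x z hzx, hout y z hzy]
        simpa using add_nonneg hx0 hy0
  have hii : ∀ a, Integrable ((I a).indicator fun _ => D) := fun a =>
    (integrable_indicator_iff measurableSet_Icc).2 (by simp)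
  have := norm_integral_le_of_norm_le ((hii x).add (hii y)) (Eventually.of_forall hle)
  rw [integral_add' (hii x) (hii y), integral_indicator measurableSet_Icc,
    integral_indicator measurableSet_Icc] at this
  simp only [integral_const, MeasurableSet.univ, measureReal_restrict_apply, univ_inter,
    Real.volume_real_Icc, smul_eq_mul] at this
  rw [max_eq_left (by linarith), max_eq_left (by linarith), Real.norm_eq_abs] at this
  refine this.trans (le_of_eq ?_)
  simp only [D]
  field_simp
  ring

/-- Testing the equation with the cutoff moves all space derivatives onto it, so the time derivative
is bounded using only `|U| ≤ B`. The Lipschitz constant therefore does not degenerate as `t → 0`,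
although the initial value may be rough. -/
theorem exists_lipschitzOnWith_integral_mul_cutoff (hA : ContDiff ℝ 2 A)
    (hU : IsViscousSolution A ε T U₀ U) (hε : 0 < ε) {B : ℝ} (hB0 : 0 ≤ B)
    (hB : ∀ t ∈ Ioo 0 T, ∀ x, |U t x| ≤ B) {R : ℝ} (hR : 0 < R) :
    ∃ L : ℝ≥0, LipschitzOnWith L (fun p : ℝ × ℝ => ∫ z, U p.1 z * cutoff R (z - p.2))
      (Ioo 0 T ×ˢ univ) := by
  obtain ⟨DA, hDA⟩ := (isCompact_Icc (a := -B) (b := B)).exists_bound_of_continuousOn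
    hA.continuous.continuousOn
  have hDA0 : 0 ≤ DA := (norm_nonneg _).trans (hDA 0 (by simp [hB0]))
  set L1 := (DA * (8 / R) + ε * B * (56 / R ^ 2)) * (2 * R)
  have hL10 : 0 ≤ L1 := by positivity
  have htime : ∀ x, ∀ s ∈ Ioo 0 T, ∀ t ∈ Ioo 0 T,
      |(∫ z, U s z * cutoff R (z - x)) - ∫ z, U t z * cutoff R (z - x)| ≤ L1 * |s - t| := by
    intro x s hs t ht
    have hder := fun τ hτ => hasDerivAt_integral_mul_weight hA hU (h := fun u => u)
      (h1 := fun _ => 1) (h2 := fun _ => 0) (Q := A) (fun u => hasDerivAt_id u)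
      (fun u => hasDerivAt_const _ _) continuous_const
      (fun u => (one_mul (deriv A u)).symm ▸ (hA.differentiable (by norm_num) u).hasDerivAt)
      (hasDerivAt_cutoff R) (hasDerivAt_cutoffD R) (continuous_cutoffDD R)
      (fun y hy => cutoff_eq_zero hR hy) (fun y hy => cutoffD_eq_zero hR hy)
      (fun y hy => cutoffDD_eq_zero hR hy) (X := fun _ => x) (X1 := fun _ => 0)
      (fun t _ => hasDerivAt_const _ _) (V := 0) (fun t _ => by simp) (t := τ) hτ
    have := Convex.norm_image_sub_le_of_norm_deriv_le (C := L1)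
      (f := fun s => ∫ z, U s z * cutoff R (z - x)) (s := Ioo 0 T)
      (fun τ hτ => (hder τ hτ).differentiableAt) (fun τ hτ => ?_) (convex_Ioo 0 T) ht hs
    · exact this
    · rw [(hder τ hτ).deriv, Real.norm_eq_abs]
      refine abs_integral_mul_le_of_support (x := x) hR.le (fun z => ?_)
        (fun z hz => ?_)
      · simp only [zero_mul, sub_zero, mul_zero]
        refine (abs_add_le _ _).trans (add_le_add ?_ ?_)
        · rw [abs_mul]
          exact mul_le_mul (hDA _ (abs_le.1 (hB τ hτ z))) (abs_cutoffD_le_div hR _) (abs_nonneg _)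
            hDA0
        · rw [abs_mul, abs_mul, abs_of_pos hε]
          have := hB τ hτ z
          have := abs_cutoffDD_le_div hR (z - x)
          gcongr
      · rw [cutoff_eq_zero hR hz, cutoffD_eq_zero hR hz, cutoffDD_eq_zero hR hz]; simp
  refine ⟨(L1 + 32 * B).toNNReal, LipschitzOnWith.of_dist_le_mul fun p hp q hq => ?_⟩
  rw [Real.coe_toNNReal _ (by positivity), Real.dist_eq]
  have e1 := htime p.2 p.1 hp.1 q.1 hq.1
  have e2 := abs_integral_mul_cutoff_sub_le hR (hU.continuous_space hq.1) (hB q.1 hq.1) p.2 q.2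
  have d1 : |p.1 - q.1| ≤ dist p q := by rw [← Real.dist_eq]; exact le_max_left _ _
  have d2 : |p.2 - q.2| ≤ dist p q := by rw [← Real.dist_eq]; exact le_max_right _ _
  have e3 := mul_le_mul_of_nonneg_left d1 hL10
  have e4 := mul_le_mul_of_nonneg_left d2 (by positivity : 0 ≤ 32 * B)
  have e5 := abs_sub_le (∫ z, U p.1 z * cutoff R (z - p.2)) (∫ z, U q.1 z * cutoff R (z - p.2))
    (∫ z, U q.1 z * cutoff R (z - q.2))
  linarith

/-- The shift: a Lipschitz curve driven by a function of the local mean of the solution. -/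
theorem exists_shift (hA : ContDiff ℝ 2 A)
    (hU : IsViscousSolution A ε T U₀ U) (hε : 0 < ε) (hT : 0 < T) {B : ℝ} (hB0 : 0 ≤ B)
    (hB : ∀ t ∈ Ioo 0 T, ∀ x, |U t x| ≤ B) {R : ℝ} (hR : 0 < R) {b : ℝ → ℝ} {Lb : ℝ≥0}
    (hb : LipschitzWith Lb b) {V : ℝ} (hV0 : 0 ≤ V) (hV : ∀ v, |b v| ≤ V) :
    ∃ X : ℝ → ℝ, X 0 = 0 ∧ LipschitzOnWith V.toNNReal X (Icc 0 T) ∧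
      ∀ t ∈ Ioo 0 T, HasDerivAt X (b (localMean R (U t) (X t))) t := by
  obtain ⟨L, hL⟩ := exists_lipschitzOnWith_integral_mul_cutoff hA hU hε hB0 hB hR
  -- The Picard–Lindelöf theorem is applied on the closed interval, whereas the averages are
  -- controlled only for `0 < t < T`; a Lipschitz extension supplies the endpoints and does not
  -- change the ODE inside.
  obtain ⟨G, hG, hGeq⟩ := hL.extend_real
  set m := ∫ z, cutoff R z
  have hdiv : LipschitzWith (‖m⁻¹‖₊) fun v : ℝ => v / m := by
    refine LipschitzWith.of_dist_le_mul fun v w => le_of_eq ?_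
    rw [Real.dist_eq, Real.dist_eq, ← sub_div, div_eq_mul_inv, abs_mul, mul_comm]
    simp
  have hF : LipschitzWith (Lb * (‖m⁻¹‖₊ * L)) fun p : ℝ × ℝ => b (G p / m) :=
    hb.comp (hdiv.comp hG)
  have hpl : IsPicardLindelof (fun t x => b (G (t, x) / m)) (tmin := 0) (tmax := T)
      ⟨0, by simp [hT.le]⟩ (0 : ℝ) (V * T).toNNReal 0 V.toNNReal (Lb * (‖m⁻¹‖₊ * L)) := by
    refine ⟨fun t _ => ?_, fun x _ => ?_, fun t _ x _ => ?_, ?_⟩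
    · have := hF.comp (LipschitzWith.prodMk_left t)
      rw [mul_one] at this
      exact this.lipschitzOnWith
    · exact (hF.continuous.comp (by fun_prop : Continuous fun t : ℝ => (t, x))).continuousOn
    · rw [Real.coe_toNNReal _ hV0]; exact hV _
    · rw [Real.coe_toNNReal _ hV0, Real.coe_toNNReal _ (by positivity)]
      simp [max_eq_left hT.le]
  obtain ⟨X, hX0, hX⟩ := hpl.exists_eq_forall_mem_Icc_hasDerivWithinAt
    (Metric.mem_closedBall_self (by simp))
  refine ⟨X, hX0, ?_, fun t ht => ?_⟩
  · refine Convex.lipschitzOnWith_of_nnnorm_hasDerivWithin_le (convex_Icc 0 T) hX fun t _ => ?_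
    rw [← NNReal.coe_le_coe, coe_nnnorm, Real.coe_toNNReal _ hV0]
    exact hV _
  · have h1 := (hX t ⟨ht.1.le, ht.2.le⟩).hasDerivAt (Icc_mem_nhds ht.1 ht.2)
    have h2 : G (t, X t) = ∫ z, U t z * cutoff R (z - X t) :=
      (hGeq (show (t, X t) ∈ Ioo 0 T ×ˢ univ from ⟨ht, mem_univ _⟩)).symm
    rw [h2] at h1
    exact h1

end Shift

/-! ### The layer weight -/

section Layer

/-- A `C²` weight equal to `1` left of `-a` and decaying like `exp (-k (y + a))` to its right. -/
noncomputable def layer (k a y : ℝ) : ℝ := 1 - (max (1 - Real.exp (-k * (y + a))) 0) ^ 3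

/-- The derivative of `layer k a`. -/
noncomputable def layerD (k a y : ℝ) : ℝ :=
  -(3 * (max (1 - Real.exp (-k * (y + a))) 0) ^ 2 * (k * Real.exp (-k * (y + a))))

/-- The second derivative of `layer k a`. -/
noncomputable def layerDD (k a y : ℝ) : ℝ :=
  k ^ 2 * (3 * (max (1 - Real.exp (-k * (y + a))) 0) ^ 2 * Real.exp (-k * (y + a))
    - 6 * max (1 - Real.exp (-k * (y + a))) 0 * Real.exp (-k * (y + a)) ^ 2)

variable {k a : ℝ}

theorem hasDerivAt_exp_layer (k a y : ℝ) :
    HasDerivAt (fun y => Real.exp (-k * (y + a))) (-(k * Real.exp (-k * (y + a)))) y :=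
  (((hasDerivAt_id y).add_const a).const_mul (-k)).exp.congr_deriv (by simp only [id]; ring)

theorem hasDerivAt_layer (k a y : ℝ) : HasDerivAt (layer k a) (layerD k a y) y := by
  have h1 : HasDerivAt (fun y => 1 - Real.exp (-k * (y + a))) (k * Real.exp (-k * (y + a))) y :=
    ((hasDerivAt_exp_layer k a y).const_sub 1).congr_deriv (neg_neg _)
  have h2 := ((hasDerivAt_max_zero_pow 1 (1 - Real.exp (-k * (y + a)))).comp y h1).const_sub 1
  refine h2.congr_deriv ?_
  simp only [layerD]; norm_num

theorem hasDerivAt_layerD (k a y : ℝ) : HasDerivAt (layerD k a) (layerDD k a y) y := by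
  have h0 := hasDerivAt_exp_layer k a y
  have h1 : HasDerivAt (fun y => 1 - Real.exp (-k * (y + a))) (k * Real.exp (-k * (y + a))) y :=
    (h0.const_sub 1).congr_deriv (neg_neg _)
  have h2 := (((hasDerivAt_max_zero_pow 0 (1 - Real.exp (-k * (y + a)))).comp y h1).const_mul 3).mul
    (h0.const_mul k)
  refine h2.neg.congr_deriv ?_
  simp only [layerDD, Function.comp]; norm_num; ring

theorem continuous_layerDD (k a : ℝ) : Continuous (layerDD k a) := by
  unfold layerDD; fun_prop

theorem max_one_sub_exp_mem (k a y : ℝ) : max (1 - Real.exp (-k * (y + a))) 0 ∈ Icc (0 : ℝ) 1 :=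
  ⟨le_max_right _ _, max_le (by linarith [Real.exp_pos (-k * (y + a))]) zero_le_one⟩

theorem layer_nonneg (k a y : ℝ) : 0 ≤ layer k a y := by
  have h := max_one_sub_exp_mem k a y
  have := pow_le_one₀ (n := 3) h.1 h.2
  unfold layer; linarith

theorem layer_le_one (k a y : ℝ) : layer k a y ≤ 1 := by
  have h := (max_one_sub_exp_mem k a y).1
  have : 0 ≤ (max (1 - Real.exp (-k * (y + a))) 0) ^ 3 := by positivity
  unfold layer; linarith

theorem max_one_sub_exp_eq_zero (hk : 0 ≤ k) {y : ℝ} (hy : y ≤ -a) :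
    max (1 - Real.exp (-k * (y + a))) 0 = 0 := by
  apply max_eq_right
  have : 0 ≤ -k * (y + a) := by nlinarith
  linarith [Real.one_le_exp this]

theorem layer_eq_one (hk : 0 ≤ k) {y : ℝ} (hy : y ≤ -a) : layer k a y = 1 := by
  unfold layer; rw [max_one_sub_exp_eq_zero hk hy]; norm_num

theorem layerD_eq_zero (hk : 0 ≤ k) {y : ℝ} (hy : y ≤ -a) : layerD k a y = 0 := by
  unfold layerD; rw [max_one_sub_exp_eq_zero hk hy]; norm_num

theorem layerDD_eq_zero (hk : 0 ≤ k) {y : ℝ} (hy : y ≤ -a) : layerDD k a y = 0 := by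
  unfold layerDD; rw [max_one_sub_exp_eq_zero hk hy]; norm_num

theorem layer_le (k a y : ℝ) : layer k a y ≤ 3 * Real.exp (-k * (y + a)) := by
  have hs := Real.exp_pos (-k * (y + a))
  unfold layer
  set s := Real.exp (-k * (y + a))
  rcases le_total s 1 with h | h
  · rw [max_eq_left (by linarith)]
    have : s ^ 3 ≤ 3 * s ^ 2 := by nlinarith [sq_nonneg s]
    nlinarith
  · rw [max_eq_right (by linarith)]; linarith

theorem layerD_nonpos (hk : 0 ≤ k) (y : ℝ) : layerD k a y ≤ 0 := by
  have h := (max_one_sub_exp_mem k a y).1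
  unfold layerD
  rw [neg_nonpos]; positivity

/-- With `s` the exponential and `s ≤ 1`, one has `1 - (1 - s)³ - 3 (1 - s)² s = s² (3 - 2 s) ≥ 0`.
This is the admissibility condition that lets the weight be multiplied by a cutoff. -/
theorem mul_abs_layerD_le {ε : ℝ} (hk : 0 ≤ k) (hεk : ε * k ≤ 1) (y : ℝ) :
    ε * |layerD k a y| ≤ layer k a y := by
  have hm := max_one_sub_exp_mem k a y
  have hs := Real.exp_pos (-k * (y + a))
  rw [abs_of_nonpos (layerD_nonpos hk y)]
  unfold layerD layer
  set s := Real.exp (-k * (y + a))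
  rcases le_total s 1 with h | h
  · have hM : max (1 - s) 0 = 1 - s := max_eq_left (by linarith)
    rw [hM]
    have h1 : 3 * (1 - s) ^ 2 * s ≤ 1 - (1 - s) ^ 3 := by
      have : 0 ≤ s * (s * (3 - 2 * s)) := by
        refine mul_nonneg hs.le (mul_nonneg hs.le (by linarith))
      nlinarith
    have h2 : 0 ≤ 3 * (1 - s) ^ 2 * s := by positivity
    calc ε * -(-(3 * (1 - s) ^ 2 * (k * s))) = ε * k * (3 * (1 - s) ^ 2 * s) := by ring
      _ ≤ 1 * (3 * (1 - s) ^ 2 * s) := by gcongr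
      _ ≤ _ := by linarith
  · rw [max_eq_right (by linarith)]; norm_num

/-- Differentiating the exponential once more costs a factor `k`, and the remaining term of
`layerDD` is negative. With `ε k = c` the diffusion of the weight is thus no larger than what a
dissipation margin `c` provides. -/
theorem mul_layerDD_le {ε c : ℝ} (hε : 0 ≤ ε) (hεk : ε * k = c) (y : ℝ) :
    ε * layerDD k a y ≤ c * (-layerD k a y) := by
  have hm := (max_one_sub_exp_mem k a y).1
  have hs := Real.exp_pos (-k * (y + a))
  unfold layerDD layerD
  set s := Real.exp (-k * (y + a))
  set m := max (1 - s) 0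
  rw [← hεk]
  have : 0 ≤ ε * k ^ 2 * (6 * m * s ^ 2) := by positivity
  linarith

theorem abs_layerD_le (hk : 0 ≤ k) (y : ℝ) :
    |layerD k a y| ≤ 3 * k * Real.exp (-k * (y + a)) := by
  have hm := max_one_sub_exp_mem k a y
  have hs := Real.exp_pos (-k * (y + a))
  rw [abs_of_nonpos (layerD_nonpos hk y)]
  unfold layerD
  set s := Real.exp (-k * (y + a))
  set m := max (1 - s) 0
  have : m ^ 2 ≤ 1 := pow_le_one₀ hm.1 hm.2
  have : m ^ 2 * (k * s) ≤ 1 * (k * s) := by gcongr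
  linarith

theorem abs_layerDD_le (y : ℝ) :
    |layerDD k a y| ≤ 9 * k ^ 2 * Real.exp (-k * (y + a)) := by
  have hm := max_one_sub_exp_mem k a y
  have hs := Real.exp_pos (-k * (y + a))
  unfold layerDD
  set s := Real.exp (-k * (y + a))
  rw [abs_mul, abs_of_nonneg (sq_nonneg k), show 9 * k ^ 2 * s = k ^ 2 * (9 * s) by ring]
  refine mul_le_mul_of_nonneg_left ?_ (sq_nonneg k)
  rcases le_total s 1 with h | h
  · have h2 : (max (1 - s) 0) ^ 2 ≤ 1 := pow_le_one₀ hm.1 hm.2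
    set m := max (1 - s) 0
    have h3 : m ^ 2 * s ≤ 1 * s := by gcongr
    have h4 : m * s ^ 2 ≤ 1 * (s * 1) := by
      rw [sq]; gcongr
      exact hm.2
    have h5 : 0 ≤ m ^ 2 * s := by positivity
    have h6 : 0 ≤ m * s ^ 2 := by have := hm.1; positivity
    rw [abs_le]; constructor <;> linarith
  · rw [max_eq_right (by linarith)]; simp; positivity

theorem integrableOn_exp_layer (hk : 0 < k) (a b : ℝ) :
    IntegrableOn (fun y => Real.exp (-k * (y + a))) (Ici b) := by
  rw [integrableOn_Ici_iff_integrableOn_Ioi]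
  have := (integrableOn_exp_mul_Ioi (a := -k) (by linarith) b).const_mul (Real.exp (-k * a))
  refine this.congr (Eventually.of_forall fun y => ?_)
  dsimp only
  rw [← Real.exp_add]; ring_nf

theorem integral_exp_layer (hk : 0 < k) (a b : ℝ) :
    ∫ y in Ici b, Real.exp (-k * (y + a)) = Real.exp (-k * (b + a)) / k := by
  rw [integral_Ici_eq_integral_Ioi]
  have h : ∀ y, Real.exp (-k * (y + a)) = Real.exp (-k * a) * Real.exp (-k * y) := fun y => by
    rw [← Real.exp_add]; ring_nf
  simp_rw [h]
  rw [integral_const_mul, integral_exp_mul_Ioi (by linarith)]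
  field_simp

end Layer

/-! ### Entropy estimate on each side of the shift -/

section HalfLine

variable {A η : ℝ → ℝ} {ε T : ℝ} {U₀ : ℝ → ℝ} {U : ℝ → ℝ → ℝ}

theorem integrable_comp_sign_mul {f : ℝ → ℝ} (hf : Integrable f) {σ : ℝ} (hσ : σ = 1 ∨ σ = -1) :
    Integrable fun y => f (σ * y) := by
  rcases hσ with rfl | rfl
  · simpa using hf
  · simpa using hf.comp_neg

theorem integral_comp_sign_mul (f : ℝ → ℝ) {σ : ℝ} (hσ : σ = 1 ∨ σ = -1) :
    ∫ y, f (σ * y) = ∫ y, f y := by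
  rcases hσ with rfl | rfl
  · simp
  · simpa using integral_neg_eq_self f volume

/-- There are three zones. For `σ y ≤ -a` the weight is constant. For `-a < σ y < -ε` the margin `c`
beats the diffusion of the weight. For `σ y ≥ -ε` nothing is known about the sign, but the
derivatives of the weight are exponentially small. The zone ends at `-ε` because `ε` is the radius
of the average that drives the shift. The sign `σ` reflects the right half-line onto the left one.
-/
theorem layer_rate_le {σ q h a k y c D H : ℝ} (hσ : σ = 1 ∨ σ = -1) (hε : 0 < ε) (hk : 0 < k)
    (hεk : ε * k = c) (hc1 : c ≤ 1) (hh : 0 ≤ h) (hH : h ≤ H) (hD : 0 ≤ D) (hq : |q| ≤ D * h)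
    (hgood : -a < σ * y → σ * y < -ε → c * h ≤ σ * q) :
    q * (σ * layerD k a (σ * y)) + ε * h * layerDD k a (σ * y) ≤
      (3 * D + 9) * H * k *
        (Ici (-ε)).indicator (fun z => Real.exp (-k * (z + a))) (σ * y) := by
  have hH0 : 0 ≤ H := hh.trans hH
  by_cases hy : σ * y ∈ Ici (-ε)
  · rw [indicator_of_mem hy]
    set s := Real.exp (-k * (σ * y + a))
    have hs : 0 < s := Real.exp_pos _
    have hσa : |σ| = 1 := by rcases hσ with rfl | rfl <;> norm_num
    have e1 : q * (σ * layerD k a (σ * y)) ≤ D * H * (3 * k * s) := by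
      refine (le_abs_self _).trans ?_
      rw [abs_mul, abs_mul, hσa, one_mul]
      refine mul_le_mul (hq.trans (by gcongr)) (abs_layerD_le hk.le _) (abs_nonneg _)
        (by positivity)
    have e2 : ε * h * layerDD k a (σ * y) ≤ H * (9 * k * s) := by
      have h1 : ε * layerDD k a (σ * y) ≤ 9 * k * s := by
        calc ε * layerDD k a (σ * y) ≤ ε * (9 * k ^ 2 * s) := by
              gcongr; exact (le_abs_self _).trans (abs_layerDD_le _)
          _ = (ε * k) * (9 * k * s) := by ring
          _ ≤ 1 * (9 * k * s) := by
              rw [hεk]; gcongr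
          _ = _ := one_mul _
      calc ε * h * layerDD k a (σ * y) = h * (ε * layerDD k a (σ * y)) := by ring
        _ ≤ h * (9 * k * s) := by gcongr
        _ ≤ H * (9 * k * s) := by gcongr
    linarith
  · rw [indicator_of_notMem hy, mul_zero]
    have hy' : σ * y < -ε := not_le.1 hy
    rcases le_or_gt (σ * y) (-a) with ha | ha
    · rw [layerD_eq_zero hk.le ha, layerDD_eq_zero hk.le ha]; simp
    · have h1 := hgood ha hy'
      have h2 := mul_layerDD_le (a := a) hε.le hεk (σ * y)
      have h3 := layerD_nonpos (a := a) hk.le (σ * y)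
      have h4 := mul_le_mul_of_nonneg_left h2 hh
      have h5 := mul_le_mul_of_nonpos_right h1 h3
      linarith

/-- The layer weight follows the shift and equals `1` on the region of interest. Its production is
nonpositive except in the exponential tail, whose factor `k` is cancelled by the `1/k` from
integrating the exponential, so the error stays uniform in `ε`. -/
theorem lintegral_half_line_le (hA : ContDiff ℝ 2 A) (hη : ContDiff ℝ 2 η)
    (hηc : ∀ x, 0 < deriv (deriv η) x) (hU : IsViscousSolution A ε T U₀ U)
    (hε : 0 < ε) (hε1 : ε ≤ 1)
    (hm : AEStronglyMeasurable U₀ volume) {B : ℝ} (hB : ∀ t ∈ Ioo 0 T, ∀ x, |U t x| ≤ B)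
    (hB0 : ∀ᵐ x, |U₀ x| ≤ B) {C : ℝ} (hC : C ∈ Icc (-B) B) {D : ℝ}
    (hD : ∀ u ∈ Icc (-B) B, |deriv A u| ≤ D) {H : ℝ}
    (hH : ∀ u ∈ Icc (-B) B, relEntropy η u C ≤ H)
    {X X1 : ℝ → ℝ} (hX : ∀ t ∈ Ioo 0 T, HasDerivAt X (X1 t) t) {V : ℝ} (hV0 : 0 ≤ V)
    (hV : ∀ t ∈ Ioo 0 T, |X1 t| ≤ V) (hXlim : Tendsto X (𝓝[>] 0) (𝓝 0))
    {σ : ℝ} (hσ : σ = 1 ∨ σ = -1) {c α : ℝ} (hc : 0 < c) (hc1 : c ≤ 1)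
    (hgood : ∀ t ∈ Ioo 0 T, ∀ x, -(α / c) < σ * (x - X t) → σ * (x - X t) < -ε →
      c * relEntropy η (U t x) C ≤
        σ * (relFlux A η (U t x) C - X1 t * relEntropy η (U t x) C))
    (hinit : IntegrableOn (fun x => relEntropy η (U₀ x) C) {x | σ * x < 0})
    {t : ℝ} (ht : t ∈ Ioo 0 T) :
    ∫⁻ x in {x | σ * (x - X t) ≤ -(α / c)}, ENNReal.ofReal (relEntropy η (U t x) C) ≤
      ENNReal.ofReal ((∫ x in {x | σ * x < 0}, relEntropy η (U₀ x) C)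
        + (3 * H / c + (3 * (D + V) + 9) * H * Real.exp c * t) * Real.exp (-α / ε)) := by
  set h : ℝ → ℝ := fun u => relEntropy η u C
  -- Rate and position are tuned so that `ε k = c`, the dissipation margin, and `k a = α / ε`, the
  -- exponent of the error.
  set k := c / ε with hk
  set a := α / c
  have hk0 : 0 < k := by positivity
  have hεk : ε * k = c := by rw [hk]; field_simp
  have hh0 : ∀ u, 0 ≤ h u := fun u => relEntropy_nonneg hη hηc u C
  have hH0 : 0 ≤ H := (hh0 C).trans (hH C hC)
  have hD0 : 0 ≤ D := (abs_nonneg _).trans (hD C hC)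
  have hσ2 : σ * σ = 1 := by rcases hσ with rfl | rfl <;> norm_num
  have hhd : ∀ u, HasDerivAt h (deriv η u - deriv η C) u := hasDerivAt_relEntropy_left hη C
  have hhc : Continuous h := continuous_iff_continuousAt.2 fun u => (hhd u).continuousAt
  have hh1c : Continuous fun u => deriv η u - deriv η C :=
    (hη.continuous_deriv (by norm_num)).sub continuous_const
  have hlin : ∀ y : ℝ, HasDerivAt (fun y => σ * y) σ y := fun y =>
    ((hasDerivAt_id y).const_mul σ).congr_deriv (mul_one σ)
  have hφ : ∀ y, HasDerivAt (fun y => layer k a (σ * y)) (σ * layerD k a (σ * y)) y := fun y =>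
    ((hasDerivAt_layer k a (σ * y)).comp y (hlin y)).congr_deriv (mul_comm _ _)
  have hφ1 : ∀ y, HasDerivAt (fun y => σ * layerD k a (σ * y)) (layerDD k a (σ * y)) y := fun y =>
    (((hasDerivAt_layerD k a (σ * y)).comp y (hlin y)).const_mul σ).congr_deriv (by
      linear_combination layerDD k a (σ * y) * hσ2)
  set e0 : ℝ → ℝ := (Ici (-ε)).indicator fun z => Real.exp (-k * (z + a)) with he0
  have he0i : Integrable e0 :=
    (integrable_indicator_iff measurableSet_Ici).2 (integrableOn_exp_layer hk0 a (-ε))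
  have he0n : ∀ y, 0 ≤ e0 y := fun y => indicator_nonneg (fun _ _ => (Real.exp_pos _).le) y
  have hka : k * a = α / ε := by simp only [hk, a]; field_simp
  have he0I : ∫ y, e0 y = Real.exp c * Real.exp (-α / ε) / k := by
    rw [he0, integral_indicator measurableSet_Ici, integral_exp_layer hk0, ← Real.exp_add]
    congr 2
    have : k * (-ε + a) = -c + α / ε := by rw [mul_add, hka]; linarith
    rw [neg_mul, this]; ring
  have hflux : ∀ u ∈ Icc (-B) B, |relFlux A η u C| ≤ D * h u := fun u hu =>
    abs_integral_mul_deriv_le hhd hh1c (relEntropy_self C)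
      (fun u => by
        rcases le_total C u with huC | huC
        · exact mul_nonneg (sub_nonneg.2 huC)
            (sub_nonneg.2 ((strictMono_deriv_of_pos hηc).monotone huC))
        · exact mul_nonneg_of_nonpos_of_nonpos (sub_nonpos.2 huC)
            (sub_nonpos.2 ((strictMono_deriv_of_pos hηc).monotone huC))) hD hC hu
  set E := (3 * (D + V) + 9) * H * k
  have hE0 : 0 ≤ E := by positivity
  set e1 : ℝ → ℝ := (Ici 0).indicator fun z => Real.exp (-k * (z + a)) with he1
  have he1i : Integrable e1 :=
    (integrable_indicator_iff measurableSet_Ici).2 (integrableOn_exp_layer hk0 a 0)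
  have he1I : ∫ y, e1 y = Real.exp (-α / ε) / k := by
    rw [he1, integral_indicator measurableSet_Ici, integral_exp_layer hk0, zero_add, neg_mul, hka,
      neg_div]
  have hmeas : MeasurableSet {x : ℝ | σ * x < 0} := measurableSet_lt (by fun_prop) (by fun_prop)
  -- Beyond the origin `h(U₀)` is merely bounded, since `C` is the wrong end state there; the
  -- exponential tail of the weight makes that part integrable and supplies the second term.
  set I0 := (∫ x in {x | σ * x < 0}, h (U₀ x)) + 3 * H * (Real.exp (-α / ε) / k)
  have hI0 : 0 ≤ I0 := add_nonneg (integral_nonneg fun x => hh0 _) (by positivity)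
  have hinit' : ∀ n : ℝ, 1 ≤ n →
      ∫ x, h (U₀ x) * (layer k a (σ * x) * cutoff (n ^ 2) x) ≤ I0 := by
    intro n hn
    have hbd : Integrable fun x => ({x : ℝ | σ * x < 0}.indicator (fun x => h (U₀ x)) x
        + 3 * H * e1 (σ * x)) :=
      ((integrable_indicator_iff hmeas).2 hinit).add
        ((integrable_comp_sign_mul he1i hσ).const_mul _)
    refine (integral_mono_of_nonneg (Eventually.of_forall fun x =>
      mul_nonneg (hh0 _) (mul_nonneg (layer_nonneg _ _ _) (cutoff_nonneg _ _))) hbd ?_).trans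
      (le_of_eq ?_)
    · filter_upwards [hB0] with x hx
      have hc0 := cutoff_nonneg (n ^ 2) x
      have hc1 := cutoff_le_one (n ^ 2) x
      have hl0 := layer_nonneg k a (σ * x)
      have hh := hh0 (U₀ x)
      by_cases hxs : σ * x < 0
      · rw [indicator_of_mem (show x ∈ {x : ℝ | σ * x < 0} from hxs)]
        have : e1 (σ * x) = 0 := indicator_of_notMem (by simpa using hxs) _
        rw [this, mul_zero, add_zero]
        have : layer k a (σ * x) * cutoff (n ^ 2) x ≤ 1 :=
          mul_le_one₀ (layer_le_one _ _ _) hc0 hc1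
        calc _ ≤ h (U₀ x) * 1 := by gcongr
          _ = _ := mul_one _
      · rw [indicator_of_notMem (show x ∉ {x : ℝ | σ * x < 0} from hxs), zero_add]
        have : e1 (σ * x) = Real.exp (-k * (σ * x + a)) :=
          indicator_of_mem (by simpa using not_lt.1 hxs) _
        rw [this]
        calc h (U₀ x) * (layer k a (σ * x) * cutoff (n ^ 2) x)
            ≤ H * (3 * Real.exp (-k * (σ * x + a)) * 1) := by
              gcongr
              · exact hH _ (abs_le.1 hx)
              · exact layer_le k a (σ * x)
          _ = _ := by ring
    · rw [integral_add ((integrable_indicator_iff hmeas).2 hinit)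
        ((integrable_comp_sign_mul he1i hσ).const_mul _), integral_indicator hmeas,
        integral_const_mul, integral_comp_sign_mul e1 hσ, he1I]
  have key := lintegral_mul_weight_le hA hU hε hε1 hm hB hB0 hhd
    (fun u => (hη.hasDerivAt_deriv_of_two u).sub_const _) hη.continuous_deriv_deriv
    (hasDerivAt_relFlux_left hA hη C) hh0 (fun u => (hηc u).le) hD0 hflux hφ hφ1
    ((continuous_layerDD k a).comp (continuous_const.mul continuous_id))
    (fun y => layer_nonneg _ _ _) (fun y => layer_le_one _ _ _)
    (fun y => by
      rw [abs_mul, show |σ| = 1 by rcases hσ with rfl | rfl <;> norm_num, one_mul]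
      exact mul_abs_layerD_le hk0.le (hεk.le.trans hc1) _)
    hX hV0 hV hXlim (Err := fun y => E * e0 (σ * y))
    ((integrable_comp_sign_mul he0i hσ).const_mul E) (fun y => mul_nonneg hE0 (he0n _))
    (fun s hs x => by
      have hu := abs_le.1 (hB s hs x)
      refine layer_rate_le hσ hε hk0 hεk hc1 (hh0 _) (hH _ hu) (by positivity) ?_
        (hgood s hs x)
      refine (abs_sub _ _).trans ?_
      rw [abs_mul, abs_of_nonneg (hh0 (U s x))]
      have h1 := hflux _ hu
      have h2 := mul_le_mul_of_nonneg_right (hV s hs) (hh0 (U s x))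
      linarith) hI0 hinit' ht
  have hset : MeasurableSet {x : ℝ | σ * (x - X t) ≤ -a} :=
    measurableSet_le (by fun_prop) (by fun_prop)
  calc ∫⁻ x in {x | σ * (x - X t) ≤ -a}, ENNReal.ofReal (h (U t x))
      = ∫⁻ x in {x | σ * (x - X t) ≤ -a},
          ENNReal.ofReal (h (U t x) * layer k a (σ * (x - X t))) := by
        refine setLIntegral_congr_fun hset fun x hx => ?_
        rw [layer_eq_one hk0.le hx, mul_one]
    _ ≤ ∫⁻ x, ENNReal.ofReal (h (U t x) * layer k a (σ * (x - X t))) := setLIntegral_le_lintegral _ _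
    _ ≤ _ := key
    _ ≤ _ := by
        refine ENNReal.ofReal_le_ofReal ?_
        rw [integral_const_mul, integral_comp_sign_mul e0 hσ, he0I]
        have e1 : E * (Real.exp c * Real.exp (-α / ε) / k) * t =
            (3 * (D + V) + 9) * H * Real.exp c * t * Real.exp (-α / ε) := by
          simp only [E]; field_simp
        have e2 : 3 * H * (Real.exp (-α / ε) / k) ≤ 3 * H / c * Real.exp (-α / ε) := by
          have : Real.exp (-α / ε) / k = Real.exp (-α / ε) / c * ε := by
            rw [hk]; field_simp
          rw [this]
          calc 3 * H * (Real.exp (-α / ε) / c * ε) ≤ 3 * H * (Real.exp (-α / ε) / c * 1) := by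
                gcongr
            _ = _ := by ring
        simp only [I0]
        linarith

end HalfLine

/-! ### Relative entropy estimate away from the layer -/

section ShiftEstimate

theorem exists_mem_uIcc_hasDerivAt_eq {f f' : ℝ → ℝ} (hf : ∀ x, HasDerivAt f (f' x) x) (a b : ℝ) :
    ∃ ξ ∈ uIcc a b, f b - f a = f' ξ * (b - a) := by
  have key : ∀ a b, a < b → ∃ ξ ∈ uIcc a b, f b - f a = f' ξ * (b - a) := by
    intro a b hab
    obtain ⟨ξ, hξ, he⟩ := exists_hasDerivAt_eq_slope f f' hab
      (fun x _ => (hf x).continuousAt.continuousWithinAt) (fun x _ => hf x)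
    refine ⟨ξ, Icc_subset_uIcc (Ioo_subset_Icc_self hξ), ?_⟩
    rw [he, div_mul_cancel₀ _ (by linarith)]
  rcases lt_trichotomy a b with h | rfl | h
  · exact key a b h
  · exact ⟨a, by simp, by simp⟩
  · obtain ⟨ξ, hξ, he⟩ := key b a h
    exact ⟨ξ, by rwa [uIcc_comm], by linarith⟩

variable {A η : ℝ → ℝ}

/-- On bounded sets the relative entropy is comparable to the squared distance. -/
theorem exists_relEntropy_bounds (hη : ContDiff ℝ 2 η) (hηc : ∀ x, 0 < deriv (deriv η) x)
    (B : ℝ) : ∃ lo hi : ℝ, 0 < lo ∧ 0 < hi ∧ ∀ u ∈ Icc (-B) B, ∀ C ∈ Icc (-B) B,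
      lo * (u - C) ^ 2 ≤ relEntropy η u C ∧ relEntropy η u C ≤ hi * (u - C) ^ 2 := by
  rcases (Icc (-B) B).eq_empty_or_nonempty with he | hne
  · exact ⟨1, 1, one_pos, one_pos, by simp [he]⟩
  obtain ⟨p, hp, hmin⟩ := isCompact_Icc.exists_isMinOn hne hη.continuous_deriv_deriv.continuousOn
  obtain ⟨q, hq, hmax⟩ := isCompact_Icc.exists_isMaxOn hne hη.continuous_deriv_deriv.continuousOn
  refine ⟨deriv (deriv η) p / 2, deriv (deriv η) q, half_pos (hηc p), hηc q, fun u hu C hC => ?_⟩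
  have hsub : ∀ w ∈ Icc (-B) B, uIcc C w ⊆ Icc (-B) B := fun w hw => uIcc_subset_Icc hC hw
  have hsign : ∀ w, ∀ ξ ∈ uIcc C w, 0 ≤ (ξ - C) * (w - C) ∧ (ξ - C) * (w - C) ≤ (w - C) ^ 2 := by
    intro w ξ hξ
    rcases mem_uIcc.1 hξ with h | h <;> constructor <;> nlinarith [h.1, h.2]
  constructor
  · set l := deriv (deriv η) p
    obtain ⟨ξ, hξ, e1⟩ := exists_mem_uIcc_hasDerivAt_eq
      (f := fun u => relEntropy η u C - l / 2 * (u - C) ^ 2)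
      (f' := fun u => (deriv η u - deriv η C) - l * (u - C))
      (fun w => ((hasDerivAt_relEntropy_left hη C w).sub
        ((((hasDerivAt_id w).sub_const C).pow 2).const_mul (l / 2))).congr_deriv (by
          simp only [id, Nat.cast_ofNat]; ring)) C u
    obtain ⟨ζ, hζ, e2⟩ := exists_mem_uIcc_hasDerivAt_eq
      (fun w => hη.hasDerivAt_deriv_of_two w) C ξ
    have h1 : l ≤ deriv (deriv η) ζ := hmin (hsub _ (hsub _ hu hξ) hζ)
    simp only [relEntropy_self, sub_self, e2] at e1
    have h2 := mul_nonneg (sub_nonneg.2 h1) (hsign u ξ hξ).1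
    nlinarith
  · obtain ⟨ξ, hξ, e1⟩ := exists_mem_uIcc_hasDerivAt_eq (hasDerivAt_relEntropy_left hη C) C u
    obtain ⟨ζ, hζ, e2⟩ := exists_mem_uIcc_hasDerivAt_eq
      (fun w => hη.hasDerivAt_deriv_of_two w) C ξ
    have h1 : deriv (deriv η) ζ ≤ deriv (deriv η) q := hmax (hsub _ (hsub _ hu hξ) hζ)
    simp only [relEntropy_self, sub_zero, e2] at e1
    have h2 := hsign u ξ hξ
    have h3 := mul_le_mul h1 h2.2 h2.1 (hηc q).le
    rw [e1]; linarith

theorem measurable_shockProfile (CL CR : ℝ) : Measurable (shockProfile CL CR) :=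
  Measurable.ite measurableSet_Iio measurable_const measurable_const

theorem shockProfile_mem {CL CR : ℝ} {s : Set ℝ} (hL : CL ∈ s) (hR : CR ∈ s) (x : ℝ) :
    shockProfile CL CR x ∈ s := by
  unfold shockProfile; split_ifs <;> assumption

theorem continuous_relEntropy (hη : ContDiff ℝ 2 η) :
    Continuous fun p : ℝ × ℝ => relEntropy η p.1 p.2 := by
  have c0 := hη.continuous
  have c1 := hη.continuous_deriv (by norm_num)
  unfold relEntropy
  fun_prop

theorem integrable_relEntropy_shockProfile (hη : ContDiff ℝ 2 η)
    (hηc : ∀ x, 0 < deriv (deriv η) x) {B CL CR : ℝ} (hCL : CL ∈ Icc (-B) B)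
    (hCR : CR ∈ Icc (-B) B) {U₀ : ℝ → ℝ} (hm : AEStronglyMeasurable U₀ volume)
    (hB0 : ∀ᵐ x, |U₀ x| ≤ B) (h2 : MemLp (fun x => U₀ x - shockProfile CL CR x) 2 volume) :
    Integrable fun x => relEntropy η (U₀ x) (shockProfile CL CR x) := by
  obtain ⟨lo, hi, hlo, hhi, hb⟩ := exists_relEntropy_bounds hη hηc B
  refine (h2.integrable_sq.const_mul hi).mono' ?_ ?_
  · exact (continuous_relEntropy hη).comp_aestronglyMeasurable
      (hm.prodMk (measurable_shockProfile CL CR).aestronglyMeasurable)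
  · filter_upwards [hB0] with x hx
    rw [Real.norm_eq_abs, abs_of_nonneg (relEntropy_nonneg hη hηc _ _)]
    exact (hb _ (abs_le.1 hx) _ (shockProfile_mem hCL hCR x)).2

theorem integral_relEntropy_shockProfile {CL CR : ℝ} {U₀ : ℝ → ℝ}
    (hi : Integrable fun x => relEntropy η (U₀ x) (shockProfile CL CR x)) :
    IntegrableOn (fun x => relEntropy η (U₀ x) CL) {x | 1 * x < 0} ∧
    IntegrableOn (fun x => relEntropy η (U₀ x) CR) {x | -1 * x < 0} ∧
    ∫ x, relEntropy η (U₀ x) (shockProfile CL CR x) =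
      (∫ x in {x | 1 * x < 0}, relEntropy η (U₀ x) CL) +
        ∫ x in {x | -1 * x < 0}, relEntropy η (U₀ x) CR := by
  have s1 : {x : ℝ | 1 * x < 0} = Iio 0 := by ext x; simp
  have s2 : {x : ℝ | -1 * x < 0} = Ioi 0 := by ext x; simp
  rw [s1, s2]
  have e1 : EqOn (fun x => relEntropy η (U₀ x) (shockProfile CL CR x))
      (fun x => relEntropy η (U₀ x) CL) (Iio 0) := fun x hx => by
    simp only [shockProfile, if_pos (mem_Iio.1 hx)]
  have e2 : EqOn (fun x => relEntropy η (U₀ x) (shockProfile CL CR x))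
      (fun x => relEntropy η (U₀ x) CR) (Ioi 0) := fun x hx => by
    simp only [shockProfile, if_neg (not_lt.2 (mem_Ioi.1 hx).le)]
  refine ⟨hi.integrableOn.congr_fun e1 measurableSet_Iio,
    hi.integrableOn.congr_fun e2 measurableSet_Ioi, ?_⟩
  rw [← setIntegral_congr_fun measurableSet_Iio e1, ← setIntegral_congr_fun measurableSet_Ioi e2,
    ← integral_Ici_eq_integral_Ioi, ← compl_Iio]
  exact (integral_add_compl measurableSet_Iio hi).symm

/-- Away from a layer of width comparable to `α`, the shifted relative entropy is controlled by
its initial value up to an exponentially small error. -/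
theorem exists_shift_lintegral_le (hA : ContDiff ℝ 2 A) (hAconv : StrictConvexOn ℝ univ A)
    (hη : ContDiff ℝ 2 η) (hηc : ∀ x, 0 < deriv (deriv η) x) {CL CR : ℝ} (hC : CR < CL)
    {B : ℝ} (hCL : CL ∈ Icc (-B) B) (hCR : CR ∈ Icc (-B) B) (K : ℝ≥0) :
    ∃ ε₀ c V P : ℝ, 0 < ε₀ ∧ ε₀ ≤ Real.exp (-1) ∧ 0 < c ∧ 0 ≤ V ∧ 0 ≤ P ∧
      ∀ T : ℝ, 0 < T → ∀ U₀ : ℝ → ℝ, AEStronglyMeasurable U₀ volume → (∀ᵐ x, |U₀ x| ≤ B) →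
      LocallyIntegrable U₀ volume →
      MemLp (fun x => U₀ x - shockProfile CL CR x) 2 volume →
      ∀ g : ℝ → ℝ, HasDerivPosPart U₀ g → MemLp g 2 volume → eLpNorm g 2 volume ≤ (K : ℝ≥0∞) →
      ∀ ε : ℝ, 0 < ε → ε ≤ ε₀ → ∀ U : ℝ → ℝ → ℝ, IsViscousSolution A ε T U₀ U →
      ∃ X X1 : ℝ → ℝ, X 0 = 0 ∧ LipschitzOnWith V.toNNReal X (Icc 0 T) ∧
        (∀ t ∈ Ioo 0 T, HasDerivAt X (X1 t) t) ∧ (∀ t ∈ Ioo 0 T, |X1 t| ≤ V) ∧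
        Tendsto X (𝓝[>] 0) (𝓝 0) ∧
        ∀ t ∈ Ioo 0 T, ∀ α : ℝ, ε ≤ α → α ≤ ε₀ →
          ∫⁻ x in {x | α / c ≤ |x - X t|},
              ENNReal.ofReal (relEntropy η (U t x) (shockProfile CL CR (x - X t))) ≤
            ENNReal.ofReal ((∫ x, relEntropy η (U₀ x) (shockProfile CL CR x))
              + P * (1 + t) * Real.exp (-α / ε)) := by
  have hBnn : 0 ≤ B := by linarith [hCL.1, hCL.2]
  obtain ⟨b, Lb, V, c, κ, hLb, hV0, hV, hc, hc1, hκ, hdiss⟩ :=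
    exists_dissipative_speed hA hAconv hη hηc hC hBnn
  obtain ⟨lo, hi, hlo, hhi, hb⟩ := exists_relEntropy_bounds hη hηc B
  obtain ⟨D, hD⟩ := (isCompact_Icc (a := -B) (b := B)).exists_bound_of_continuousOn
    (hA.continuous_deriv (by norm_num)).continuousOn
  have hD0 : 0 ≤ D := (norm_nonneg _).trans (hD CL hCL)
  -- Half of the tolerance `κ` goes to the constant `K² / (4 N)` of the modulus, the other half to
  -- its slope over the distance `r`, where `N r = κ / 2`.
  set N : ℝ := (K : ℝ) ^ 2 / (2 * κ) + 1
  have hN : 0 < N := by positivity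
  have hNκ : (K : ℝ) ^ 2 / (4 * N) ≤ κ / 2 := by
    rw [div_le_iff₀ (by positivity)]
    have : κ / 2 * (4 * N) = (K : ℝ) ^ 2 + 2 * κ := by simp only [N]; field_simp; ring
    linarith
  set H : ℝ := hi * (2 * B) ^ 2
  have hH : ∀ C ∈ Icc (-B) B, ∀ u ∈ Icc (-B) B, relEntropy η u C ≤ H := by
    intro C hC u hu
    refine (hb u hu C hC).2.trans ?_
    have : |u - C| ≤ 2 * B := abs_le.2 ⟨by linarith [hu.1, hC.2], by linarith [hu.2, hC.1]⟩
    have := sq_le_sq' (by linarith [(abs_le.1 this).1]) (abs_le.1 this).2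
    exact mul_le_mul_of_nonneg_left this hhi.le
  have hH0 : 0 ≤ H := by positivity
  set r : ℝ := κ / (2 * N)
  have hr : 0 < r := by positivity
  have hNr : N * r = κ / 2 := by simp only [r]; field_simp
  set P1 : ℝ := 3 * H / c + (3 * (D + V) + 9) * H * Real.exp c
  have hP1 : 0 ≤ P1 := by positivity
  -- A point of the layer zone and a point of the averaging window are at most `α / c + ε` apart, so
  -- the modulus must be effective up to that distance. The cap `exp (-1)` ensures `ε ≤ 1` and later
  -- `log (1/ε) ≥ 1`.
  have hεr : ∀ ε α : ℝ, ε ≤ α → α ≤ min (r / (1 / c + 1)) (Real.exp (-1)) → α / c + ε ≤ r := by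
    intro ε α h1 h2
    have := h2.trans (min_le_left _ _)
    rw [le_div_iff₀ (by positivity)] at this
    have e : α * (1 / c + 1) = α / c + α := by ring
    linarith
  refine ⟨min (r / (1 / c + 1)) (Real.exp (-1)), c, V, 2 * P1, lt_min (by positivity)
    (Real.exp_pos _), min_le_right _ _, hc, hV0, by positivity, ?_⟩
  intro T hT U₀ hm hB0 hloc h2 g hg hg2 hgK ε hε hεε₀ U hU
  have hε1 : ε ≤ 1 := (hεε₀.trans (min_le_right _ _)).trans (by
    rw [Real.exp_le_one_iff]; norm_num)
  have hB : ∀ t ∈ Ioo 0 T, ∀ x, |U t x| ≤ B := fun t ht x =>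
    hU.abs_le hA hε hε1 hm hBnn hB0 ht x
  obtain ⟨X, hX0, hXL, hX⟩ := exists_shift hA hU hε hT hBnn hB hε hLb hV0 hV
  have hXlim : Tendsto X (𝓝[>] 0) (𝓝 0) := by
    have h1 := hXL.continuousOn 0 (by simp [hT.le])
    unfold ContinuousWithinAt at h1
    rw [hX0] at h1
    exact h1.mono_left (nhdsWithin_le_of_mem (mem_of_superset (Ioo_mem_nhdsGT hT)
      Ioo_subset_Icc_self))
  have hmono : Monotone (deriv A) :=
    monotoneOn_univ.1 <|
      hAconv.convexOn.monotoneOn_deriv fun x _ => hA.differentiable (by norm_num) x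
  have hosl := ae_prod_sub_le hloc hg hg2 hgK hN
  have hUosl : ∀ t ∈ Ioo 0 T, ∀ x y, x < y → y - x ≤ r → U t y ≤ U t x + κ := by
    intro t ht x y hxy hyx
    have h1 := IsViscousSolution.sub_le_of_initial hA hmono hU hε hm hB hB0 hN.le (by positivity)
      hosl ht hxy
    have h2 := mul_le_mul_of_nonneg_left hyx hN.le
    linarith
  have hmean : ∀ t ∈ Ioo 0 T, ∀ x, localMean ε (U t) x ∈ Icc (-B) B := fun t ht x =>
    ⟨le_localMean hε (hU.continuous_space ht) fun z _ => (abs_le.1 (hB t ht z)).1,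
      localMean_le hε (hU.continuous_space ht) fun z _ => (abs_le.1 (hB t ht z)).2⟩
  have hintg := integrable_relEntropy_shockProfile hη hηc hCL hCR hm hB0 h2
  obtain ⟨iL, iR, hE⟩ := integral_relEntropy_shockProfile hintg
  refine ⟨X, _, hX0, hXL, hX, fun t _ => hV _, hXlim, fun t ht α hεα hα => ?_⟩
  have hr' := hεr ε α hεα hα
  have hαc : 0 < α / c := div_pos (hε.trans_le hεα) hc
  have left := lintegral_half_line_le hA hη hηc hU hε hε1 hm hB hB0 hCL hD (hH CL hCL) hX hV0
    (fun t _ => hV _) hXlim (σ := 1) (Or.inl rfl) (α := α) hc hc1 (fun s hs x hx1 hx2 => by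
      -- Since `x - X s < -ε`, the point `x` lies to the left of the whole averaging window, so the
      -- one-sided modulus bounds every averaged value by `U s x + κ`. On the right side the order
      -- is reversed.
      rw [one_mul] at hx1 hx2 ⊢
      refine (hdiss _ (abs_le.1 (hB s hs x)) _ (hmean s hs _)).1 ?_
      rw [sub_le_iff_le_add]
      refine localMean_le hε (hU.continuous_space hs) fun z hz => ?_
      rw [abs_lt] at hz
      exact hUosl s hs x z (by linarith) (by linarith)) iL ht
  have right := lintegral_half_line_le hA hη hηc hU hε hε1 hm hB hB0 hCR hD (hH CR hCR) hX hV0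
    (fun t _ => hV _) hXlim (σ := -1) (Or.inr rfl) (α := α) hc hc1 (fun s hs x hx1 hx2 => by
      have := (hdiss _ (abs_le.1 (hB s hs x)) _ (hmean s hs (X s))).2 (by
        rw [← sub_le_iff_le_add]
        refine le_localMean hε (hU.continuous_space hs) fun z hz => ?_
        rw [abs_lt] at hz
        rw [sub_le_iff_le_add]
        exact hUosl s hs z x (by linarith) (by linarith))
      linarith) iR ht
  have hsub : {x | α / c ≤ |x - X t|} ⊆
      {x | 1 * (x - X t) ≤ -(α / c)} ∪ {x | -1 * (x - X t) ≤ -(α / c)} := by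
    intro x hx
    rcases le_abs.1 (show α / c ≤ |x - X t| from hx) with h | h
    · right; show -1 * (x - X t) ≤ _; linarith
    · left; show 1 * (x - X t) ≤ _; linarith
  refine (lintegral_mono_set hsub).trans ((lintegral_union_le _ _ _).trans ?_)
  have m1 : MeasurableSet {x | 1 * (x - X t) ≤ -(α / c)} :=
    measurableSet_le (by fun_prop) measurable_const
  have m2 : MeasurableSet {x | -1 * (x - X t) ≤ -(α / c)} :=
    measurableSet_le (by fun_prop) measurable_const
  rw [setLIntegral_congr_fun m1 (g := fun x => ENNReal.ofReal (relEntropy η (U t x) CL))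
    (fun x (hx : 1 * (x - X t) ≤ -(α / c)) => by
      simp only [shockProfile, if_pos (show x - X t < 0 by linarith)]),
    setLIntegral_congr_fun m2 (g := fun x => ENNReal.ofReal (relEntropy η (U t x) CR))
    (fun x (hx : -1 * (x - X t) ≤ -(α / c)) => by
      simp only [shockProfile, if_neg (show ¬ x - X t < 0 by linarith)])]
  refine (add_le_add left right).trans ?_
  have ht0 := ht.1.le
  rw [← ENNReal.ofReal_add]
  · refine ENNReal.ofReal_le_ofReal ?_
    rw [hE]
    have : 3 * H / c + (3 * (D + V) + 9) * H * Real.exp c * t ≤ P1 * (1 + t) := by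
      have h1 : 0 ≤ 3 * H / c * t := by positivity
      have h2 : 0 ≤ (3 * (D + V) + 9) * H * Real.exp c := by positivity
      simp only [P1]; nlinarith
    have := mul_le_mul_of_nonneg_right this (Real.exp_pos (-α / ε)).le
    linarith
  · exact add_nonneg (integral_nonneg fun x => relEntropy_nonneg hη hηc _ _) (by positivity)
  · exact add_nonneg (integral_nonneg fun x => relEntropy_nonneg hη hηc _ _) (by positivity)

end ShiftEstimate

/-! ### The drift of the shift -/

section Drift

/-- The fundamental theorem of calculus on each half-line. For the cutoff itself the value at the
jump is `1`, and for its derivative it is `0`, so the viscous term gives the exact shock no drift.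
-/
theorem integral_shockProfile_mul_deriv {w w1 : ℝ → ℝ} (hw : ∀ y, HasDerivAt w (w1 y) y)
    (hw1 : Continuous w1) {R : ℝ} (hw0 : ∀ y, R ≤ |y| → w y = 0)
    (hw10 : ∀ y, R ≤ |y| → w1 y = 0) (G : ℝ → ℝ) (CL CR a : ℝ) :
    (Integrable fun x => G (shockProfile CL CR (x - a)) * w1 (x - a)) ∧
    ∫ x, G (shockProfile CL CR (x - a)) * w1 (x - a) = (G CL - G CR) * w 0 := by
  have hi : Integrable w1 := hw1.integrable_of_hasCompactSupport (hasCompactSupport_of_eq_zero hw10)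
  have e1 : EqOn (fun x => G (shockProfile CL CR x) * w1 x) (fun x => G CL * w1 x) (Iio 0) :=
    fun x hx => by simp only [shockProfile, if_pos (mem_Iio.1 hx)]
  have e2 : EqOn (fun x => G (shockProfile CL CR x) * w1 x) (fun x => G CR * w1 x) (Iio 0)ᶜ :=
    fun x hx => by
      rw [compl_Iio] at hx
      simp only [shockProfile, if_neg (not_lt.2 (mem_Ici.1 hx))]
  have i : Integrable fun x => G (shockProfile CL CR x) * w1 x := by
    rw [← integrableOn_univ, ← union_compl_self (Iio (0 : ℝ))]
    exact ((hi.const_mul (G CL)).integrableOn.congr_fun e1.symm measurableSet_Iio).union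
      ((hi.const_mul (G CR)).integrableOn.congr_fun e2.symm measurableSet_Iio.compl)
  refine ⟨i.comp_sub_right a, ?_⟩
  rw [integral_sub_right_eq_self (fun x => G (shockProfile CL CR x) * w1 x) a,
    ← integral_add_compl measurableSet_Iio i, setIntegral_congr_fun measurableSet_Iio e1,
    setIntegral_congr_fun measurableSet_Iio.compl e2, integral_const_mul, integral_const_mul,
    compl_Iio, integral_Ici_eq_integral_Ioi, ← integral_Iic_eq_integral_Iio]
  have l1 : Tendsto w atBot (𝓝 0) := tendsto_const_nhds.congr' (by
    filter_upwards [eventually_le_atBot (-R)] with y hy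
    exact (hw0 y (by have := neg_abs_le y; linarith)).symm)
  have l2 : Tendsto w atTop (𝓝 0) := tendsto_const_nhds.congr' (by
    filter_upwards [eventually_ge_atTop R] with y hy
    exact (hw0 y (hy.trans (le_abs_self y))).symm)
  rw [integral_Iic_of_hasDerivAt_of_tendsto' (fun x _ => hw x) hi.integrableOn l1,
    integral_Ioi_of_hasDerivAt_of_tendsto' (fun x _ => hw x) hi.integrableOn l2]
  ring

theorem abs_integral_le_mul_setIntegral {f d : ℝ → ℝ} {a R k : ℝ}
    (hd : IntegrableOn d {x | |x - a| ≤ R}) (hfd : ∀ᵐ x, |f x| ≤ k * |d x|)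
    (h0 : ∀ x, R ≤ |x - a| → f x = 0) :
    |∫ x, f x| ≤ k * ∫ x in {x | |x - a| ≤ R}, |d x| := by
  rw [← setIntegral_eq_integral_of_forall_compl_eq_zero (s := {x | |x - a| ≤ R})
    (fun x hx => h0 x (not_le.1 hx).le), ← integral_const_mul]
  exact norm_integral_le_of_norm_le (f := f) (hd.abs.const_mul k) (ae_restrict_of_ae hfd)

theorem setOf_abs_sub_le (a R : ℝ) : {x : ℝ | |x - a| ≤ R} = Icc (a - R) (a + R) := by
  ext x
  rw [mem_ofPred_eq, abs_le, mem_Icc]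
  constructor <;> rintro ⟨h1, h2⟩ <;> constructor <;> linarith

variable {A : ℝ → ℝ} {ε T : ℝ} {U₀ : ℝ → ℝ} {U : ℝ → ℝ → ℝ}

/-- The distance of the shift to the straight shock line is controlled by the `L¹` distance of the
solution to the shifted shock on a window of width `R` around the shift. -/
theorem abs_shift_sub_le (hA : ContDiff ℝ 2 A) (hU : IsViscousSolution A ε T U₀ U) (hε : 0 < ε)
    (hT : 0 < T) (hm : AEStronglyMeasurable U₀ volume) {B : ℝ}
    (hB : ∀ t ∈ Ioo 0 T, ∀ x, |U t x| ≤ B) (hB0 : ∀ᵐ x, |U₀ x| ≤ B) {CL CR : ℝ} (hC : CR < CL)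
    (hCL : CL ∈ Icc (-B) B) (hCR : CR ∈ Icc (-B) B) {D : ℝ}
    (hD : ∀ u ∈ Icc (-B) B, |deriv A u| ≤ D) {X X1 : ℝ → ℝ}
    (hX : ∀ t ∈ Ioo 0 T, HasDerivAt X (X1 t) t) {V : ℝ} (hV0 : 0 ≤ V)
    (hV : ∀ t ∈ Ioo 0 T, |X1 t| ≤ V) (hXlim : Tendsto X (𝓝[>] 0) (𝓝 0)) {R Q : ℝ} (hεR : ε ≤ R)
    (hQ : ∀ s ∈ Ioo 0 T,
      ∫ x in {x | |x - X s| ≤ R}, |U s x - shockProfile CL CR (x - X s)| ≤ Q)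
    (hQ0 : ∫ x in {x | |x - 0| ≤ R}, |U₀ x - shockProfile CL CR (x - 0)| ≤ Q)
    {t : ℝ} (ht : t ∈ Ioo 0 T) (htR : t ≤ R) :
    (CL - CR) * |X t - shockSpeed A CL CR * t| ≤ (8 * (D + V) + 58) * Q := by
  have hR : 0 < R := hε.trans_le hεR
  have hD0 : 0 ≤ D := (abs_nonneg _).trans (hD CL hCL)
  have hQn : 0 ≤ Q := (integral_nonneg fun _ => abs_nonneg _).trans hQ0
  have hCC : CL - CR ≠ 0 := by linarith
  set L := CL - CR
  set v := shockSpeed A CL CR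
  have hv : L * v = A CL - A CR := mul_div_cancel₀ _ hCC
  have hmS : ∀ a, Measurable fun x => shockProfile CL CR (x - a) := fun a =>
    (measurable_shockProfile CL CR).comp (measurable_id.sub_const a)
  have hSB : ∀ y, |shockProfile CL CR y| ≤ B := fun y => abs_le.2 (shockProfile_mem hCL hCR y)
  have hdint : ∀ (u : ℝ → ℝ) (a : ℝ), AEStronglyMeasurable u volume → (∀ᵐ x, |u x| ≤ B) →
      IntegrableOn (fun x => u x - shockProfile CL CR (x - a)) {x | |x - a| ≤ R} := by
    intro u a hu hub
    rw [setOf_abs_sub_le]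
    refine Measure.integrableOn_of_bounded (M := 2 * B) (by simp)
      (hu.sub (hmS a).aestronglyMeasurable) (ae_restrict_of_ae ?_)
    filter_upwards [hub] with x hx
    have := abs_sub (u x) (shockProfile CL CR (x - a))
    rw [Real.norm_eq_abs]
    linarith [hSB (x - a)]
  have hUm : ∀ s ∈ Ioo 0 T, AEStronglyMeasurable (U s) volume := fun s hs =>
    (hU.continuous_space hs).aestronglyMeasurable
  have hUd := fun s hs => hdint (U s) (X s) (hUm s hs) (Eventually.of_forall (hB s hs))
  have hψ1 := fun y => abs_cutoffD_le_div hR y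
  have hψ2 := fun y => abs_cutoffDD_le_div hR y
  have hzero : ∀ (u : ℝ → ℝ) (a : ℝ), AEStronglyMeasurable u volume → (∀ᵐ x, |u x| ≤ B) →
      ∫ x in {x | |x - a| ≤ R}, |u x - shockProfile CL CR (x - a)| ≤ Q →
      |(∫ x, u x * cutoff R (x - a)) - ∫ x, shockProfile CL CR x * cutoff R x| ≤ Q := by
    intro u a hu hub hq
    have iψ : Integrable fun x => cutoff R (x - a) :=
      (integrable_cutoff hR).comp_sub_right a
    have i1 : Integrable fun x => u x * cutoff R (x - a) := iψ.bdd_mul (c := B) hu hub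
    have i2 : Integrable fun x => shockProfile CL CR (x - a) * cutoff R (x - a) :=
      iψ.bdd_mul (c := B) (hmS a).aestronglyMeasurable (Eventually.of_forall fun x => hSB _)
    rw [← integral_sub_right_eq_self (fun x => shockProfile CL CR x * cutoff R x) a,
      ← integral_sub i1 i2]
    refine (abs_integral_le_mul_setIntegral (k := 1) (hdint u a hu hub)
      (Eventually.of_forall fun x => ?_) fun x hx => ?_).trans ((one_mul _).trans_le hq)
    · rw [← sub_mul, abs_mul, one_mul, abs_of_nonneg (cutoff_nonneg _ _)]
      exact mul_le_of_le_one_right (abs_nonneg _) (cutoff_le_one _ _)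
    · rw [cutoff_eq_zero hR hx]; simp
  set F : ℝ → ℝ := fun s => ∫ x, U s x * cutoff R (x - X s)
  -- For an exact shock the flux term would contribute `L (v - X')` by the Rankine–Hugoniot
  -- relation. Subtracting its primitive leaves only the discrepancy `Δ` between the solution and
  -- the shifted shock as the derivative of `f`.
  set f : ℝ → ℝ := fun s => F s - L * (v * s - X s)
  set Δ : ℝ → ℝ := fun s => ∫ x, (((A (U s x) - A (shockProfile CL CR (x - X s)))
    - X1 s * (U s x - shockProfile CL CR (x - X s))) * cutoffD R (x - X s)
    + ε * (U s x - shockProfile CL CR (x - X s)) * cutoffDD R (x - X s))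
  have hΔ : ∀ s ∈ Ioo 0 T, |Δ s| ≤ (8 * (D + V) + 56) / R * Q := by
    intro s hs
    refine (abs_integral_le_mul_setIntegral (hUd s hs) (Eventually.of_forall fun x => ?_)
      fun x hx => ?_).trans (mul_le_mul_of_nonneg_left (hQ s hs) (by positivity))
    · set S := shockProfile CL CR (x - X s)
      have h1 : |A (U s x) - A S| ≤ D * |U s x - S| :=
        abs_sub_le_of_hasDerivAt (fun u => hA.hasDerivAt_of_two u) (convex_Icc (-B) B) hD
          (abs_le.1 (hB s hs x)) (shockProfile_mem hCL hCR _)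
      have h2 : |X1 s * (U s x - S)| ≤ V * |U s x - S| := by
        rw [abs_mul]; exact mul_le_mul_of_nonneg_right (hV s hs) (abs_nonneg _)
      have h3 : |(A (U s x) - A S) - X1 s * (U s x - S)| ≤ (D + V) * |U s x - S| :=
        (abs_sub _ _).trans (by linarith)
      have h4 : ε * (56 / R ^ 2) ≤ 56 / R := by
        rw [mul_div_assoc', div_le_div_iff₀ (by positivity) hR]
        nlinarith [mul_le_mul_of_nonneg_right hεR hR.le]
      refine (abs_add_le _ _).trans ?_
      rw [abs_mul, abs_mul, abs_mul, abs_of_pos hε]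
      have h5 := mul_le_mul h3 (hψ1 (x - X s)) (abs_nonneg _) (by positivity)
      have h6 := mul_le_mul_of_nonneg_left (hψ2 (x - X s))
        (by positivity : 0 ≤ ε * |U s x - S|)
      have h7 := mul_le_mul_of_nonneg_right h4 (abs_nonneg (U s x - S))
      have e : (8 * (D + V) + 56) / R * |U s x - S|
          = (D + V) * |U s x - S| * (8 / R) + 56 / R * |U s x - S| := by ring
      rw [e]
      linarith
    · rw [cutoffD_eq_zero hR hx, cutoffDD_eq_zero hR hx]; simp
  have hder : ∀ s ∈ Ioo 0 T, HasDerivAt f (Δ s) s := by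
    intro s hs
    have h1 := hasDerivAt_integral_mul_weight hA hU (h := fun u => u)
      (h1 := fun _ => 1) (h2 := fun _ => 0) (Q := A) (fun u => hasDerivAt_id u)
      (fun u => hasDerivAt_const _ _) continuous_const
      (fun u => (one_mul (deriv A u)).symm ▸ (hA.differentiable (by norm_num) u).hasDerivAt)
      (hasDerivAt_cutoff R) (hasDerivAt_cutoffD R) (continuous_cutoffDD R)
      (fun y hy => cutoff_eq_zero hR hy) (fun y hy => cutoffD_eq_zero hR hy)
      (fun y hy => cutoffDD_eq_zero hR hy) hX hV hs
    refine (h1.sub ((((hasDerivAt_id s).const_mul v).sub (hX s hs)).const_mul L)).congr_deriv ?_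
    obtain ⟨j1, k1⟩ := integral_shockProfile_mul_deriv (hasDerivAt_cutoff R)
      (continuous_cutoffD R) (fun y hy => cutoff_eq_zero hR hy)
      (fun y hy => cutoffD_eq_zero hR hy) (fun u => A u - X1 s * u) CL CR (X s)
    obtain ⟨j2, k2⟩ := integral_shockProfile_mul_deriv (hasDerivAt_cutoffD R)
      (continuous_cutoffDD R) (fun y hy => cutoffD_eq_zero hR hy)
      (fun y hy => cutoffDD_eq_zero hR hy) (fun u => ε * u) CL CR (X s)
    rw [cutoff_zero] at k1
    rw [cutoffD_zero, mul_zero] at k2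
    have cU := hU.continuous_space hs
    have i : Integrable fun x => (A (U s x) - X1 s * U s x) * cutoffD R (x - X s)
        + ε * U s x * cutoffDD R (x - X s) := by
      refine Integrable.add ?_ ?_
      · exact ((((hA.continuous.comp cU).sub (continuous_const.mul cU)).mul
          ((continuous_cutoffD R).comp (by fun_prop))).integrable_of_hasCompactSupport
          (hasCompactSupport_comp_sub (fun y hy => cutoffD_eq_zero hR hy) (X s)).mul_left)
      · exact (((continuous_const.mul cU).mul
          ((continuous_cutoffDD R).comp (by fun_prop))).integrable_of_hasCompactSupport
          (hasCompactSupport_comp_sub (fun y hy => cutoffDD_eq_zero hR hy) (X s)).mul_left)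
    have e : Δ s = (∫ x, ((A (U s x) - X1 s * U s x) * cutoffD R (x - X s)
        + ε * U s x * cutoffDD R (x - X s)))
        - ((∫ x, (A (shockProfile CL CR (x - X s)) - X1 s * shockProfile CL CR (x - X s))
            * cutoffD R (x - X s))
          + ∫ x, ε * shockProfile CL CR (x - X s) * cutoffDD R (x - X s)) := by
      rw [← integral_add j1 j2, ← integral_sub i (by exact j1.add j2)]
      refine integral_congr_ae (Eventually.of_forall fun x => ?_)
      ring
    rw [e, k1, k2]
    simp only [mul_zero, zero_mul, sub_zero]
    have e2 : A CL - X1 s * CL - (A CR - X1 s * CR) = L * v - X1 s * L := by rw [hv]; ring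
    rw [e2]; ring
  have hflim : Tendsto f (𝓝[>] 0) (𝓝 (∫ x, U₀ x * cutoff R x)) := by
    have h1 := tendsto_integral_mul_weight hU hT hm hB hB0 (h := fun u => u) continuous_id
      (Lh := 1) (fun u _ v _ => by simp) (continuous_cutoff R) (Lχ := 8 / R)
      (fun x y => abs_sub_le_of_hasDerivAt (fun u => hasDerivAt_cutoff R u) convex_univ
        (fun u _ => hψ1 u) (mem_univ x) (mem_univ y))
      (fun y hy => cutoff_eq_zero hR hy) hXlim hR
    have h2 : Tendsto (fun s : ℝ => L * (v * s - X s)) (𝓝[>] 0) (𝓝 (L * (v * 0 - 0))) :=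
      (((tendsto_id.mono_left nhdsWithin_le_nhds).const_mul v).sub hXlim).const_mul L
    have := h1.sub h2
    simpa using this
  -- The factor `1/R` from differentiating the cutoff is compensated by the length of the time
  -- interval, at most `t ≤ R`. Comparing with the exact shock at times `t` and `0` costs `Q` each,
  -- whence the final `58`.
  have hft : |f t - ∫ x, U₀ x * cutoff R x| ≤ (8 * (D + V) + 56) * Q := by
    refine le_of_tendsto (tendsto_const_nhds.sub hflim).abs ?_
    filter_upwards [Ioo_mem_nhdsGT ht.1] with s hs
    have hs' : s ∈ Ioo 0 T := ⟨hs.1, hs.2.trans ht.2⟩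
    have h1 := Convex.norm_image_sub_le_of_norm_hasDerivWithin_le (f := f) (s := Ioo 0 T)
      (fun τ hτ => (hder τ hτ).hasDerivWithinAt) (fun τ hτ => hΔ τ hτ) (convex_Ioo 0 T) hs' ht
    rw [Real.norm_eq_abs, Real.norm_eq_abs, abs_of_pos (by linarith [hs.2] : 0 < t - s)] at h1
    refine h1.trans ?_
    have h2 : (8 * (D + V) + 56) / R * Q * (t - s) ≤ (8 * (D + V) + 56) / R * Q * R :=
      mul_le_mul_of_nonneg_left (by linarith [hs.1]) (by positivity)
    refine h2.trans (le_of_eq ?_)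
    field_simp
  have a1 := hzero (U t) (X t) (hUm t ht) (Eventually.of_forall (hB t ht)) (hQ t ht)
  have a2 := hzero U₀ 0 hm hB0 hQ0
  simp only [sub_zero] at a2
  have hL : 0 < L := sub_pos.2 hC
  rw [← abs_of_pos hL, ← abs_mul]
  have ef : f t = F t - L * (v * t - X t) := rfl
  have eF : F t = ∫ x, U t x * cutoff R (x - X t) := rfl
  rw [← eF] at a1
  rw [ef] at hft
  rw [abs_le] at *
  constructor <;> linarith [hft.1, hft.2, a1.1, a1.2, a2.1, a2.2]

end Drift

/-! ### The main theorem -/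

section Main

/-- Cauchy–Schwarz on a window of half-width `R`. -/
theorem setIntegral_abs_le_sqrt {d : ℝ → ℝ} {a R Z : ℝ} (hR : 0 < R) (hZ : 0 < Z)
    (hd : AEStronglyMeasurable d volume)
    (h : ∫⁻ x in {x | |x - a| ≤ R}, ENNReal.ofReal (d x ^ 2) ≤ ENNReal.ofReal Z) :
    ∫ x in {x | |x - a| ≤ R}, |d x| ≤ √(2 * R * Z) := by
  set Q := √(2 * R * Z)
  have hQ : 0 < Q := Real.sqrt_pos.2 (by positivity)
  have hQ2 : Q * Q = 2 * R * Z := Real.mul_self_sqrt (by positivity)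
  have i2 : IntegrableOn (fun x => d x ^ 2) {x | |x - a| ≤ R} := by
    refine ⟨(hd.pow 2).restrict, ?_⟩
    rw [hasFiniteIntegral_iff_ofReal (Eventually.of_forall fun x => sq_nonneg _)]
    exact h.trans_lt ENNReal.ofReal_lt_top
  have hZ2 : ∫ x in {x | |x - a| ≤ R}, d x ^ 2 ≤ Z := by
    rw [integral_eq_lintegral_of_nonneg_ae (Eventually.of_forall fun x => sq_nonneg _)
      (hd.pow 2).restrict]
    exact ENNReal.toReal_le_of_le_ofReal hZ.le h
  have ic : IntegrableOn (fun _ : ℝ => Q / (4 * R)) {x | |x - a| ≤ R} := by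
    rw [setOf_abs_sub_le]; exact integrableOn_const (by simp)
  have hconst : ∫ _ in {x | |x - a| ≤ R}, Q / (4 * R) = Q / 2 := by
    rw [setOf_abs_sub_le, setIntegral_const, measureReal_def, Real.volume_Icc,
      ENNReal.toReal_ofReal (by linarith), smul_eq_mul]
    field_simp; ring
  calc ∫ x in {x | |x - a| ≤ R}, |d x|
      ≤ ∫ x in {x | |x - a| ≤ R}, (R / Q * d x ^ 2 + Q / (4 * R)) := by
        refine integral_mono_of_nonneg (Eventually.of_forall fun _ => abs_nonneg _)
          ((i2.const_mul (R / Q)).add ic) (Eventually.of_forall fun x => ?_)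
        -- Young's inequality with the weight for which both halves integrate to at most `Q / 2`.
        have e : R / Q * d x ^ 2 + Q / (4 * R) - |d x| = R / Q * (|d x| - Q / (2 * R)) ^ 2 := by
          rw [sub_sq, sq_abs]; field_simp; ring
        have : 0 ≤ R / Q * (|d x| - Q / (2 * R)) ^ 2 := by positivity
        show |d x| ≤ _
        linarith
    _ = R / Q * (∫ x in {x | |x - a| ≤ R}, d x ^ 2) + Q / 2 := by
        rw [integral_add (i2.const_mul (R / Q)) ic, integral_const_mul, hconst]
    _ ≤ R / Q * Z + Q / 2 := by gcongr
    _ = Q := by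
        have : R / Q * Z = Q / 2 := by field_simp; linarith
        linarith

/-- The `L²` distance to the shifted shock on a window, from a relative entropy bound outside a
thin layer. -/
theorem lintegral_sq_le {η : ℝ → ℝ} {B lo : ℝ} (hlo : 0 < lo) {u S : ℝ → ℝ} {a w R Z : ℝ}
    (hw : 0 ≤ w)
    (hu : ∀ᵐ x, lo * (u x - S x) ^ 2 ≤ relEntropy η (u x) (S x) ∧ |u x - S x| ≤ 2 * B)
    (hZ : ∫⁻ x in {x | w ≤ |x - a|}, ENNReal.ofReal (relEntropy η (u x) (S x)) ≤
      ENNReal.ofReal Z) (hZ0 : 0 ≤ Z) :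
    ∫⁻ x in {x | |x - a| ≤ R}, ENNReal.ofReal ((u x - S x) ^ 2) ≤
      ENNReal.ofReal (lo⁻¹ * Z + 8 * B ^ 2 * w) := by
  have hsub : {x : ℝ | |x - a| ≤ R} ⊆ {x | w ≤ |x - a|} ∪ {x | |x - a| ≤ w} :=
    fun x _ => le_total w |x - a|
  refine (lintegral_mono_set hsub).trans ((lintegral_union_le _ _ _).trans ?_)
  rw [ENNReal.ofReal_add (by positivity) (by positivity)]
  refine add_le_add ?_ ?_
  · rw [ENNReal.ofReal_mul (by positivity)]
    refine le_trans ?_ (mul_le_mul_right hZ (ENNReal.ofReal lo⁻¹))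
    rw [← lintegral_const_mul' _ _ ENNReal.ofReal_ne_top]
    refine lintegral_mono_ae (ae_restrict_of_ae ?_)
    filter_upwards [hu] with x hx
    rw [← ENNReal.ofReal_mul (by positivity)]
    refine ENNReal.ofReal_le_ofReal ?_
    rw [inv_mul_eq_div, le_div_iff₀ hlo]
    linarith [hx.1]
  · calc ∫⁻ x in {x | |x - a| ≤ w}, ENNReal.ofReal ((u x - S x) ^ 2)
        ≤ ∫⁻ x in {x | |x - a| ≤ w}, ENNReal.ofReal ((2 * B) ^ 2) := by
          refine lintegral_mono_ae (ae_restrict_of_ae ?_)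
          filter_upwards [hu] with x hx
          refine ENNReal.ofReal_le_ofReal (sq_le_sq' ?_ ?_) <;>
            linarith [(abs_le.1 hx.2).1, (abs_le.1 hx.2).2]
      _ = ENNReal.ofReal (8 * B ^ 2 * w) := by
          rw [setLIntegral_const, setOf_abs_sub_le, Real.volume_Icc,
            ← ENNReal.ofReal_mul (by positivity)]
          congr 1; ring

end Main

theorem theorem1p2
    (A : ℝ → ℝ) (hA : ContDiff ℝ 2 A) (hAconv : StrictConvexOn ℝ univ A)
    (η : ℝ → ℝ) (hη : ContDiff ℝ 2 η) (hηconv : ∀ x, 0 < deriv (deriv η) x)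
    (CL CR : ℝ) (hC : CR < CL) (M K : ℝ≥0) :
    ∃ ε₀ : ℝ, 0 < ε₀ ∧ ∀ T : ℝ, 0 < T → ∃ C : ℝ, 0 < C ∧
      ∀ U₀ : ℝ → ℝ, MemLp U₀ ∞ volume → eLpNorm U₀ ∞ volume ≤ (M : ℝ≥0∞) →
      MemBVLoc U₀ →
      MemLp (fun x => U₀ x - shockProfile CL CR x) 2 volume →
      ∀ g : ℝ → ℝ, HasDerivPosPart U₀ g → MemLp g 2 volume →
        eLpNorm g 2 volume ≤ (K : ℝ≥0∞) →
      ∀ ε : ℝ, 0 < ε → ε ≤ ε₀ →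
      ∀ U : ℝ → ℝ → ℝ, IsViscousSolution A ε T U₀ U →
      ∃ X : ℝ → ℝ, X 0 = 0 ∧
        LipschitzOnWith C.toNNReal X (Icc 0 T) ∧
        (∀ᵐ t ∂(volume.restrict (Ioo 0 T)), DifferentiableAt ℝ X t ∧ |deriv X t| ≤ C) ∧
        (∀ t ∈ Ioo 0 T, ∀ α : ℝ, ε ≤ α → α ≤ ε₀ →
          IntegrableOn (fun x => relEntropy η (U t x) (shockProfile CL CR (x - X t)))
              {x | C * α ≤ |x - X t|} volume ∧
            ∫ x in {x | C * α ≤ |x - X t|},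
                relEntropy η (U t x) (shockProfile CL CR (x - X t)) ≤
              (∫ x, relEntropy η (U₀ x) (shockProfile CL CR x)) +
                C * Real.exp (-α / ε)) ∧
        (∀ t ∈ Ioo 0 T,
          |X t - shockSpeed A CL CR * t| ^ 2 ≤
            C * t ^ (2 / 3 : ℝ) *
              ((∫ x, relEntropy η (U₀ x) (shockProfile CL CR x)) +
                ε * Real.log (1 / ε))) := by
  set B : ℝ := max (M : ℝ) (max |CL| |CR|)
  have hCL : CL ∈ Icc (-B) B := abs_le.1 ((le_max_left _ _).trans (le_max_right _ _))
  have hCR : CR ∈ Icc (-B) B := abs_le.1 ((le_max_right _ _).trans (le_max_right _ _))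
  have hBnn : 0 ≤ B := M.coe_nonneg.trans (le_max_left _ _)
  obtain ⟨ε₀, c, V, P, hε₀, hε₀e, hc, hV0, hP, hmain⟩ :=
    exists_shift_lintegral_le hA hAconv hη hηconv hC hCL hCR K
  obtain ⟨lo, hi, hlo, hhi, hent⟩ := exists_relEntropy_bounds hη hηconv B
  obtain ⟨D, hD⟩ := (isCompact_Icc (a := -B) (b := B)).exists_bound_of_continuousOn
    (hA.continuous_deriv (by norm_num)).continuousOn
  have hD0 : 0 ≤ D := (norm_nonneg _).trans (hD CL hCL)
  refine ⟨ε₀, hε₀, fun T hT => ?_⟩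
  set v := shockSpeed A CL CR
  set L := CL - CR
  have hL : 0 < L := sub_pos.2 hC
  set Cz : ℝ := lo⁻¹ * (1 + P * (1 + T)) + 8 * B ^ 2 / c
  have hCz : 0 < Cz := by positivity
  set Ca : ℝ := ((8 * (D + V) + 58) / L) ^ 2 * (2 * Cz)
  set Cb : ℝ := (V + |v|) ^ 2
  -- Each summand serves one claim: the speed bound, the layer width, the exponential error, and the
  -- drift. Within the drift, `Ca` belongs to the main regime and the `Cb` terms to the two regimes
  -- where the trivial bound `(V + |v|) t` suffices.
  set C : ℝ := V + 1 / c + P * (1 + T) + (Ca + Cb + Cb * T / ε₀) * T ^ (1 / 3 : ℝ)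
  have hCa : 0 ≤ Ca := by positivity
  have hCb : 0 ≤ Cb := by positivity
  have hT3 : 0 ≤ T ^ (1 / 3 : ℝ) := Real.rpow_nonneg hT.le _
  have hCpos : 0 < C := by positivity
  have hCV : V ≤ C := by
    have : 0 ≤ 1 / c + P * (1 + T) + (Ca + Cb + Cb * T / ε₀) * T ^ (1 / 3 : ℝ) := by positivity
    simp only [C]; linarith
  have hCc : 1 / c ≤ C := by
    have : 0 ≤ V + P * (1 + T) + (Ca + Cb + Cb * T / ε₀) * T ^ (1 / 3 : ℝ) := by positivity
    simp only [C]; linarith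
  have hCP : P * (1 + T) ≤ C := by
    have : 0 ≤ V + 1 / c + (Ca + Cb + Cb * T / ε₀) * T ^ (1 / 3 : ℝ) := by positivity
    simp only [C]; linarith
  have hCT : (Ca + Cb + Cb * T / ε₀) * T ^ (1 / 3 : ℝ) ≤ C := by
    have : 0 ≤ V + 1 / c + P * (1 + T) := by positivity
    simp only [C]; linarith
  refine ⟨C, hCpos, ?_⟩
  intro U₀ hU₀ hU₀M hBV h2 g hg hg2 hgK ε hε hεε₀ U hU
  have hm := hU₀.aestronglyMeasurable
  have hB0 : ∀ᵐ x, |U₀ x| ≤ B := by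
    rw [eLpNorm_exponent_top] at hU₀M
    filter_upwards [enorm_ae_le_eLpNormEssSup U₀ volume] with x hx
    have h1 := hx.trans hU₀M
    rw [enorm_le_coe, ← NNReal.coe_le_coe, coe_nnnorm, Real.norm_eq_abs] at h1
    exact h1.trans (le_max_left _ _)
  obtain ⟨X, X1, hX0, hXL, hX, hX1, hXlim, hest⟩ :=
    hmain T hT U₀ hm hB0 hBV.1 h2 g hg hg2 hgK ε hε hεε₀ U hU
  have hlog : 1 ≤ Real.log (1 / ε) := by
    rw [one_div, Real.log_inv, le_neg]
    exact (Real.log_le_log hε (hεε₀.trans hε₀e)).trans_eq (Real.log_exp _)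
  have hε1 : ε ≤ 1 := (hεε₀.trans hε₀e).trans (by rw [Real.exp_le_one_iff]; norm_num)
  have hB : ∀ t ∈ Ioo 0 T, ∀ x, |U t x| ≤ B := fun t ht x =>
    hU.abs_le hA hε hε1 hm hBnn hB0 ht x
  set E0 := ∫ x, relEntropy η (U₀ x) (shockProfile CL CR x)
  have hE0 : 0 ≤ E0 := integral_nonneg fun x => relEntropy_nonneg hη hηconv _ _
  have hmS : ∀ a, Measurable fun x => shockProfile CL CR (x - a) := fun a =>
    (measurable_shockProfile CL CR).comp (measurable_id.sub_const a)
  refine ⟨X, hX0, hXL.weaken (Real.toNNReal_le_toNNReal hCV), ?_, fun t ht α hεα hα => ?_,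
    fun t ht => ?_⟩
  · rw [ae_restrict_iff' measurableSet_Ioo]
    exact Eventually.of_forall fun t ht =>
      ⟨(hX t ht).differentiableAt, (hX t ht).deriv ▸ (hX1 t ht).trans hCV⟩
  · have hα0 : 0 < α := hε.trans_le hεα
    have hsub : {x | C * α ≤ |x - X t|} ⊆ {x | α / c ≤ |x - X t|} := fun x hx =>
      le_trans (by
        have := mul_le_mul_of_nonneg_right hCc hα0.le
        rwa [one_div_mul_eq_div] at this) (show C * α ≤ |x - X t| from hx)
    have hlin := (lintegral_mono_set hsub).trans (hest t ht α hεα hα)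
    have hms : AEStronglyMeasurable
        (fun x => relEntropy η (U t x) (shockProfile CL CR (x - X t)))
        (volume.restrict {x | C * α ≤ |x - X t|}) :=
      ((continuous_relEntropy hη).comp_aestronglyMeasurable
        ((hU.continuous_space ht).aestronglyMeasurable.prodMk
          (hmS (X t)).aestronglyMeasurable)).restrict
    have hnn : ∀ᵐ x ∂(volume.restrict {x | C * α ≤ |x - X t|}),
        0 ≤ relEntropy η (U t x) (shockProfile CL CR (x - X t)) :=
      Eventually.of_forall fun x => relEntropy_nonneg hη hηconv _ _
    refine ⟨⟨hms, ?_⟩, ?_⟩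
    · rw [hasFiniteIntegral_iff_ofReal hnn]
      exact hlin.trans_lt ENNReal.ofReal_lt_top
    · rw [integral_eq_lintegral_of_nonneg_ae hnn hms]
      have h1 : P * (1 + t) ≤ C := le_trans (by have := ht.2.le; gcongr) hCP
      have ht0 := ht.1.le
      refine (ENNReal.toReal_le_of_le_ofReal (by positivity) hlin).trans ?_
      gcongr
  · set E := E0 + ε * Real.log (1 / ε)
    have hα0 : ε ≤ ε * Real.log (1 / ε) := le_mul_of_one_le_right hε.le hlog
    have hE : 0 < E := by simp only [E]; linarith
    have hlin : |X t - v * t| ≤ (V + |v|) * t := by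
      have h1 := hXL.dist_le_mul t ⟨ht.1.le, ht.2.le⟩ 0 ⟨le_rfl, hT.le⟩
      rw [Real.dist_eq, Real.dist_eq, hX0, sub_zero, sub_zero, Real.coe_toNNReal _ hV0,
        abs_of_pos ht.1] at h1
      have h2 := abs_sub (X t) (v * t)
      rw [abs_mul v t, abs_of_pos ht.1] at h2
      linarith
    have hsq : |X t - v * t| ^ 2 ≤ Cb * t * t := by
      rw [mul_assoc, ← sq, ← mul_pow]; exact pow_le_pow_left₀ (abs_nonneg _) hlin 2
    have ht0 := ht.1
    have key : |X t - v * t| ^ 2 ≤ (Ca + Cb + Cb * T / ε₀) * t * E := by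
      have p1 : 0 ≤ Ca * t * E := by positivity
      have p2 : 0 ≤ Cb * t * E := by positivity
      have p3 : 0 ≤ Cb * T / ε₀ * t * E := by positivity
      have e : (Ca + Cb + Cb * T / ε₀) * t * E = Ca * t * E + Cb * t * E + Cb * T / ε₀ * t * E := by
        ring
      rw [e]
      -- For `t < ε` one has `t ≤ E`, so the square of the trivial bound is already of order `t E`;
      -- the window of half-width `t` would be too narrow for the viscous term.
      rcases lt_or_ge t ε with htε | hεt
      · have : t ≤ E := by simp only [E]; linarith
        have : Cb * t * t ≤ Cb * t * E := by gcongr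
        linarith
      -- If `ε log (1/ε)` exceeds `ε₀` it is not an admissible `α`, but then `E ≥ ε₀` and `t ≤ T`
      -- gives `t ≤ T E / ε₀`.
      rcases lt_or_ge ε₀ (ε * Real.log (1 / ε)) with hbig | hα
      · have h1 : 1 ≤ E / ε₀ := by rw [one_le_div hε₀]; simp only [E]; linarith
        have h2 : Cb * t * t ≤ Cb * t * (T * (E / ε₀)) := by
          gcongr
          exact ht.2.le.trans (le_mul_of_one_le_right hT.le h1)
        have h3 : Cb * t * (T * (E / ε₀)) = Cb * T / ε₀ * t * E := by ring
        linarith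
      have hexp : Real.exp (-(ε * Real.log (1 / ε)) / ε) = ε := by
        rw [neg_div, mul_div_cancel_left₀ _ hε.ne', one_div, Real.log_inv, neg_neg,
          Real.exp_log hε]
      -- This choice balances the two errors: the layer, where only `|U - S| ≤ 2 B` is known, has
      -- width of order `α`, and the exponential error is exactly `ε`. Both are at most a multiple
      -- of `E`.
      set α := ε * Real.log (1 / ε)
      have hαnn : 0 ≤ α := hε.le.trans hα0
      have hbounds : ∀ u S : ℝ, |u| ≤ B → S ∈ Icc (-B) B →
          lo * (u - S) ^ 2 ≤ relEntropy η u S ∧ |u - S| ≤ 2 * B := by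
        intro u S hu hS
        refine ⟨(hent u (abs_le.1 hu) S hS).1, ?_⟩
        have := abs_sub u S
        have := abs_le.2 hS
        linarith
      have hQs : ∀ s ∈ Ioo 0 T,
          ∫ x in {x | |x - X s| ≤ t}, |U s x - shockProfile CL CR (x - X s)|
            ≤ √(2 * t * (Cz * E)) := by
        intro s hs
        have h1 := hest s hs α hα0 hα
        rw [hexp] at h1
        have hs0 := hs.1
        refine setIntegral_abs_le_sqrt ht0 (by positivity)
          ((hU.continuous_space hs).aestronglyMeasurable.sub
            (hmS (X s)).aestronglyMeasurable) ?_
        refine (lintegral_sq_le hlo (by positivity : 0 ≤ α / c) (Eventually.of_forall fun x =>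
          hbounds _ _ (hB s hs x) (shockProfile_mem hCL hCR _)) h1 (by positivity)).trans ?_
        refine ENNReal.ofReal_le_ofReal ?_
        have q1 : P * (1 + s) * ε ≤ P * (1 + T) * E := by
          have : ε ≤ E := by simp only [E]; linarith
          have := hs.2.le
          gcongr
        have q2 : 8 * B ^ 2 * (α / c) ≤ 8 * B ^ 2 * (E / c) := by
          have : α ≤ E := by simp only [E]; linarith
          gcongr
        have q3 : E0 + P * (1 + s) * ε ≤ (1 + P * (1 + T)) * E := by
          have : E0 ≤ E := by simp only [E]; linarith
          linarith
        have q4 := mul_le_mul_of_nonneg_left q3 (inv_pos.2 hlo).le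
        have q5 : Cz * E = lo⁻¹ * ((1 + P * (1 + T)) * E) + 8 * B ^ 2 * (E / c) := by
          simp only [Cz]; ring
        linarith
      have hQ0 : ∫ x in {x | |x - 0| ≤ t}, |U₀ x - shockProfile CL CR (x - 0)|
          ≤ √(2 * t * (Cz * E)) := by
        refine setIntegral_abs_le_sqrt ht0 (by positivity)
          (hm.sub (hmS 0).aestronglyMeasurable) ?_
        have hintg := integrable_relEntropy_shockProfile hη hηconv hCL hCR hm hB0 h2
        have h1 : ∫⁻ x in {x | 0 ≤ |x - 0|},
            ENNReal.ofReal (relEntropy η (U₀ x) (shockProfile CL CR (x - 0))) ≤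
              ENNReal.ofReal E0 := by
          simp only [sub_zero]
          refine (setLIntegral_le_lintegral _ _).trans_eq ?_
          exact (ofReal_integral_eq_lintegral_ofReal hintg
            (Eventually.of_forall fun x => relEntropy_nonneg hη hηconv _ _)).symm
        refine (lintegral_sq_le hlo le_rfl (hB0.mono fun x hx =>
          hbounds _ _ hx (shockProfile_mem hCL hCR _)) h1 hE0).trans ?_
        refine ENNReal.ofReal_le_ofReal ?_
        have q1 : lo⁻¹ * E0 ≤ Cz * E := by
          have r1 : lo⁻¹ ≤ Cz := by
            have : 0 ≤ lo⁻¹ * (P * (1 + T)) + 8 * B ^ 2 / c := by positivity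
            simp only [Cz]; linarith
          have r2 : E0 ≤ E := by simp only [E]; linarith
          gcongr
        linarith
      -- The window half-width is `t` itself, the smallest that the drift estimate allows at time
      -- `t`.
      have hdrift := abs_shift_sub_le hA hU hε hT hm hB hB0 hC hCL hCR hD hX hV0 hX1 hXlim hεt
        hQs hQ0 ht le_rfl
      have h1 : |X t - v * t| ≤ (8 * (D + V) + 58) / L * √(2 * t * (Cz * E)) := by
        rw [div_mul_eq_mul_div, le_div_iff₀ hL, mul_comm]
        exact hdrift
      have h2 := pow_le_pow_left₀ (abs_nonneg _) h1 2
      rw [mul_pow, Real.sq_sqrt (by positivity)] at h2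
      have h3 : ((8 * (D + V) + 58) / L) ^ 2 * (2 * t * (Cz * E)) = Ca * t * E := by
        simp only [Ca]; ring
      linarith
    -- The bound just obtained is linear in `t`; the excess power `t^(1/3)` is put into the constant
    -- through `T`.
    have ht3 : t ≤ T ^ (1 / 3 : ℝ) * t ^ (2 / 3 : ℝ) := by
      have h1 : t = t ^ (1 / 3 : ℝ) * t ^ (2 / 3 : ℝ) := by
        rw [← Real.rpow_add ht0]; norm_num
      have h2 : t ^ (1 / 3 : ℝ) ≤ T ^ (1 / 3 : ℝ) :=
        Real.rpow_le_rpow ht0.le ht.2.le (by norm_num)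
      calc t = t ^ (1 / 3 : ℝ) * t ^ (2 / 3 : ℝ) := h1
        _ ≤ _ := mul_le_mul_of_nonneg_right h2 (Real.rpow_nonneg ht0.le _)
    refine key.trans (mul_le_mul_of_nonneg_right ?_ hE.le)
    calc (Ca + Cb + Cb * T / ε₀) * t
        ≤ (Ca + Cb + Cb * T / ε₀) * (T ^ (1 / 3 : ℝ) * t ^ (2 / 3 : ℝ)) := by gcongr
      _ = (Ca + Cb + Cb * T / ε₀) * T ^ (1 / 3 : ℝ) * t ^ (2 / 3 : ℝ) := by ring
      _ ≤ C * t ^ (2 / 3 : ℝ) := mul_le_mul_of_nonneg_right hCT (Real.rpow_nonneg ht0.le _)
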